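/- Let $\Gamma$ be a countably infinite group. **Generating systems and graphs.** A generating system is a sequence $(\sigma_i)_{i\ge 1}$ generating $\Gamma$ such that, with $\Gamma_n=\langle\sigma_1,\dots,\sigma_n\rangle$, $\sigma_{n+1}\notin\Gamma_n$ whenever $n\ge1$ and $\Gamma_n\ne\Gamma$. $G_n$ is the graph on $\Gamma$ in which $p\neq q$ are adjacent iff $\sigma_ip=q$ or $\sigma_iq=p$ for some $1\le i\le n$; $d_{G_n}$ is its path metric ($\infty$ between components) and $B_t(G_n,x)$ its closed balls. A set $T$ is $r$-sparse if distinct points of $T$ have distance $>r$; $T$ is $S$-maximal $r$-sparse if it is maximal among $r$-sparse subsets of $S$; $T$ is an $r$-net if every point has distance $\le r$ from $T$. **Parameters.** Integers $s_m,r_m,f(m)$ $(m\ge1)$, finite sets $F_m$ with $q_m\in F_m$, and thresholds $n_T$ obey the Rules if, with $r_0=0$, $e=e_\Gamma$, $\mathcal F_m=\{0,1\}^m\times F_1\times\dots\times F_m$ and $\kappa_m=|\mathcal F_m|^{|B_{s_m}(G_{f(m)},e)|}$: $s_1=10$; $s_m<r_m<s_{m+1}$ and $f(m)<f(m+1)$;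 for $T\ge1$ and $n\ge n_T$ some $\gamma\in\Gamma_n$ has $d_{G_n}(\gamma,e)\ge T$; $s_{m+1}\ge1000r_m\kappa_m$; for every $n\ge n_{1000r_m\kappa_m}$ every $2r_m$-net $T$ of $\Gamma_n$ (in $G_n$) contains $\kappa_m$ elements $\delta$ with $\frac13s_{m+1}\le d_{G_n}(e,\delta)\le\frac23s_{m+1}$ and pairwise distances $>20r_m$; $f(m+1)>n_{1000r_m\kappa_m}$; $10^m|B_{5s_m}(G_{f(m)},e)|<|\Gamma_{f(m)}|$; $r_{m+1}\ge1000\sum_{j=1}^{m+1}(5r_{j-1}+s_j)$; $|B_{r_m/10}(G_{f(m)},e)|\ge10^m|B_{5s_m}(G_{f(m)},e)|$; $|B_{r_m}(G_{f(m)},e)|<|F_m|$. **Clean labelings.** Let $\mathcal F=\{0,1\}^{\mathbb N}\times\prod_{m\ge1}F_m$. For $\Theta:\Gamma\to\mathcal F$ let $\Theta_m$ be its $F_m$-component, $Q_m(\Theta)=\Theta_m^{-1}(q_m)$, and $\Theta_{[j]}$ its projection to $\mathcal F_j$. $\Theta$ is clean if $Q_1(\Theta)$ is a maximal $r_1$-sparse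 set in $G_{f(1)}$; for $m>1$, $Q_m(\Theta)$ is $Q_{m-1}(\Theta)$-maximal $r_m$-sparse in $G_{f(m)}$; $\Theta_m(x)\ne\Theta_m(y)$ if $0<d_{G_{f(m)}}(x,y)\le r_{m-1}$; and $d_{G_{f(m)}}(e,Q_m(\Theta))>10s_m$. The $\mathcal F_j$-labeled balls of radius $t$ around $z$ in $\Theta'$ and around $h$ in $\Theta''$ are isomorphic if $\Theta'_{[j]}(y)=\Theta''_{[j]}(yz^{-1}h)$ for all $y\in B_t(G_{f(j)},z)$. **Patching.** Patching at level $n$ with radii $(a,b)$ the balls around points $x_i$ of $\Theta^d$ into $\Theta^a$ around points $y_i$ ($i\in I$) means passing to any clean labeling $\Theta^b$ such that: all components outside $\mathcal F_n$ agree with those of $\Theta^a$; $\Theta^b_{[n]}(z)=\Theta^a_{[n]}(z)$ if $d_{G_{f(n)}}(y_i,z)\ge b$ for all $i$; and $\Theta^b_{[n]}(z)=\Theta^d_{[n]}(zy_i^{-1}x_i)$ if $d_{G_{f(n)}}(y_i,z)\le a$. Regular $n$-patching has $(a,b)=(s_n+r_{n-1},\,s_n+4r_{n-1}+1)$; supersize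 $n$-patching has $(a,b)=(3r_n,7r_n)$. **Construction.** Start with a clean labeling $\Theta^1=\Theta$. Given $\Theta^1,\dots,\Theta^n$ and, for $2\le i\le n$, labeled balls $B_i$ (the $i$-codeballs), do the following. 1. Pick $z_{n+1}\in Q_{n+1}(\Theta^n)$. Let $A$ be a set of centres representing each isomorphism type of $\mathcal F_n$-labeled balls of radius $s_n$ in $\Theta^n$ exactly once. For $a\in A$ pick $w_a\in Q_n(\Theta^n)$ with $\frac13s_{n+1}\le d_{G_{f(n+1)}}(z_{n+1},w_a)\le\frac23s_{n+1}$ and pairwise $G_{f(n+1)}$-distances $>20r_n$, and $x_a\in Q_n(\Theta^n)$ such that some $v$ with $d_{G_{f(n)}}(x_a,v)+s_n<2r_n$ has its $\mathcal F_n$-labeled $s_n$-ball in $\Theta^n$ isomorphic to the one around $a$. Let $\hat\Theta^{n+1,n+1}$ be obtained by simultaneous supersize $n$-patching of the balls of $\Theta^n$ around $x_a$ into $\Theta^n$ around $w_a$, $a\in A$. 2. For $i=n,n-1,\dots,2$ let $\hat\Theta^{n+1,i}$ be an $i$-repair of $\hat\Theta^{n+1,i+1}$. Here $\mathrm{Bad}_i(\Theta')$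 is the set of $y\in Q_i(\Theta')$ whose $\mathcal F_i$-labeled $s_i$-ball is not isomorphic to $B_i$, and an $i$-repair of $\Theta'$ is obtained by regular $i$-patching of the ball around some $x$ in $\Theta^i$, where the $\mathcal F_i$-labeled $s_i$-ball around $x$ is isomorphic to $B_i$, into $\Theta'$ around all $y\in Q_i(\Theta')$ such that $B_{s_i+r_{i-1}}(G_{f(i)},y)$ meets $\bigcup_{2\le j\le i}\mathrm{Bad}_j(\Theta')$. 3. Let $B_{n+1}$ be the $\mathcal F_{n+1}$-labeled ball of radius $s_{n+1}$ around $z_{n+1}$ in $\hat\Theta^{n+1,2}$. Let $\bar\Theta^{n+1,n+1}$ be obtained by regular $(n+1)$-patching of the ball around $z_{n+1}$ in $\hat\Theta^{n+1,2}$ into $\Theta^n$ around all points of $Q_{n+1}(\Theta^n)$; for $i=n,\dots,2$ let $\bar\Theta^{n+1,i}$ be an $i$-repair of $\bar\Theta^{n+1,i+1}$; put $\Theta^{n+1}=\bar\Theta^{n+1,2}$. **Theorem.** $\Gamma$ has a generating system. For every generating system there are parameters obeying the Rules and admitting a clean labeling. For all parameters obeying the Rules and every clean labeling $\Theta$, the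 construction can be carried out starting from $\Theta$; and however its choices are made, for each $g\in\Gamma$ the sequence $\Theta^n(g)$ is eventually constant, the limit $\Theta^\infty$ is a clean labeling, and the orbit closure of $\Theta^\infty$ in $\mathcal F^\Gamma$ (product topology, action $L_\delta(\rho)(\gamma)=\rho(\gamma\delta)$) is free and minimal. In particular every countably infinite group has a free minimal subshift of this form. -/

import Mathlib

namespace FreeMinimal

/-! ### Graphs, nets and sparse sets -/

/-- The closed ball of radius `t` around `x`; distances take the value `⊤` between different
components. -/
def ball {V : Type*} (G : SimpleGraph V) (t : ℕ) (x : V) : Set V :=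
  {y | G.edist x y ≤ t}

/-- `r`-sparse: two different points are at distance more than `r`. -/
def IsSparse {V : Type*} (G : SimpleGraph V) (r : ℕ) (T : Set V) : Prop :=
  ∀ x ∈ T, ∀ y ∈ T, x ≠ y → (r : ℕ∞) < G.edist x y

/-- `T` is an `S`-maximal `r`-sparse set. -/
def IsMaximalSparse {V : Type*} (G : SimpleGraph V) (S : Set V) (r : ℕ) (T : Set V) : Prop :=
  Maximal (fun T' : Set V => T' ⊆ S ∧ IsSparse G r T') T

section Group

variable {Γ : Type*} [Group Γ]

/-- The subgroup `Γ_n` generated by `σ_1, …, σ_n` (the value `σ 0` is never used). -/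
def subgp (σ : ℕ → Γ) (n : ℕ) : Subgroup Γ :=
  Subgroup.closure {g | ∃ i, 1 ≤ i ∧ i ≤ n ∧ g = σ i}

/-- The graph `G_n` on `Γ`: `p ≠ q` are adjacent if `σ_i p = q` or `σ_i q = p` for some
`1 ≤ i ≤ n`. -/
def cay (σ : ℕ → Γ) (n : ℕ) : SimpleGraph Γ :=
  SimpleGraph.fromRel (fun p q => ∃ i, 1 ≤ i ∧ i ≤ n ∧ σ i * p = q)

/-- `σ_1, σ_2, …` generate `Γ`, and `σ_{n+1} ∉ Γ_n` as long as `Γ_n ≠ Γ`. -/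
structure IsGeneratingSystem (σ : ℕ → Γ) : Prop where
  generates : Subgroup.closure {g | ∃ i, 1 ≤ i ∧ g = σ i} = (⊤ : Subgroup Γ)
  irredundant : ∀ n, 1 ≤ n → subgp σ n ≠ ⊤ → σ (n + 1) ∉ subgp σ n

end Group

/-! ### The numerical parameters and the rules -/

/-- The sequences `s_m, r_m, f(m), |F_m|` together with the thresholds `n_T` and the distinguished
elements `q_m`; the finite set `F_m` is `Fin (card m)`. The meaningful indices are `m ≥ 1`. -/
structure Params where
  s : ℕ → ℕ
  r : ℕ → ℕ
  f : ℕ → ℕ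
  card : ℕ → ℕ
  thr : ℕ → ℕ
  q : ∀ m, Fin (card m)

namespace Params

/-- The label space `{0,1}^ℕ × ∏ F_m`. The rules make the factor of index `0` a single point. -/
abbrev Label (P : Params) : Type := (ℕ → Bool) × (∀ m, Fin (P.card m))

variable {Γ : Type*} [Group Γ]

/-- The number of labelings of the ball of radius `s_m` in `G_{f(m)}` by the finite set
`{0,1}^m × F_1 × ⋯ × F_m`. -/
noncomputable def kap (P : Params) (σ : ℕ → Γ) (m : ℕ) : ℕ :=
  (2 ^ m * ∏ j ∈ Finset.Icc 1 m, P.card j) ^ (ball (cay σ (P.f m)) (P.s m) (1 : Γ)).ncard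

/-- The rules that the parameters have to obey. -/
structure Rules (P : Params) (σ : ℕ → Γ) : Prop where
  r_zero : P.r 0 = 0
  card_zero : P.card 0 = 1
  s_one : P.s 1 = 10
  s_lt_r : ∀ m, 1 ≤ m → P.s m < P.r m
  r_lt_s : ∀ m, 1 ≤ m → P.r m < P.s (m + 1)
  f_lt : ∀ m, 1 ≤ m → P.f m < P.f (m + 1)
  thr_spec : ∀ T, 1 ≤ T → ∀ n, P.thr T ≤ n →
    ∃ g ∈ subgp σ n, (T : ℕ∞) ≤ (cay σ n).edist g 1
  s_ge : ∀ m, 1 ≤ m → 1000 * P.r m * P.kap σ m ≤ P.s (m + 1)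
  s_spec : ∀ m, 1 ≤ m → ∀ n, P.thr (1000 * P.r m * P.kap σ m) ≤ n →
    ∀ T : Set Γ, T ⊆ subgp σ n →
      (∀ x ∈ subgp σ n, ∃ y ∈ T, (cay σ n).edist x y ≤ (2 * P.r m : ℕ)) →
      ∃ L : Finset Γ, (L : Set Γ) ⊆ T ∧ L.card = P.kap σ m ∧
        (∀ d ∈ L, (P.s (m + 1) : ℕ∞) ≤ 3 * (cay σ n).edist 1 d ∧
          3 * (cay σ n).edist 1 d ≤ (2 * P.s (m + 1) : ℕ)) ∧
        (∀ g ∈ L, ∀ d ∈ L, g ≠ d → ((20 * P.r m : ℕ) : ℕ∞) < (cay σ n).edist g d)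
  f_gt_thr : ∀ m, 1 ≤ m → P.thr (1000 * P.r m * P.kap σ m) < P.f (m + 1)
  f_large : ∀ m, 1 ≤ m →
    10 ^ m * (ball (cay σ (P.f m)) (5 * P.s m) (1 : Γ)).encard <
      (subgp σ (P.f m) : Set Γ).encard
  r_sum : ∀ m, 1 ≤ m →
    1000 * ∑ j ∈ Finset.Icc 1 (m + 1), (5 * P.r (j - 1) + P.s j) ≤ P.r (m + 1)
  r_large : ∀ m, 1 ≤ m →
    10 ^ m * (ball (cay σ (P.f m)) (5 * P.s m) (1 : Γ)).encard ≤
      (ball (cay σ (P.f m)) (P.r m / 10) (1 : Γ)).encard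
  card_large : ∀ m, 1 ≤ m → (ball (cay σ (P.f m)) (P.r m) (1 : Γ)).ncard < P.card m

/-! ### Clean labelings -/

/-- The set `Θ_m⁻¹(q_m)`. -/
def Q (P : Params) (Θ : Γ → P.Label) (m : ℕ) : Set Γ :=
  {x | (Θ x).2 m = P.q m}

/-- Clean labelings. Properness at level `m` is required at radius `r_{m-1}`, which is what
patchings at level `m` can preserve. -/
structure Clean (P : Params) (σ : ℕ → Γ) (Θ : Γ → P.Label) : Prop where
  first : IsMaximalSparse (cay σ (P.f 1)) Set.univ (P.r 1) (P.Q Θ 1)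
  next : ∀ m, 1 < m → IsMaximalSparse (cay σ (P.f m)) (P.Q Θ (m - 1)) (P.r m) (P.Q Θ m)
  proper : ∀ m, 1 ≤ m → ∀ x y : Γ, x ≠ y →
    (cay σ (P.f m)).edist x y ≤ (P.r (m - 1) : ℕ) → (Θ x).2 m ≠ (Θ y).2 m
  away : ∀ m, 1 ≤ m → ∀ x ∈ P.Q Θ m,
    ((10 * P.s m : ℕ) : ℕ∞) < (cay σ (P.f m)).edist 1 x

/-! ### Labeled balls -/

/-- Two labels have the same image in `{0,1}^j × F_1 × ⋯ × F_j`. -/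
def AgreeUpTo (P : Params) (j : ℕ) (a b : P.Label) : Prop :=
  (∀ i, i < j → a.1 i = b.1 i) ∧ ∀ m, 1 ≤ m → m ≤ j → a.2 m = b.2 m

/-- Two labels have the same image in the complementary factors. -/
def AgreeBeyond (P : Params) (j : ℕ) (a b : P.Label) : Prop :=
  (∀ i, j ≤ i → a.1 i = b.1 i) ∧ ∀ m, j < m → a.2 m = b.2 m

/-- The balls of radius `t` in `G_{f(j)}` around `z` in `Θ'` and around `h` in `Θ''` are isomorphic,
with labels taken in `{0,1}^j × F_1 × ⋯ × F_j`. -/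
def BallIso (P : Params) (σ : ℕ → Γ) (j t : ℕ)
    (Θ' : Γ → P.Label) (z : Γ) (Θ'' : Γ → P.Label) (h : Γ) : Prop :=
  ∀ y ∈ ball (cay σ (P.f j)) t z, P.AgreeUpTo j (Θ' y) (Θ'' (y * z⁻¹ * h))

/-- The ball of radius `l` around `x` in `Θ''` fully contains an isomorphic copy of the ball of
radius `l'` around `x'` in `Θ'`. -/
def FullyContains (P : Params) (σ : ℕ → Γ) (j : ℕ)
    (Θ'' : Γ → P.Label) (l : ℕ) (x : Γ) (Θ' : Γ → P.Label) (l' : ℕ) (x' : Γ) : Prop :=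
  ∃ w, (cay σ (P.f j)).edist x w + (l' : ℕ∞) < (l : ℕ∞) ∧ P.BallIso σ j l' Θ' x' Θ'' w

/-! ### Patchings -/

/-- `Θb` arises from `Θa` by simultaneously patching, for `i ∈ I`, the labeled ball of radius
`rin` in `G_{f(n)}` around `x i` in `Θd` into `Θa` around `y i`; only labels of level `≤ n` at
points at distance less than `rout` from some `y i` are changed, and `Θb` is again clean. -/
structure IsPatching (P : Params) (σ : ℕ → Γ) (n rin rout : ℕ) (Θa Θd : Γ → P.Label)
    (I : Set Γ) (x y : Γ → Γ) (Θb : Γ → P.Label) : Prop where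
  clean : P.Clean σ Θb
  beyond : ∀ z, P.AgreeBeyond n (Θb z) (Θa z)
  outside : ∀ z, (∀ i ∈ I, (rout : ℕ∞) ≤ (cay σ (P.f n)).edist (y i) z) →
    P.AgreeUpTo n (Θb z) (Θa z)
  inside : ∀ i ∈ I, ∀ z, (cay σ (P.f n)).edist (y i) z ≤ (rin : ℕ∞) →
    P.AgreeUpTo n (Θb z) (Θd (z * (y i)⁻¹ * x i))

/-- Regular `n`-patching of the ball of radius `s_n + r_{n-1}` around the point `x` of `Θd` into
`Θa` around all points of `Y`. Nothing changes at distance more than `s_n + 4 r_{n-1}` from `Y`. -/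
def IsRegularPatching (P : Params) (σ : ℕ → Γ) (n : ℕ) (Θa Θd : Γ → P.Label)
    (Y : Set Γ) (x : Γ) (Θb : Γ → P.Label) : Prop :=
  P.IsPatching σ n (P.s n + P.r (n - 1)) (P.s n + 4 * P.r (n - 1) + 1) Θa Θd Y
    (fun _ => x) (fun y => y) Θb

/-- Supersize `n`-patching of the balls of radius `3 r_n` around `x i` in `Θd` into `Θa` around
`y i`, for `i ∈ I`. -/
def IsSupersizePatching (P : Params) (σ : ℕ → Γ) (n : ℕ) (Θa Θd : Γ → P.Label)
    (I : Set Γ) (x y : Γ → Γ) (Θb : Γ → P.Label) : Prop :=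
  P.IsPatching σ n (3 * P.r n) (7 * P.r n) Θa Θd I x y Θb

/-! ### Codeballs and repairs -/

/-- The first step towards the `(n+1)`-codeball around `z`: the set `A` contains exactly one centre
of each isomorphism type of labeled balls of radius `s_n` in `Θ`; for each `a ∈ A` the ball of
radius `3 r_n` around `x a`, which contains a copy of the ball around `a`, is patched into `Θ`
around `w a`. -/
def IsInsertion (P : Params) (σ : ℕ → Γ) (n : ℕ) (Θ : Γ → P.Label) (z : Γ)
    (Θb : Γ → P.Label) : Prop :=
  ∃ (A : Set Γ) (w x : Γ → Γ),
    (∀ g, ∃! a, a ∈ A ∧ P.BallIso σ n (P.s n) Θ g Θ a) ∧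
    (∀ a ∈ A, w a ∈ P.Q Θ n ∧
      (P.s (n + 1) : ℕ∞) ≤ 3 * (cay σ (P.f (n + 1))).edist z (w a) ∧
      3 * (cay σ (P.f (n + 1))).edist z (w a) ≤ (2 * P.s (n + 1) : ℕ)) ∧
    (∀ a ∈ A, ∀ b ∈ A, a ≠ b →
      ((20 * P.r n : ℕ) : ℕ∞) < (cay σ (P.f (n + 1))).edist (w a) (w b)) ∧
    (∀ a ∈ A, x a ∈ P.Q Θ n ∧ P.FullyContains σ n Θ (2 * P.r n) (x a) Θ (P.s n) a) ∧
    P.IsSupersizePatching σ n Θ Θ A x w Θb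

/-- The set `Bad_i(Θ')`, where the `i`-codeball is the ball of radius `s_i` around `z i` in
`B i`. -/
def Bad (P : Params) (σ : ℕ → Γ) (B : ℕ → Γ → P.Label) (z : ℕ → Γ) (i : ℕ)
    (Θ' : Γ → P.Label) : Set Γ :=
  {y | y ∈ P.Q Θ' i ∧ ¬ P.BallIso σ i (P.s i) Θ' y (B i) (z i)}

/-- `Θb` is an `i`-repair of `Θ'`: the ball of radius `s_i + r_{i-1}` around some point of `Θi` at
which the `i`-codeball occurs is patched into `Θ'` around all points of `Q_i` whose ball of that
radius meets `Bad_2 ∪ ⋯ ∪ Bad_i`. -/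
def IsRepair (P : Params) (σ : ℕ → Γ) (B : ℕ → Γ → P.Label) (z : ℕ → Γ) (i : ℕ)
    (Θi Θ' Θb : Γ → P.Label) : Prop :=
  ∃ x, P.BallIso σ i (P.s i) Θi x (B i) (z i) ∧
    P.IsRegularPatching σ i Θ' Θi
      {y | y ∈ P.Q Θ' i ∧ ∃ j, 2 ≤ j ∧ j ≤ i ∧ ∃ g ∈ P.Bad σ B z j Θ',
        g ∈ ball (cay σ (P.f i)) (P.s i + P.r (i - 1)) y} x Θb

/-! ### The induction -/

/-- A sequence of labelings `Θ^1, Θ^2, …` built by the inductive construction from the labeling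
`Θ₀`, with all the auxiliary labelings and choices. For `m ≥ 2` the `m`-codeball is the ball
of radius `s_m` in `G_{f(m)}` around `z m` in `hat m 2`. -/
structure Construction (P : Params) (σ : ℕ → Γ) (Θ₀ : Γ → P.Label) where
  lab : ℕ → Γ → P.Label
  z : ℕ → Γ
  hat : ℕ → ℕ → Γ → P.Label
  bar : ℕ → ℕ → Γ → P.Label
  start : lab 1 = Θ₀
  z_mem : ∀ n, 1 ≤ n → z (n + 1) ∈ P.Q (lab n) (n + 1)
  hat_top : ∀ n, 1 ≤ n → P.IsInsertion σ n (lab n) (z (n + 1)) (hat (n + 1) (n + 1))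
  hat_repair : ∀ n, 1 ≤ n → ∀ i, 2 ≤ i → i ≤ n →
    P.IsRepair σ (fun m => hat m 2) z i (lab i) (hat (n + 1) (i + 1)) (hat (n + 1) i)
  bar_top : ∀ n, 1 ≤ n →
    P.IsRegularPatching σ (n + 1) (lab n) (hat (n + 1) 2) (P.Q (lab n) (n + 1)) (z (n + 1))
      (bar (n + 1) (n + 1))
  bar_repair : ∀ n, 1 ≤ n → ∀ i, 2 ≤ i → i ≤ n →
    P.IsRepair σ (fun m => hat m 2) z i (lab i) (bar (n + 1) (i + 1)) (bar (n + 1) i)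
  lab_succ : ∀ n, 1 ≤ n → lab (n + 1) = bar (n + 1) 2

end Params

/-! ### The Bernoulli shift -/

section Shift

variable {Γ : Type*} [Group Γ] {K : Type*}

/-- The left action `L_δ(ρ)(γ) = ρ(γδ)` on `K^Γ`. -/
def shift (δ : Γ) (ρ : Γ → K) : Γ → K := fun γ => ρ (γ * δ)

/-- The closure of the orbit of `ρ` in the product topology. -/
def orbitClosure [TopologicalSpace K] (ρ : Γ → K) : Set (Γ → K) :=
  closure (Set.range (fun δ : Γ => shift δ ρ))

/-- The shift action is free on `X`. -/
def IsFreeOn (X : Set (Γ → K)) : Prop :=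
  ∀ ρ ∈ X, ∀ δ : Γ, shift δ ρ = ρ → δ = 1

/-- `X` is a minimal subshift: nonempty, closed, invariant, and all its orbits are dense in it. -/
def IsMinimalSubshift [TopologicalSpace K] (X : Set (Γ → K)) : Prop :=
  X.Nonempty ∧ IsClosed X ∧ (∀ δ : Γ, ∀ ρ ∈ X, shift δ ρ ∈ X) ∧ ∀ ρ ∈ X, X ⊆ orbitClosure ρ

end Shift

end FreeMinimal

open FreeMinimal

/-! Freeness comes from properness of the labels, minimality from repetition, and the work lies in
creating repetition by patching without losing properness.

Freeness. Every `δ ≠ 1` has length at most `r_n` in `G_{f(n+1)}` for some `n`. Properness at level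
`n + 1` then separates the labels at `ε` and `δε` for every `ε`, and a difference in a finite
coordinate survives in the orbit closure (`Clean.isFreeOn`).

Minimality. It suffices that the labeled `s_n`-ball at the identity recurs within a bounded distance
of every point of the limit (`Construction.exists_recurrence`). The `(n+1)`-codeball contains a copy
of every labeled `s_n`-ball of `Θ^n` (`Stage.exists_copy`). From stage `n + 1` on, every point of
`Q_{n+1}` is the centre of such a codeball (`Stage.good`), and `Q_{n+1}` is a net (`Clean.net`).

Patching. Two maximal sparse sets can be glued across an annulus of width `3r`
(`exists_patched_sparse`). Doing this level by level, with radii that shrink as the level rises,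
gives the new sets `Q_m`. All other labels in the annuli are found greedily, as there are more
labels than points in the relevant balls (`exists_coloring`). Together this is `exists_patching`.

Repairs. A patch at a high level spoils codeballs of lower levels only near its boundary. An
`i`-repair restores the codeballs at all points of `Q_i` and keeps the remaining bad points away
from them (`IsRepair.spec`). Later repairs act only near bad points, and the total distance over
which damage spreads, `loss`, is tiny compared with `r_n` (`IsChain.eq_of_near`). The same estimate
shows that inserted copies survive the repairs and that stage `n` leaves a ball around the identity
untouched, since `Q_{n+1}` avoids it (`Stage.lab_eq`); this gives convergence.

Parameters. Either some `Γ_n` is infinite or `|Γ_n|` grows exponentially, whereas balls of fixed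
radius grow polynomially in `n` (`growth`). Hence each level can be chosen large enough after the
preceding ones. -/

namespace FreeMinimal
open scoped Pointwise

/-! ### Word metrics of the graphs `G_n` -/

section WordMetric

variable {Γ : Type*} [Group Γ] {σ : ℕ → Γ} {n k s t : ℕ} {x y z : Γ}

/-- The distance of `x` and `y` in `G_n` is at most `t`. -/
def Near (σ : ℕ → Γ) (n t : ℕ) (x y : Γ) : Prop := (cay σ n).edist x y ≤ (t : ℕ∞)

/-- The generators of `Γ_n` with their inverses and the identity. -/
def gens (σ : ℕ → Γ) (n : ℕ) : Set Γ :=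
  {g | g = 1 ∨ ∃ i, 1 ≤ i ∧ i ≤ n ∧ (g = σ i ∨ g = (σ i)⁻¹)}

theorem mem_ball : y ∈ ball (cay σ n) t x ↔ Near σ n t x y := Iff.rfl

theorem one_mem_gens : (1 : Γ) ∈ gens σ n := Or.inl rfl

theorem mem_gens_of_adj (h : (cay σ n).Adj x y) : y * x⁻¹ ∈ gens σ n := by
  rw [cay, SimpleGraph.fromRel_adj] at h
  rcases h.2 with ⟨i, h1, h2, h3⟩ | ⟨i, h1, h2, h3⟩
  · exact Or.inr ⟨i, h1, h2, Or.inl (by rw [← h3]; group)⟩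
  · exact Or.inr ⟨i, h1, h2, Or.inr (by rw [← h3]; group)⟩

theorem near_one_of_mem_gens (h : y * x⁻¹ ∈ gens σ n) : (cay σ n).edist x y ≤ 1 := by
  rw [SimpleGraph.edist_le_one_iff_adj_or_eq]
  by_cases hxy : x = y
  · exact Or.inr hxy
  left
  rw [cay, SimpleGraph.fromRel_adj]
  refine ⟨hxy, ?_⟩
  rcases h with h | ⟨i, h1, h2, h3 | h3⟩
  · exact absurd (mul_inv_eq_one.1 h).symm hxy
  · exact Or.inl ⟨i, h1, h2, by rw [← h3]; group⟩
  · refine Or.inr ⟨i, h1, h2, ?_⟩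
    have := inv_eq_iff_eq_inv.2 h3
    rw [← this]; group

theorem mem_pow_of_walk (p : (cay σ n).Walk x y) : y * x⁻¹ ∈ gens σ n ^ p.length := by
  induction p with
  | nil => simp
  | @cons u v w h p ih =>
    rw [SimpleGraph.Walk.length_cons, pow_succ]
    have := Set.mul_mem_mul ih (mem_gens_of_adj h)
    simpa [mul_assoc] using this

/-- Generators act on the left, so the distance depends only on `y * x⁻¹`. Right translations are
therefore isometries, which is what allows labeled balls to be copied from one centre to another. -/
theorem near_iff : Near σ n t x y ↔ y * x⁻¹ ∈ gens σ n ^ t := by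
  constructor
  · intro h
    have hne : (cay σ n).edist x y ≠ ⊤ := ne_top_of_le_ne_top (by simp) h
    obtain ⟨p, hp⟩ := SimpleGraph.exists_walk_of_edist_ne_top hne
    have hpt : p.length ≤ t := by
      rw [Near, ← hp] at h
      exact_mod_cast h
    exact Set.pow_subset_pow_right one_mem_gens hpt (mem_pow_of_walk p)
  · intro h
    induction t generalizing y with
    | zero =>
      have : y = x := by simpa [mul_inv_eq_one] using h
      simp [Near, this]
    | succ t ih =>
      rw [pow_succ'] at h
      obtain ⟨a, ha, b, hb, hab⟩ := Set.mem_mul.1 h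
      have h1 : Near σ n t x (b * x) := ih (by simpa using hb)
      have h2 : (cay σ n).edist (b * x) y ≤ 1 := near_one_of_mem_gens (by
        have : y * (b * x)⁻¹ = a := by
          rw [mul_inv_rev, ← mul_assoc, ← hab]; group
        rwa [this])
      calc (cay σ n).edist x y ≤ _ := SimpleGraph.edist_triangle (v := b * x)
        _ ≤ (t : ℕ∞) + 1 := add_le_add h1 h2
        _ = ((t + 1 : ℕ) : ℕ∞) := by push_cast; rfl

theorem Near.refl (σ : ℕ → Γ) (n t : ℕ) (x : Γ) : Near σ n t x x := by
  simp [Near]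

theorem Near.symm (h : Near σ n t x y) : Near σ n t y x := by
  rw [Near, SimpleGraph.edist_comm]; exact h

theorem Near.trans (h : Near σ n s x y) (h' : Near σ n t y z) : Near σ n (s + t) x z := by
  unfold Near
  push_cast
  exact SimpleGraph.edist_triangle.trans (add_le_add h h')

theorem Near.mono (h : Near σ n s x y) (hst : s ≤ t) : Near σ n t x y :=
  le_trans h (by exact_mod_cast hst)

theorem cay_mono (hnk : n ≤ k) : cay σ n ≤ cay σ k := by
  intro a b h
  rw [cay, SimpleGraph.fromRel_adj] at h ⊢
  refine ⟨h.1, ?_⟩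
  rcases h.2 with ⟨i, h1, h2, h3⟩ | ⟨i, h1, h2, h3⟩
  · exact Or.inl ⟨i, h1, h2.trans hnk, h3⟩
  · exact Or.inr ⟨i, h1, h2.trans hnk, h3⟩

theorem Near.level_mono (h : Near σ n t x y) (hnk : n ≤ k) : Near σ k t x y :=
  (SimpleGraph.edist_anti (cay_mono hnk)).trans h

theorem near_mul_right (g : Γ) : Near σ n t (x * g) (y * g) ↔ Near σ n t x y := by
  rw [near_iff, near_iff]
  have : y * g * (x * g)⁻¹ = y * x⁻¹ := by group
  rw [this]

/-- Right translations are isometries: the translate by `p⁻¹ * q`. -/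
theorem near_translate (p q : Γ) : Near σ n t (x * p⁻¹ * q) (y * p⁻¹ * q) ↔ Near σ n t x y := by
  rw [near_mul_right, near_mul_right]

theorem near_translate_center (p q : Γ) : Near σ n t q (y * p⁻¹ * q) ↔ Near σ n t p y := by
  have := near_translate (σ := σ) (n := n) (t := t) (x := p) (y := y) p q
  simpa using this

theorem edist_mul_right (g : Γ) : (cay σ n).edist (x * g) (y * g) = (cay σ n).edist x y := by
  apply eq_of_forall_ge_iff
  intro c
  induction c with
  | top => simp
  | coe t => exact near_mul_right g

theorem not_near : ¬ Near σ n t x y ↔ (t : ℕ∞) < (cay σ n).edist x y := not_le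

theorem succ_le_edist : ((t + 1 : ℕ) : ℕ∞) ≤ (cay σ n).edist x y ↔ ¬ Near σ n t x y := by
  rw [not_near]
  push_cast
  exact ENat.add_one_le_iff (by simp)

theorem gens_finite : (gens σ n).Finite := by
  have : gens σ n ⊆ {1} ∪ (σ '' Set.Icc 1 n ∪ (fun i => (σ i)⁻¹) '' Set.Icc 1 n) := by
    rintro g (h | ⟨i, h1, h2, h3 | h3⟩)
    · exact Or.inl h
    · exact Or.inr (Or.inl ⟨i, ⟨h1, h2⟩, h3.symm⟩)
    · exact Or.inr (Or.inr ⟨i, ⟨h1, h2⟩, h3.symm⟩)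
  exact Set.Finite.subset ((Set.finite_singleton _).union
    (((Set.finite_Icc 1 n).image _).union ((Set.finite_Icc 1 n).image _))) this

theorem gens_ncard_le : (gens σ n).ncard ≤ 2 * n + 1 := by
  have : gens σ n ⊆ {1} ∪ (σ '' Set.Icc 1 n ∪ (fun i => (σ i)⁻¹) '' Set.Icc 1 n) := by
    rintro g (h | ⟨i, h1, h2, h3 | h3⟩)
    · exact Or.inl h
    · exact Or.inr (Or.inl ⟨i, ⟨h1, h2⟩, h3.symm⟩)
    · exact Or.inr (Or.inr ⟨i, ⟨h1, h2⟩, h3.symm⟩)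
  have h1 := Set.ncard_image_le (Set.finite_Icc 1 n) (f := σ)
  have h2 := Set.ncard_image_le (Set.finite_Icc 1 n) (f := fun i => (σ i)⁻¹)
  have h3 : (Set.Icc 1 n).ncard = n := by
    rw [← Finset.coe_Icc, Set.ncard_coe_finset]; simp
  have h4 := Set.ncard_le_ncard this (((Set.finite_singleton _).union
    (((Set.finite_Icc 1 n).image _).union ((Set.finite_Icc 1 n).image _))))
  have h5 := Set.ncard_union_le ({1} : Set Γ)
    (σ '' Set.Icc 1 n ∪ (fun i => (σ i)⁻¹) '' Set.Icc 1 n)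
  have h6 := Set.ncard_union_le (σ '' Set.Icc 1 n) ((fun i => (σ i)⁻¹) '' Set.Icc 1 n)
  rw [Set.ncard_singleton] at h5
  omega

theorem ball_one_eq : ball (cay σ n) t (1 : Γ) = gens σ n ^ t := by
  ext g
  rw [mem_ball, near_iff]
  simp

theorem ball_eq_image : ball (cay σ n) t x = (fun g => g * x) '' (gens σ n ^ t) := by
  ext g
  rw [mem_ball, near_iff, Set.mem_image]
  constructor
  · intro h
    exact ⟨_, h, by group⟩
  · rintro ⟨a, ha, rfl⟩
    simpa using ha

theorem ball_finite : (ball (cay σ n) t x).Finite := by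
  rw [ball_eq_image]
  refine Set.Finite.image _ ?_
  induction t with
  | zero => simp
  | succ t ih =>
    rw [pow_succ]
    exact Set.Finite.mul ih gens_finite

theorem ball_ncard : (ball (cay σ n) t x).ncard = (ball (cay σ n) t (1 : Γ)).ncard := by
  rw [ball_one_eq, ball_eq_image, Set.ncard_image_of_injective _ (mul_left_injective x)]

theorem ball_ncard_le : (ball (cay σ n) t (1 : Γ)).ncard ≤ (2 * n + 1) ^ t := by
  classical
  rw [ball_one_eq, ← gens_finite.coe_toFinset, ← Finset.coe_pow, Set.ncard_coe_finset]
  refine Finset.card_pow_le.trans (Nat.pow_le_pow_left ?_ _)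
  rw [← Set.ncard_eq_toFinset_card _ gens_finite]
  exact gens_ncard_le

theorem ball_ncard_pos : 0 < (ball (cay σ n) t x).ncard :=
  (Set.ncard_pos ball_finite).2 ⟨x, Near.refl ..⟩

theorem subgp_mono (h : n ≤ k) : subgp σ n ≤ subgp σ k :=
  Subgroup.closure_mono fun _ ⟨i, h1, h2, h3⟩ => ⟨i, h1, h2.trans h, h3⟩

theorem gens_subset_subgp : gens σ n ⊆ subgp σ n := by
  rintro g (h | ⟨i, h1, h2, h3 | h3⟩)
  · rw [h]; exact one_mem _
  · rw [h3]; exact Subgroup.subset_closure ⟨i, h1, h2, rfl⟩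
  · rw [h3]; exact inv_mem (Subgroup.subset_closure ⟨i, h1, h2, rfl⟩)

theorem Near.mem_subgp (h : Near σ n t x y) : y * x⁻¹ ∈ subgp σ n := by
  have key : ∀ t, ∀ g ∈ gens σ n ^ t, g ∈ subgp σ n := by
    intro t
    induction t with
    | zero => intro g hg; rw [pow_zero, Set.mem_one] at hg; rw [hg]; exact one_mem _
    | succ t ih =>
      intro g hg
      rw [pow_succ] at hg
      obtain ⟨a, ha, b, hb, rfl⟩ := Set.mem_mul.1 hg
      exact mul_mem (ih a ha) (gens_subset_subgp hb)
  exact key t _ (near_iff.1 h)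

theorem mem_subgp_iff : x ∈ subgp σ n ↔ ∃ t, Near σ n t 1 x := by
  constructor
  · intro h
    refine Subgroup.closure_induction ?_ ?_ ?_ ?_ h
    · rintro g ⟨i, h1, h2, rfl⟩
      exact ⟨1, near_iff.2 (by
        rw [inv_one, mul_one, pow_one]; exact Or.inr ⟨i, h1, h2, Or.inl rfl⟩)⟩
    · exact ⟨0, Near.refl ..⟩
    · rintro a b - - ⟨s, hs⟩ ⟨t, ht⟩
      have h1 : Near σ n s b (a * b) := by simpa using (near_mul_right b).2 hs
      exact ⟨t + s, ht.trans h1⟩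
    · rintro a - ⟨s, hs⟩
      have : Near σ n s a⁻¹ 1 := by simpa using (near_mul_right a⁻¹).2 hs
      exact ⟨s, this.symm⟩
  · rintro ⟨t, h⟩
    simpa using h.mem_subgp

theorem exists_subgp (hσ : IsGeneratingSystem σ) (x : Γ) : ∃ n, x ∈ subgp σ n := by
  have hx : x ∈ Subgroup.closure {g | ∃ i, 1 ≤ i ∧ g = σ i} := by
    rw [hσ.generates]; trivial
  refine Subgroup.closure_induction ?_ ?_ ?_ ?_ hx
  · rintro g ⟨i, h1, rfl⟩
    exact ⟨i, Subgroup.subset_closure ⟨i, h1, le_rfl, rfl⟩⟩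
  · exact ⟨0, one_mem _⟩
  · rintro a b - - ⟨s, hs⟩ ⟨t, ht⟩
    exact ⟨max s t, mul_mem (subgp_mono (le_max_left ..) hs) (subgp_mono (le_max_right ..) ht)⟩
  · rintro a - ⟨s, hs⟩
    exact ⟨s, inv_mem hs⟩

theorem exists_near (hσ : IsGeneratingSystem σ) (x y : Γ) :
    ∃ n t, ∀ m ≥ n, Near σ m t x y := by
  obtain ⟨n, hn⟩ := exists_subgp hσ (y * x⁻¹)
  obtain ⟨t, ht⟩ := mem_subgp_iff.1 hn
  refine ⟨n, t, fun m hm => ?_⟩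
  have := (near_mul_right x).2 ht
  exact Near.level_mono (by simpa using this) hm

end WordMetric

/-! ### Maximal sparse sets -/

section Sparse

variable {Γ : Type*} [Group Γ] {σ : ℕ → Γ} {n r : ℕ} {S T : Set Γ}

theorem isSparse_iff :
    IsSparse (cay σ n) r T ↔ ∀ x ∈ T, ∀ y ∈ T, Near σ n r x y → x = y := by
  refine ⟨fun h x hx y hy hn => ?_, fun h x hx y hy hne => ?_⟩
  · by_contra hne
    exact not_near.2 (h x hx y hy hne) hn
  · exact not_near.1 fun hn => hne (h x hx y hy hn)

/-- Turns maximality into domination, a condition that can be checked inside balls of radius `r`.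
Gluing and limits of maximal sparse sets both rest on this local form. -/
theorem isMaximalSparse_iff :
    IsMaximalSparse (cay σ n) S r T ↔
      T ⊆ S ∧ (∀ x ∈ T, ∀ y ∈ T, Near σ n r x y → x = y) ∧ ∀ x ∈ S, ∃ y ∈ T, Near σ n r x y := by
  constructor
  · rintro ⟨⟨h1, h2⟩, h3⟩
    rw [isSparse_iff] at h2
    refine ⟨h1, h2, fun x hx => ?_⟩
    by_contra! hcon
    have hins : insert x T ⊆ S ∧ IsSparse (cay σ n) r (insert x T) := by
      refine ⟨Set.insert_subset hx h1, isSparse_iff.2 ?_⟩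
      rintro a (rfl | ha) b (rfl | hb) hab
      · rfl
      · exact absurd hab (hcon b hb)
      · exact absurd hab.symm (hcon a ha)
      · exact h2 a ha b hb hab
    have hxT : x ∈ T := h3 hins (Set.subset_insert ..) (Set.mem_insert ..)
    exact hcon x hxT (Near.refl ..)
  · rintro ⟨h1, h2, h3⟩
    refine ⟨⟨h1, isSparse_iff.2 h2⟩, ?_⟩
    rintro T' ⟨h4, h5⟩ hle x hx
    rw [isSparse_iff] at h5
    obtain ⟨y, hy, hxy⟩ := h3 x (h4 hx)
    rw [h5 x hx y (hle hy) hxy]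
    exact hy

theorem exists_isMaximalSparse {T₀ : Set Γ} (hT : T₀ ⊆ S)
    (hs : ∀ x ∈ T₀, ∀ y ∈ T₀, Near σ n r x y → x = y) :
    ∃ T, T₀ ⊆ T ∧ IsMaximalSparse (cay σ n) S r T := by
  refine zorn_subset_nonempty {T' | T' ⊆ S ∧ IsSparse (cay σ n) r T'} ?_ T₀
    ⟨hT, isSparse_iff.2 hs⟩
  intro c hc hchain hne
  refine ⟨⋃₀ c, ⟨Set.sUnion_subset fun t ht => (hc ht).1, isSparse_iff.2 ?_⟩,
    fun s hs => Set.subset_sUnion_of_mem hs⟩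
  rintro x ⟨a, ha, hxa⟩ y ⟨b, hb, hyb⟩ hxy
  rcases hchain.total ha hb with h | h
  · exact isSparse_iff.1 (hc hb).2 x (h hxa) y hyb hxy
  · exact isSparse_iff.1 (hc ha).2 x hxa y (h hyb) hxy

end Sparse

end FreeMinimal

namespace FreeMinimal

namespace Params

variable {Γ : Type*} [Group Γ] {P : Params} {σ : ℕ → Γ}

/-! ### Numerical consequences of the rules -/

section Rules

theorem Rules.card_pos (R : P.Rules σ) (m : ℕ) : 0 < P.card m := by
  rcases Nat.eq_zero_or_pos m with rfl | hm
  · rw [R.card_zero]; exact one_pos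
  · exact (Nat.zero_le _).trans_lt (R.card_large m hm)

theorem Rules.kap_pos (R : P.Rules σ) (m : ℕ) : 0 < P.kap σ m :=
  pow_pos (Nat.mul_pos (pow_pos two_pos _) (Finset.prod_pos fun j _ => R.card_pos j)) _

/-- Otherwise `r_m / 10 ≤ 5 s_m`, and a ball of the smaller radius would have at least `10^m` times
as many points as a ball containing it. -/
theorem Rules.s_le_r (R : P.Rules σ) {m : ℕ} (hm : 1 ≤ m) : 50 * P.s m + 10 ≤ P.r m := by
  by_contra! hlt
  have h1 := R.r_large m hm
  have h2 : ball (cay σ (P.f m)) (P.r m / 10) (1 : Γ) ⊆ ball (cay σ (P.f m)) (5 * P.s m) 1 :=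
    fun g hg => Near.mono hg (by omega)
  have h3 := h1.trans (Set.encard_le_encard h2)
  rw [← (ball_finite (σ := σ)).cast_ncard_eq] at h3
  have h4 : 10 ^ m * (ball (cay σ (P.f m)) (5 * P.s m) (1 : Γ)).ncard ≤
    (ball (cay σ (P.f m)) (5 * P.s m) (1 : Γ)).ncard := by exact_mod_cast h3
  have h5 : 0 < (ball (cay σ (P.f m)) (5 * P.s m) (1 : Γ)).ncard := ball_ncard_pos
  have h6 : 1 < 10 ^ m := Nat.one_lt_pow (by omega) (by norm_num)
  nlinarith

theorem Rules.r_le_s (R : P.Rules σ) {m : ℕ} (hm : 1 ≤ m) : 1000 * P.r m ≤ P.s (m + 1) :=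
  (Nat.le_mul_of_pos_right _ (R.kap_pos m)).trans (R.s_ge m hm)

theorem Rules.r_succ (R : P.Rules σ) (m : ℕ) : 1000 * P.r m ≤ P.r (m + 1) := by
  rcases Nat.eq_zero_or_pos m with rfl | hm
  · simp [R.r_zero]
  · exact (R.r_le_s hm).trans (R.s_lt_r (m + 1) (by omega)).le

theorem Rules.r_mono (R : P.Rules σ) : Monotone P.r :=
  monotone_nat_of_le_succ fun m => by have := R.r_succ m; omega

theorem Rules.s_mono (R : P.Rules σ) {m k : ℕ} (hm : 1 ≤ m) (hk : m ≤ k) : P.s m ≤ P.s k := by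
  induction k, hk using Nat.le_induction with
  | base => rfl
  | succ k hk ih =>
    have h1 := R.s_lt_r k (by omega)
    have h2 := R.r_lt_s k (by omega)
    omega

theorem Rules.f_mono (R : P.Rules σ) {m k : ℕ} (hm : 1 ≤ m) (hk : m ≤ k) : P.f m ≤ P.f k := by
  induction k, hk using Nat.le_induction with
  | base => rfl
  | succ k hk ih => exact ih.trans (R.f_lt k (by omega)).le

theorem Rules.le_f (R : P.Rules σ) {m : ℕ} (hm : 1 ≤ m) : m ≤ P.f m + 1 := by
  induction m, hm using Nat.le_induction with
  | base => omega
  | succ k hk ih => have := R.f_lt k hk; omega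

theorem Rules.le_s (R : P.Rules σ) {m : ℕ} (hm : 1 ≤ m) : m ≤ P.s m := by
  induction m, hm using Nat.le_induction with
  | base => rw [R.s_one]; omega
  | succ k hk ih =>
    have h1 := R.s_lt_r k hk
    have h2 := R.r_lt_s k hk
    omega

theorem Rules.card_gt (R : P.Rules σ) {m : ℕ} (hm : 1 ≤ m) :
    (ball (cay σ (P.f m)) (P.r (m - 1)) (1 : Γ)).ncard < P.card m := by
  refine (Set.ncard_le_ncard ?_ ball_finite).trans_lt (R.card_large m hm)
  exact fun g hg => Near.mono hg (R.r_mono (Nat.sub_le ..))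

end Rules

/-! ### The nested sets `Q_m` of a clean labeling -/

section Clean

variable {Θ Θa Θd : Γ → P.Label}

theorem Rules.Q_zero (R : P.Rules σ) (Θ : Γ → P.Label) : P.Q Θ 0 = Set.univ := by
  have : Subsingleton (Fin (P.card 0)) := by rw [R.card_zero]; infer_instance
  ext x
  exact ⟨fun _ => trivial, fun _ => Subsingleton.elim (α := Fin (P.card 0)) _ _⟩

theorem Clean.isMaximalSparse (h : P.Clean σ Θ) (R : P.Rules σ) {m : ℕ} (hm : 1 ≤ m) :
    IsMaximalSparse (cay σ (P.f m)) (P.Q Θ (m - 1)) (P.r m) (P.Q Θ m) := by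
  rcases hm.eq_or_lt with rfl | hm
  · rw [Nat.sub_self, R.Q_zero]; exact h.first
  · exact h.next m hm

theorem Clean.sparse (h : P.Clean σ Θ) (R : P.Rules σ) {m : ℕ} (hm : 1 ≤ m) {x y : Γ}
    (hx : x ∈ P.Q Θ m) (hy : y ∈ P.Q Θ m) (hxy : Near σ (P.f m) (P.r m) x y) : x = y :=
  (isMaximalSparse_iff.1 (h.isMaximalSparse R hm)).2.1 x hx y hy hxy

theorem Clean.subset (h : P.Clean σ Θ) (R : P.Rules σ) (m : ℕ) : P.Q Θ (m + 1) ⊆ P.Q Θ m :=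
  (isMaximalSparse_iff.1 (h.isMaximalSparse R (m := m + 1) (by omega))).1

theorem Clean.anti (h : P.Clean σ Θ) (R : P.Rules σ) : Antitone (P.Q Θ) :=
  antitone_nat_of_succ_le fun m => h.subset R m

theorem Clean.dominates (h : P.Clean σ Θ) (R : P.Rules σ) {m : ℕ} (hm : 1 ≤ m) {x : Γ}
    (hx : x ∈ P.Q Θ (m - 1)) : ∃ y ∈ P.Q Θ m, Near σ (P.f m) (P.r m) x y :=
  (isMaximalSparse_iff.1 (h.isMaximalSparse R hm)).2.2 x hx

theorem Clean.not_near_one (h : P.Clean σ Θ) {m : ℕ} (hm : 1 ≤ m) {x : Γ} (hx : x ∈ P.Q Θ m) :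
    ¬ Near σ (P.f m) (10 * P.s m) 1 x :=
  not_near.2 (h.away m hm x hx)

/-- Domination only concerns points of `Q_{m-1}`. The errors of the lower levels add up to at most
`r_m / 2` because the radii grow by a factor of 1000. The slack below `2 r_m` leaves room for an
`s_m`-ball. -/
theorem Clean.net (h : P.Clean σ Θ) (R : P.Rules σ) {m : ℕ} (hm : 1 ≤ m) (x : Γ) :
    ∃ y ∈ P.Q Θ m, Near σ (P.f m) (P.r m + P.r m / 2) x y := by
  induction m, hm using Nat.le_induction with
  | base =>
    obtain ⟨y, hy, hxy⟩ := h.dominates R le_rfl (x := x) (by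
      rw [Nat.sub_self, R.Q_zero]; trivial)
    exact ⟨y, hy, hxy.mono (by omega)⟩
  | succ m hm ih =>
    obtain ⟨y, hy, hxy⟩ := ih
    obtain ⟨w, hw, hyw⟩ := h.dominates R (m := m + 1) (by omega) (x := y) hy
    have h1 := R.r_succ m
    exact ⟨w, hw, ((hxy.level_mono (R.f_lt m hm).le).trans hyw).mono (by omega)⟩

theorem Clean.Q_nonempty (h : P.Clean σ Θ) (R : P.Rules σ) {m : ℕ} (hm : 1 ≤ m) :
    (P.Q Θ m).Nonempty :=
  let ⟨y, hy, _⟩ := h.net R hm 1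
  ⟨y, hy⟩

end Clean

end Params

/-! ### Existence of patchings -/

section Patching

variable {Γ : Type*} [Group Γ] {σ : ℕ → Γ}

/-- Extension of a partial proper colouring to all of `Γ` without using the colour `q` again. -/
theorem exists_coloring [Countable Γ] {k t c : ℕ}
    (hc : (ball (cay σ k) t (1 : Γ)).ncard < c) (q : Fin c) (K : Set Γ) (col₀ : Γ → Fin c)
    (hK : ∀ x ∈ K, ∀ y ∈ K, x ≠ y → Near σ k t x y → col₀ x ≠ col₀ y) :
    ∃ col : Γ → Fin c, (∀ x ∈ K, col x = col₀ x) ∧ (∀ x, x ∉ K → col x ≠ q) ∧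
      ∀ x y, x ≠ y → Near σ k t x y → col x ≠ col y := by
  classical
  obtain ⟨e, he⟩ := exists_injective_nat Γ
  let N : Γ → Finset Γ := fun x => (ball_finite (σ := σ) (n := k) (t := t) (x := x)).toFinset.erase x
  have hN : ∀ x y, y ∈ N x ↔ y ≠ x ∧ Near σ k t x y := by
    intro x y
    simp [N, mem_ball]
  -- Greedy colouring along an enumeration. A neighbour neither prescribed nor earlier contributes
  -- only `q`, which is forbidden anyway. In total at most as many colours are forbidden as the ball
  -- has points, `q` taking the place of the centre.
  let forb : (x : Γ) → ((y : Γ) → e y < e x → Fin c) → Finset (Fin c) := fun x rec =>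
    insert q ((N x).image fun y =>
      if y ∈ K then col₀ y else if h : e y < e x then rec y h else q)
  have hforb : ∀ x rec, ∃ a, a ∉ forb x rec := by
    intro x rec
    by_contra! hall
    have h1 : (Finset.univ : Finset (Fin c)).card ≤ (forb x rec).card :=
      Finset.card_le_card fun a _ => hall a
    have h2 : (forb x rec).card ≤ (N x).card + 1 :=
      (Finset.card_insert_le ..).trans (by gcongr; exact Finset.card_image_le)
    have h3 : (N x).card + 1 = (ball (cay σ k) t (1 : Γ)).ncard := by
      rw [← ball_ncard (x := x), Finset.card_erase_add_one, ← Set.ncard_eq_toFinset_card _ ball_finite]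
      simpa [mem_ball] using Near.refl σ k t x
    simp at h1
    omega
  choose pick hpick using hforb
  let F : (x : Γ) → ((y : Γ) → e y < e x → Fin c) → Fin c := fun x rec =>
    if x ∈ K then col₀ x else pick x rec
  let wf : WellFounded (fun y x : Γ => e y < e x) := InvImage.wf e wellFounded_lt
  let col : Γ → Fin c := wf.fix F
  have hcol : ∀ x, col x = F x fun y _ => col y := fun x => wf.fix_eq F x
  have hin : ∀ x ∈ K, col x = col₀ x := fun x hx => by rw [hcol]; simp [F, hx]
  have hnot : ∀ x, x ∉ K → col x ∉ forb x fun y _ => col y := fun x hx => by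
    have : col x = pick x fun y _ => col y := by rw [hcol]; simp [F, hx]
    rw [this]; exact fun h => hpick _ _ h
  have key : ∀ x y, x ≠ y → Near σ k t x y → x ∉ K → (y ∈ K ∨ e y < e x) → col x ≠ col y := by
    intro x y hne hxy hx hy heq
    apply hnot x hx
    refine Finset.mem_insert_of_mem (Finset.mem_image.2 ⟨y, (hN x y).2 ⟨hne.symm, hxy⟩, ?_⟩)
    by_cases hyK : y ∈ K
    · simp only [hyK, if_true]; rw [heq, hin y hyK]
    · have := hy.resolve_left hyK
      simp only [hyK, if_false, this, dif_pos]; exact heq.symm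
  refine ⟨col, hin, fun x hx h => hnot x hx (h ▸ Finset.mem_insert_self ..), ?_⟩
  intro x y hne hxy
  by_cases hx : x ∈ K
  · by_cases hy : y ∈ K
    · rw [hin x hx, hin y hy]; exact hK x hx y hy hne hxy
    · exact (key y x hne.symm hxy.symm hy (Or.inl hx)).symm
  · rcases lt_trichotomy (e y) (e x) with h | h | h
    · exact key x y hne hxy hx (Or.inr h)
    · exact absurd (he h).symm hne
    · by_cases hy : y ∈ K
      · exact key x y hne hxy hx (Or.inl hy)
      · exact (key y x hne.symm hxy.symm hy (Or.inr h)).symm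

/-- One level of a patching: `Ta` and `Td` are maximal sparse sets, and a set `S` agrees with
translates of `Sd` near the points `y i` and with `Sa` far from them. -/
theorem exists_patched_sparse {k n r α α' β' : ℕ} (hkn : k ≤ n) {S Sa Sd Ta Td I : Set Γ}
    {x y : Γ → Γ}
    (hTa : IsMaximalSparse (cay σ k) Sa r Ta) (hTd : IsMaximalSparse (cay σ k) Sd r Td)
    (h1 : α + r ≤ α') (h2 : β' ≤ α + 2 * r)
    (hsep : ∀ i ∈ I, ∀ j ∈ I, Near σ n (2 * (α + r) + r) (y i) (y j) → i = j)
    (hin : ∀ i ∈ I, ∀ z, Near σ n α' (y i) z → (z ∈ S ↔ z * (y i)⁻¹ * x i ∈ Sd))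
    (hout : ∀ z, (∀ i ∈ I, ¬ Near σ n β' (y i) z) → (z ∈ S ↔ z ∈ Sa)) :
    ∃ T, IsMaximalSparse (cay σ k) S r T ∧
      (∀ i ∈ I, ∀ z, Near σ n α (y i) z → (z ∈ T ↔ z * (y i)⁻¹ * x i ∈ Td)) ∧
      ∀ z, (∀ i ∈ I, ¬ Near σ n (α + 3 * r) (y i) z) → (z ∈ T ↔ z ∈ Ta) := by
  obtain ⟨ha1, ha2, ha3⟩ := isMaximalSparse_iff.1 hTa
  obtain ⟨hd1, hd2, hd3⟩ := isMaximalSparse_iff.1 hTd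
  -- `T₁` and `T₂` are kept more than `r` apart, so their union is sparse; a maximal extension fills
  -- the annulus between them.
  let T₁ : Set Γ := {z | ∃ i ∈ I, Near σ n (α + r) (y i) z ∧ z * (y i)⁻¹ * x i ∈ Td}
  let T₂ : Set Γ := {z | z ∈ Ta ∧ ∀ i ∈ I, ¬ Near σ n (α + 2 * r) (y i) z}
  have hmix : ∀ z ∈ T₁, ∀ w ∈ T₂, ¬ Near σ k r z w := by
    rintro z ⟨i, hi, hz, -⟩ w ⟨-, hw⟩ hzw
    exact hw i hi ((hz.trans (hzw.level_mono hkn)).mono (by omega))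
  obtain ⟨T, hT0, hT⟩ := exists_isMaximalSparse (σ := σ) (n := k) (r := r) (S := S)
    (T₀ := T₁ ∪ T₂) (by
      rintro z (⟨i, hi, hz, hzd⟩ | ⟨hz, hzi⟩)
      · exact (hin i hi z (hz.mono h1)).2 (hd1 hzd)
      · exact (hout z fun i hi h => hzi i hi (h.mono h2)).2 (ha1 hz)) (by
      rintro z (hz | hz) w (hw | hw) hzw
      · obtain ⟨i, hi, hz, hzd⟩ := hz
        obtain ⟨j, hj, hw, hwd⟩ := hw
        have hij : i = j := hsep i hi j hj
          (((hz.trans (hzw.level_mono hkn)).trans hw.symm).mono (by omega))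
        subst hij
        have := hd2 _ hzd _ hwd ((near_translate _ _).2 hzw)
        simpa using this
      · exact absurd hzw (hmix z hz w hw)
      · exact absurd hzw.symm (hmix w hw z hz)
      · exact ha2 z hz.1 w hw.1 hzw)
  obtain ⟨ht1, ht2, -⟩ := isMaximalSparse_iff.1 hT
  refine ⟨T, hT, fun i hi z hz => ⟨fun hzT => ?_, fun hzd => ?_⟩,
    fun z hz => ⟨fun hzT => ?_, fun hza => ?_⟩⟩
  -- Nothing new appears within `α`: the point is dominated by a translate of a point of `Td`, which
  -- lies within `α + r`, hence in `T₁`, and sparseness identifies the two. The outer region is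
  -- treated in the same way with `Ta` and `T₂`.
  · have hzS := (hin i hi z (hz.mono (by omega))).1 (ht1 hzT)
    obtain ⟨p, hp, hzp⟩ := hd3 _ hzS
    have hp' : p * (x i)⁻¹ * y i * (y i)⁻¹ * x i = p := by group
    have hzq : Near σ k r z (p * (x i)⁻¹ * y i) := by
      rw [← near_translate (y i) (x i), hp']; exact hzp
    have hq : p * (x i)⁻¹ * y i ∈ T := hT0 (Or.inl ⟨i, hi, hz.trans (hzq.level_mono hkn), by
      rw [hp']; exact hp⟩)
    rw [ht2 z hzT _ hq hzq, hp']
    exact hp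
  · exact hT0 (Or.inl ⟨i, hi, hz.mono (by omega), hzd⟩)
  · have hzS := (hout z fun i hi h => hz i hi (h.mono (by omega))).1 (ht1 hzT)
    obtain ⟨p, hp, hzp⟩ := ha3 _ hzS
    have hpT : p ∈ T := hT0 (Or.inr ⟨hp, fun i hi h => hz i hi
      ((h.trans (hzp.symm.level_mono hkn)).mono (by omega))⟩)
    rw [ht2 z hzT _ hpT hzp]
    exact hp
  · exact hT0 (Or.inr ⟨hza, fun i hi h => hz i hi (h.mono (by omega))⟩)

end Patching

end FreeMinimal

namespace FreeMinimal
namespace Params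

variable {Γ : Type*} [Group Γ] {P : Params} {σ : ℕ → Γ} {Θa Θd : Γ → P.Label}

/-- The levels `m ≤ N` of a patching: new nested sets agreeing with the sets of `Θd` near the
points `y i` and with those of `Θa` far from them. -/
theorem exists_patched_Q (R : P.Rules σ) (hΘa : P.Clean σ Θa) (hΘd : P.Clean σ Θd)
    {n N M : ℕ} (hn : N ≤ n) (α : ℕ → ℕ) {I : Set Γ} {x y : Γ → Γ}
    (h1 : ∀ m < N, α (m + 1) + P.r (m + 1) ≤ α m)
    (h2 : ∀ m < N, α m + 3 * P.r m ≤ α (m + 1) + 2 * P.r (m + 1))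
    (hM : ∀ m ≤ N, α m + 3 * P.r m ≤ M)
    (hsep : ∀ i ∈ I, ∀ j ∈ I, Near σ (P.f n) (2 * M) (y i) (y j) → i = j) :
    ∃ T : ℕ → Set Γ, T 0 = Set.univ ∧
      (∀ m < N, IsMaximalSparse (cay σ (P.f (m + 1))) (T m) (P.r (m + 1)) (T (m + 1))) ∧
      (∀ m ≤ N, ∀ i ∈ I, ∀ z, Near σ (P.f n) (α m) (y i) z →
        (z ∈ T m ↔ z * (y i)⁻¹ * x i ∈ P.Q Θd m)) ∧
      ∀ m ≤ N, ∀ z, (∀ i ∈ I, ¬ Near σ (P.f n) (α m + 3 * P.r m) (y i) z) →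
        (z ∈ T m ↔ z ∈ P.Q Θa m) := by
  induction N with
  | zero =>
    refine ⟨fun _ => Set.univ, rfl, by simp, ?_, ?_⟩
    · intro m hm i _ z _
      rw [Nat.le_zero.1 hm, R.Q_zero]; simp
    · intro m hm z _
      rw [Nat.le_zero.1 hm, R.Q_zero]
  | succ N ih =>
    obtain ⟨T, hT0, hT1, hT2, hT3⟩ := ih (by omega) (fun m hm => h1 m (by omega))
      (fun m hm => h2 m (by omega)) (fun m hm => hM m (by omega))
    obtain ⟨T', hT', hin, hout⟩ := exists_patched_sparse (x := x) (y := y)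
      (R.f_mono (by omega) hn)
      (hΘa.isMaximalSparse R (m := N + 1) (by omega))
      (hΘd.isMaximalSparse R (m := N + 1) (by omega))
      (h1 N (by omega)) (h2 N (by omega))
      (fun i hi j hj h => hsep i hi j hj (h.mono (by
        have := hM (N + 1) le_rfl
        omega))) (hT2 N le_rfl) (hT3 N le_rfl)
    have hlt : ∀ m < N + 1, Function.update T (N + 1) T' m = T m := fun m hm =>
      Function.update_of_ne hm.ne _ _
    have heq : Function.update T (N + 1) T' (N + 1) = T' := Function.update_self ..
    refine ⟨Function.update T (N + 1) T', by rw [hlt 0 (by omega), hT0], ?_, ?_, ?_⟩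
    · intro m hm
      rcases (Nat.lt_succ_iff.1 hm).eq_or_lt with rfl | hm'
      · rw [heq, hlt m hm]; exact hT'
      · rw [hlt m hm, hlt (m + 1) (by omega)]; exact hT1 m hm'
    · intro m hm
      rcases hm.eq_or_lt with rfl | hm'
      · rw [heq]; exact hin
      · rw [hlt m hm']; exact hT2 m (by omega)
    · intro m hm
      rcases hm.eq_or_lt with rfl | hm'
      · rw [heq]; exact hout
      · rw [hlt m hm']; exact hT3 m (by omega)

/-- The choice is `α m = a + r_{m+1} + ⋯ + r_N`: gluing at level `m + 1` costs an inner margin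
`r_{m+1}`, and the outer margin `3 r_m` of the level below fits because `r_{m+1}` is so much larger.
-/
theorem exists_radii (R : P.Rules σ) (a N : ℕ) : ∃ α : ℕ → ℕ, α N = a ∧ (∀ m ≤ N, a ≤ α m) ∧
    (∀ m < N, α (m + 1) + P.r (m + 1) ≤ α m) ∧
    (∀ m < N, α m + 3 * P.r m ≤ α (m + 1) + 2 * P.r (m + 1)) ∧
    ∀ m ≤ N, α m + 3 * P.r m ≤ a + 3 * P.r N := by
  have hα : ∀ m < N, a + ∑ l ∈ Finset.Ico (m + 1) (N + 1), P.r l =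
      a + ∑ l ∈ Finset.Ico (m + 1 + 1) (N + 1), P.r l + P.r (m + 1) := fun m hm => by
    rw [Finset.sum_eq_sum_Ico_succ_bot (by omega)]; ring
  have hstep : ∀ m < N, a + ∑ l ∈ Finset.Ico (m + 1) (N + 1), P.r l + 3 * P.r m ≤
      a + ∑ l ∈ Finset.Ico (m + 1 + 1) (N + 1), P.r l + 2 * P.r (m + 1) := fun m hm => by
    have := hα m hm
    have := R.r_succ m
    omega
  refine ⟨fun m => a + ∑ l ∈ Finset.Ico (m + 1) (N + 1), P.r l, by simp,
    fun m _ => Nat.le_add_right .., fun m hm => (hα m hm).ge, hstep, ?_⟩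
  intro m hm
  induction hm using Nat.decreasingInduction with
  | self => simp
  | of_succ m hm ih =>
    beta_reduce at ih ⊢
    have := hstep m hm
    omega

/-- Existence of patchings: the sets `Q_m` of level `m ≤ N` are changed near the points `y i`. -/
theorem exists_patching [Countable Γ] (R : P.Rules σ) (hΘa : P.Clean σ Θa) (hΘd : P.Clean σ Θd)
    {n N : ℕ} (hN : 1 ≤ N) (hNn : N ≤ n) (hnN : n ≤ N + 1) (a : ℕ) {I : Set Γ} {x y : Γ → Γ}
    (hsep : ∀ i ∈ I, ∀ j ∈ I, Near σ (P.f n) (2 * (a + 3 * P.r N)) (y i) (y j) → i = j)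
    (haway : ∀ i ∈ I, ¬ Near σ (P.f n) (a + 3 * P.r N + 10 * P.s N) 1 (y i))
    (hzone : ∀ i ∈ I, ∀ p ∈ P.Q Θa (N + 1), Near σ (P.f n) (a + 3 * P.r N) (y i) p →
      p = y i ∧ x i ∈ P.Q Θd N)
    (hdom : ∀ i ∈ I, ∀ z, Near σ (P.f n) (a + 3 * P.r N) (y i) z →
      ∃ p ∈ P.Q Θa (N + 1), Near σ (P.f (N + 1)) (P.r (N + 1)) z p)
    (hreg : n = N + 1 → ∀ i ∈ I, ∀ z, Near σ (P.f n) a (y i) z →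
      (z ∈ P.Q Θa n ↔ z * (y i)⁻¹ * x i ∈ P.Q Θd n)) :
    ∃ Θb, P.IsPatching σ n a (a + 3 * P.r N + 1) Θa Θd I x y Θb := by
  classical
  set M := a + 3 * P.r N with hMdef
  obtain ⟨α, hαN, hαa, hα1, hα2, hα3⟩ := exists_radii R a N
  obtain ⟨T, hT0, hT1, hT2, hT3⟩ := exists_patched_Q (x := x) R hΘa hΘd hNn α hα1 hα2 hα3 hsep
  have hTin : ∀ m ≤ N, ∀ i ∈ I, ∀ z, Near σ (P.f n) a (y i) z →
      (z ∈ T m ↔ z * (y i)⁻¹ * x i ∈ P.Q Θd m) := fun m hm i hi z hz =>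
    hT2 m hm i hi z (hz.mono (hαa m hm))
  have hTout : ∀ m ≤ N, ∀ z, (∀ i ∈ I, ¬ Near σ (P.f n) M (y i) z) →
      (z ∈ T m ↔ z ∈ P.Q Θa m) := fun m hm z hz =>
    hT3 m hm z fun i hi h => hz i hi (h.mono (hα3 m hm))
  -- the new sets on all levels
  let Q' : ℕ → Set Γ := fun m => if m ≤ N then T m else P.Q Θa m
  have hQle : ∀ m ≤ N, Q' m = T m := fun m hm => if_pos hm
  have hQgt : ∀ m, N < m → Q' m = P.Q Θa m := fun m hm => if_neg hm.not_ge
  have hQin : ∀ m ≤ n, ∀ i ∈ I, ∀ z, Near σ (P.f n) a (y i) z →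
      (z ∈ Q' m ↔ z * (y i)⁻¹ * x i ∈ P.Q Θd m) := by
    intro m hm i hi z hz
    rcases le_or_gt m N with h | h
    · rw [hQle m h]; exact hTin m h i hi z hz
    · obtain rfl : m = n := by omega
      rw [hQgt m h]
      exact hreg (by omega) i hi z hz
  have hQout : ∀ m, ∀ z, (∀ i ∈ I, ¬ Near σ (P.f n) M (y i) z) → (z ∈ Q' m ↔ z ∈ P.Q Θa m) := by
    intro m z hz
    rcases le_or_gt m N with h | h
    · rw [hQle m h]; exact hTout m h z hz
    · rw [hQgt m h]
  have hmax : ∀ m, IsMaximalSparse (cay σ (P.f (m + 1))) (Q' m) (P.r (m + 1)) (Q' (m + 1)) := by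
    intro m
    rcases lt_trichotomy m N with h | rfl | h
    · rw [hQle m h.le, hQle (m + 1) h]; exact hT1 m h
    -- Here a new set meets the first unchanged one. Inside the changed zone `hzone` provides the
    -- inclusion and `hdom` the domination; outside of it nothing has changed.
    · have hold := isMaximalSparse_iff.1 (hΘa.isMaximalSparse R (m := m + 1) (by omega))
      rw [hQle m le_rfl, hQgt (m + 1) (by omega), isMaximalSparse_iff]
      refine ⟨fun p hp => ?_, hold.2.1, fun z hz => ?_⟩
      · by_cases hfar : ∀ i ∈ I, ¬ Near σ (P.f n) M (y i) p
        · exact (hTout m le_rfl p hfar).2 (hold.1 hp)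
        · push Not at hfar
          obtain ⟨i, hi, hip⟩ := hfar
          obtain ⟨rfl, hx⟩ := hzone i hi p hp hip
          exact (hTin m le_rfl i hi _ (Near.refl ..)).2 (by simpa using hx)
      · by_cases hfar : ∀ i ∈ I, ¬ Near σ (P.f n) M (y i) z
        · exact hold.2.2 z ((hTout m le_rfl z hfar).1 hz)
        · push Not at hfar
          obtain ⟨i, hi, hiz⟩ := hfar
          exact hdom i hi z hiz
    · rw [hQgt m h, hQgt (m + 1) (by omega)]
      exact hΘa.isMaximalSparse R (m := m + 1) (by omega)
  -- the labels that are prescribed near and far from the points `y i`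
  let inn : Γ → Prop := fun z => ∃ i ∈ I, Near σ (P.f n) a (y i) z
  let pre : Γ → P.Label := fun z =>
    if h : inn z then Θd (z * (y h.choose)⁻¹ * x h.choose) else Θa z
  have huniq : ∀ i ∈ I, ∀ j ∈ I, ∀ z w, Near σ (P.f n) a (y i) z → Near σ (P.f n) a (y j) w →
      Near σ (P.f n) (P.r (n - 1)) z w → i = j := by
    intro i hi j hj z w hz hw hzw
    refine hsep i hi j hj (((hz.trans hzw).trans hw.symm).mono ?_)
    have := R.r_mono (show n - 1 ≤ N by omega)
    omega
  have hpre_in : ∀ i ∈ I, ∀ z, Near σ (P.f n) a (y i) z → pre z = Θd (z * (y i)⁻¹ * x i) := by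
    intro i hi z hz
    have h : inn z := ⟨i, hi, hz⟩
    have hij : h.choose = i := huniq _ h.choose_spec.1 i hi z z h.choose_spec.2 hz (Near.refl ..)
    simp only [pre, dif_pos h, hij]
  have hpre_out : ∀ z, ¬ inn z → pre z = Θa z := fun z h => dif_neg h
  have hfar_not : ∀ z, (∀ i ∈ I, ¬ Near σ (P.f n) M (y i) z) → ¬ inn z := by
    rintro z h ⟨i, hi, hz⟩
    exact h i hi (hz.mono (by omega))
  let K : Set Γ := {z | inn z ∨ ∀ i ∈ I, ¬ Near σ (P.f n) M (y i) z}
  have hKq : ∀ m ≤ n, ∀ z ∈ K, (z ∈ Q' m ↔ (pre z).2 m = P.q m) := by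
    rintro m hm z (⟨i, hi, hz⟩ | hz)
    · rw [hpre_in i hi z hz]; exact hQin m hm i hi z hz
    · rw [hpre_out z (hfar_not z hz)]; exact hQout m z hz
  have hcol : ∀ m, 1 ≤ m → m ≤ n → ∃ col : Γ → Fin (P.card m),
      (∀ z ∈ K, col z = (pre z).2 m) ∧ (∀ z, col z = P.q m ↔ z ∈ Q' m) ∧
      ∀ z w, z ≠ w → Near σ (P.f m) (P.r (m - 1)) z w → col z ≠ col w := by
    intro m hm1 hmn
    have hfm : P.f m ≤ P.f n := R.f_mono hm1 hmn
    have hrm : P.r (m - 1) ≤ P.r (n - 1) := R.r_mono (by omega)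
    have hrN : P.r (n - 1) ≤ P.r N := R.r_mono (by omega)
    have hrm' : P.r (m - 1) ≤ P.r m := R.r_mono (by omega)
    have hsp := (isMaximalSparse_iff.1 (hmax (m - 1))).2.1
    rw [Nat.sub_add_cancel hm1] at hsp
    have hcross : ∀ z w, inn z → (∀ i ∈ I, ¬ Near σ (P.f n) M (y i) w) →
        ¬ Near σ (P.f m) (P.r (m - 1)) z w := by
      rintro z w ⟨i, hi, hz⟩ hw hzw
      exact hw i hi ((hz.trans (hzw.level_mono hfm)).mono (by omega))
    have hproperK : ∀ z ∈ K, ∀ w ∈ K, z ≠ w → Near σ (P.f m) (P.r (m - 1)) z w →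
        (pre z).2 m ≠ (pre w).2 m := by
      rintro z (hz | hz) w (hw | hw) hne hzw
      · obtain ⟨i, hi, hz⟩ := hz
        obtain ⟨j, hj, hw⟩ := hw
        obtain rfl := huniq i hi j hj z w hz hw ((hzw.level_mono hfm).mono hrm)
        rw [hpre_in i hi z hz, hpre_in i hi w hw]
        exact hΘd.proper m hm1 _ _ (by simpa using hne) ((near_translate _ _).2 hzw)
      · exact absurd hzw (hcross z w hz hw)
      · exact absurd hzw.symm (hcross w z hw hz)
      · rw [hpre_out z (hfar_not z hz), hpre_out w (hfar_not w hw)]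
        exact hΘa.proper m hm1 z w hne hzw
    -- Fixing the label `q_m` on `Q' m` beforehand and never using it for the free points makes `Q'
    -- m` exactly the fibre over `q_m`.
    obtain ⟨col, hc1, hc2, hc3⟩ := exists_coloring (R.card_gt hm1) (P.q m) (K ∪ Q' m)
      (fun z => if z ∈ Q' m then P.q m else (pre z).2 m) (by
        intro z hz w hw hne hzw
        by_cases hzQ : z ∈ Q' m
        · have hwQ : w ∉ Q' m := fun hwQ => hne (hsp z hzQ w hwQ (hzw.mono hrm'))
          have hwK := hw.resolve_right hwQ
          simp only [hzQ, hwQ, if_true, if_false]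
          exact fun h => hwQ ((hKq m hmn w hwK).2 h.symm)
        · have hzK := hz.resolve_right hzQ
          by_cases hwQ : w ∈ Q' m
          · simp only [hzQ, hwQ, if_true, if_false]
            exact fun h => hzQ ((hKq m hmn z hzK).2 h)
          · simp only [hzQ, hwQ, if_false]
            exact hproperK z hzK w (hw.resolve_right hwQ) hne hzw)
    refine ⟨col, fun z hz => ?_, fun z => ⟨fun h => ?_, fun h => ?_⟩, hc3⟩
    · rw [hc1 z (Or.inl hz)]
      by_cases hzQ : z ∈ Q' m
      · simp only [hzQ, if_true]; exact ((hKq m hmn z hz).1 hzQ).symm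
      · simp only [hzQ, if_false]
    · by_contra hzQ
      by_cases hzK : z ∈ K
      · rw [hc1 z (Or.inl hzK)] at h
        simp only [hzQ, if_false] at h
        exact hzQ ((hKq m hmn z hzK).2 h)
      · exact hc2 z (by rintro (h | h) <;> contradiction) h
    · rw [hc1 z (Or.inr h)]; simp only [h, if_true]
  choose col hcolK hcolQ hcolP using hcol
  let Θb : Γ → P.Label := fun z =>
    (fun i => if i < n then (pre z).1 i else (Θa z).1 i,
      fun m => if h : 1 ≤ m ∧ m ≤ n then col m h.1 h.2 z else (Θa z).2 m)
  have hb2 : ∀ m (h1 : 1 ≤ m) (h2 : m ≤ n) z, (Θb z).2 m = col m h1 h2 z := fun m h1 h2 z =>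
    dif_pos ⟨h1, h2⟩
  have hb2' : ∀ m, n < m → ∀ z, (Θb z).2 m = (Θa z).2 m := fun m h z =>
    dif_neg fun h' => by omega
  have hbQ : ∀ m, P.Q Θb m = Q' m := by
    intro m
    rcases Nat.eq_zero_or_pos m with rfl | hm
    · rw [R.Q_zero, hQle 0 (Nat.zero_le _), hT0]
    rcases le_or_gt m n with h | h
    · ext z
      rw [← hcolQ m hm h z, ← hb2 m hm h z]; rfl
    · rw [hQgt m (by omega)]
      ext z
      change (Θb z).2 m = _ ↔ (Θa z).2 m = _
      rw [hb2' m h]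
  have hbK : ∀ z ∈ K, P.AgreeUpTo n (Θb z) (pre z) := fun z hz =>
    ⟨fun i hi => if_pos hi, fun m h1 h2 => (hb2 m h1 h2 z).trans (hcolK m h1 h2 z hz)⟩
  refine ⟨Θb, ⟨?_, ?_, ?_, ?_⟩, ?_, ?_, ?_⟩
  · rw [hbQ, ← hT0, ← hQle 0 (Nat.zero_le _)]; exact hmax 0
  · intro m hm
    obtain ⟨m, rfl⟩ : ∃ k, m = k + 1 := ⟨m - 1, by omega⟩
    rw [hbQ, hbQ]; exact hmax m
  · intro m hm z w hne hzw
    rcases le_or_gt m n with h | h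
    · rw [hb2 m hm h, hb2 m hm h]; exact hcolP m hm h z w hne hzw
    · rw [hb2' m h, hb2' m h]; exact hΘa.proper m hm z w hne hzw
  · intro m hm z hz
    rw [← not_near]
    intro hnear
    refine hΘa.not_near_one hm ?_ hnear
    rw [hbQ] at hz
    rcases le_or_gt m N with h | h
    · refine (hQout m z fun i hi hiz => haway i hi ?_).1 hz
      have hs := R.s_mono hm h
      exact ((hnear.level_mono (R.f_mono hm (h.trans hNn))).trans hiz.symm).mono (by omega)
    · rwa [hQgt m h] at hz
  · intro z
    exact ⟨fun i hi => if_neg hi.not_gt, fun m hm => hb2' m hm z⟩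
  · intro z hz
    have hfar : ∀ i ∈ I, ¬ Near σ (P.f n) M (y i) z := fun i hi => succ_le_edist.1 (hz i hi)
    have := hbK z (Or.inr hfar)
    rwa [hpre_out z (hfar_not z hfar)] at this
  · intro i hi z hz
    have := hbK z (Or.inl ⟨i, hi, hz⟩)
    rwa [hpre_in i hi z hz] at this

end Params
end FreeMinimal

namespace FreeMinimal
namespace Params

variable {Γ : Type*} [Group Γ] {P : Params} {σ : ℕ → Γ}

/-! ### Partial agreement of labels and isomorphic balls -/

section Agree

variable {a b c : P.Label} {j k t u : ℕ}

theorem AgreeUpTo.refl (j : ℕ) (a : P.Label) : P.AgreeUpTo j a a :=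
  ⟨fun _ _ => rfl, fun _ _ _ => rfl⟩

theorem AgreeUpTo.symm (h : P.AgreeUpTo j a b) : P.AgreeUpTo j b a :=
  ⟨fun i hi => (h.1 i hi).symm, fun m h1 h2 => (h.2 m h1 h2).symm⟩

theorem AgreeUpTo.trans (h : P.AgreeUpTo j a b) (h' : P.AgreeUpTo j b c) : P.AgreeUpTo j a c :=
  ⟨fun i hi => (h.1 i hi).trans (h'.1 i hi), fun m h1 h2 => (h.2 m h1 h2).trans (h'.2 m h1 h2)⟩

theorem AgreeUpTo.mono (h : P.AgreeUpTo k a b) (hjk : j ≤ k) : P.AgreeUpTo j a b :=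
  ⟨fun i hi => h.1 i (hi.trans_le hjk), fun m h1 h2 => h.2 m h1 (h2.trans hjk)⟩

theorem AgreeBeyond.trans (h : P.AgreeBeyond j a b) (h' : P.AgreeBeyond j b c) :
    P.AgreeBeyond j a c :=
  ⟨fun i hi => (h.1 i hi).trans (h'.1 i hi), fun m h1 => (h.2 m h1).trans (h'.2 m h1)⟩

theorem AgreeBeyond.mono (h : P.AgreeBeyond j a b) (hjk : j ≤ k) : P.AgreeBeyond k a b :=
  ⟨fun i hi => h.1 i (hjk.trans hi), fun m h1 => h.2 m (hjk.trans_lt h1)⟩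

theorem Rules.label_ext (R : P.Rules σ) (h : P.AgreeUpTo j a b) (h' : P.AgreeBeyond j a b) :
    a = b := by
  refine Prod.ext (funext fun i => ?_) (funext fun m => ?_)
  · rcases lt_or_ge i j with hi | hi
    · exact h.1 i hi
    · exact h'.1 i hi
  · rcases Nat.eq_zero_or_pos m with rfl | hm
    · have : Subsingleton (Fin (P.card 0)) := by rw [R.card_zero]; infer_instance
      exact Subsingleton.elim _ _
    rcases le_or_gt m j with hi | hi
    · exact h.2 m hm hi
    · exact h'.2 m hi

variable {Θ Θ' Θ'' : Γ → P.Label} {g g' h : Γ}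

theorem ballIso_iff : P.BallIso σ j t Θ g Θ' h ↔
    ∀ b, Near σ (P.f j) t 1 b → P.AgreeUpTo j (Θ (b * g)) (Θ' (b * h)) := by
  constructor
  · intro H b hb
    have := H (b * g) (mem_ball.2 (by simpa using (near_mul_right g).2 hb))
    simpa using this
  · intro H y hy
    have := H (y * g⁻¹) (by
      rw [← near_mul_right g]; simpa using mem_ball.1 hy)
    simpa using this

theorem BallIso.trans (H : P.BallIso σ j t Θ g Θ' g') (H' : P.BallIso σ j t Θ' g' Θ'' h) :
    P.BallIso σ j t Θ g Θ'' h := by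
  rw [ballIso_iff] at H H' ⊢
  exact fun b hb => (H b hb).trans (H' b hb)

theorem BallIso.agree_center (H : P.BallIso σ j t Θ g Θ' h) : P.AgreeUpTo j (Θ g) (Θ' h) := by
  have := ballIso_iff.1 H 1 (Near.refl ..)
  simpa using this

theorem BallIso.mem_Q_iff (H : P.BallIso σ j t Θ g Θ' h) (hj : 1 ≤ j) :
    g ∈ P.Q Θ j ↔ h ∈ P.Q Θ' j := by
  change (Θ g).2 j = _ ↔ (Θ' h).2 j = _
  rw [H.agree_center.2 j hj le_rfl]

end Agree

/-! ### Regular patchings and insertions -/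

section Existence

variable {Θ Θa Θd Θb : Γ → P.Label}

theorem IsPatching.mono_out {n a b b' : ℕ} {I : Set Γ} {x y : Γ → Γ}
    (h : P.IsPatching σ n a b Θa Θd I x y Θb) (hb : b ≤ b') :
    P.IsPatching σ n a b' Θa Θd I x y Θb :=
  ⟨h.clean, h.beyond, fun z hz => h.outside z fun i hi =>
    (by exact_mod_cast hb : (b : ℕ∞) ≤ b').trans (hz i hi), h.inside⟩

theorem Rules.regular_bound (R : P.Rules σ) {n : ℕ} (hn : 1 ≤ n) :
    2 * (P.s (n + 1) + 4 * P.r n) ≤ P.r (n + 1) ∧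
      P.s (n + 1) + 4 * P.r n + 10 * P.s n ≤ 10 * P.s (n + 1) := by
  have h1 := R.s_le_r (m := n + 1) (by omega)
  have h2 := R.r_le_s hn
  have h3 := R.s_le_r hn
  omega

/-- Only the sets `Q_m` with `m < n` are rebuilt. `Q_n` can stay: by `r_n`-sparseness the patched
zone contains a single point of it, the centre, both in the source and in the target. -/
theorem exists_regularPatching [Countable Γ] (R : P.Rules σ) (hΘa : P.Clean σ Θa)
    (hΘd : P.Clean σ Θd) {n : ℕ} (hn : 2 ≤ n) {Y : Set Γ} (hY : Y ⊆ P.Q Θa n) {x : Γ}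
    (hx : x ∈ P.Q Θd n) : ∃ Θb, P.IsRegularPatching σ n Θa Θd Y x Θb := by
  obtain ⟨N, rfl⟩ : ∃ N, n = N + 1 := ⟨n - 1, by omega⟩
  have hN : 1 ≤ N := by omega
  obtain ⟨hb1, hb2⟩ := R.regular_bound hN
  obtain ⟨Θb, h⟩ := exists_patching R hΘa hΘd hN (n := N + 1) (by omega) le_rfl
    (P.s (N + 1) + P.r N) (I := Y) (x := fun _ => x) (y := fun y => y)
    (fun i hi j hj hij => hΘa.sparse R (by omega) (hY hi) (hY hj) (hij.mono (by omega)))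
    (fun i hi hi1 => hΘa.not_near_one (by omega) (hY hi) (hi1.mono (by omega)))
    (fun i hi p hp hip => ⟨(hΘa.sparse R (by omega) (hY hi) hp (hip.mono (by omega))).symm,
      hΘd.subset R N hx⟩)
    (fun i hi z hz => ⟨i, hY hi, hz.symm.mono (by omega)⟩)
    (by
      intro _ i hi z hz
      constructor
      · intro hzQ
        obtain rfl := hΘa.sparse R (by omega) (hY hi) hzQ (hz.mono (by omega))
        simpa using hx
      · intro hzQ
        have hzx : Near σ (P.f (N + 1)) (P.s (N + 1) + P.r N) x (z * i⁻¹ * x) :=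
          (near_translate_center i x).2 hz
        have heq := hΘd.sparse R (by omega) hx hzQ (hzx.mono (by omega))
        have : z = i := by
          have : z * i⁻¹ = 1 := by simpa using heq
          rwa [mul_inv_eq_one] at this
        rw [this]
        exact hY hi)
  exact ⟨Θb, h.mono_out (by simp only [Nat.add_sub_cancel]; omega)⟩

/-- The isomorphism types of labeled balls. -/
abbrev BallType (P : Params) (σ : ℕ → Γ) (n : ℕ) : Type _ :=
  ball (cay σ (P.f n)) (P.s n) (1 : Γ) → (Fin n → Bool) × (∀ j : Finset.Icc 1 n, Fin (P.card j))

/-- The isomorphism type of the labeled ball around `g`. -/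
def ballType (P : Params) (σ : ℕ → Γ) (n : ℕ) (Θ : Γ → P.Label) (g : Γ) : P.BallType σ n :=
  fun b => (fun i => (Θ (b * g)).1 i, fun j => (Θ (b * g)).2 j)

theorem ballType_eq_iff {n : ℕ} {g h : Γ} :
    P.ballType σ n Θ g = P.ballType σ n Θ h ↔ P.BallIso σ n (P.s n) Θ g Θ h := by
  rw [ballIso_iff]
  constructor
  · intro H b hb
    have := congrFun H ⟨b, hb⟩
    refine ⟨fun i hi => congrFun (congrArg Prod.fst this) ⟨i, hi⟩, fun m h1 h2 => ?_⟩
    exact congrFun (congrArg Prod.snd this) ⟨m, Finset.mem_Icc.2 ⟨h1, h2⟩⟩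
  · intro H
    funext b
    refine Prod.ext (funext fun i => (H b b.2).1 i i.2) (funext fun j => ?_)
    exact (H b b.2).2 j (Finset.mem_Icc.1 j.2).1 (Finset.mem_Icc.1 j.2).2

theorem card_ballType (P : Params) (σ : ℕ → Γ) (n : ℕ) :
    Nat.card (P.BallType σ n) = P.kap σ n := by
  have : Finite (ball (cay σ (P.f n)) (P.s n) (1 : Γ)) := ball_finite.to_subtype
  rw [Nat.card_fun, Nat.card_coe_set_eq, Nat.card_prod, Nat.card_fun, Nat.card_pi, kap]
  simp only [Nat.card_eq_fintype_card, Fintype.card_bool, Fintype.card_fin]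
  rw [Finset.prod_coe_sort (Finset.Icc 1 n) P.card]

theorem le_div_three {e : ℕ∞} {m : ℕ} (h : 3 * e ≤ (m : ℕ∞)) : e ≤ ((m / 3 : ℕ) : ℕ∞) := by
  induction e with
  | top => simp at h
  | coe t =>
    have : 3 * t ≤ m := by exact_mod_cast h
    exact_mod_cast (by omega : t ≤ m / 3)

/-- Translating by `z⁻¹` moves the part of `Q_n` in the component of `z` to a `2 r_n`-net of
`Γ_{f(n+1)}`, to which the net rule applies; `kap` counts exactly the ball types. -/
theorem exists_insertion_points (R : P.Rules σ) (hΘ : P.Clean σ Θ) {n : ℕ} (hn : 1 ≤ n) (z : Γ) :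
    ∃ w : P.BallType σ n → Γ, (∀ a, w a ∈ P.Q Θ n ∧
      (P.s (n + 1) : ℕ∞) ≤ 3 * (cay σ (P.f (n + 1))).edist z (w a) ∧
      3 * (cay σ (P.f (n + 1))).edist z (w a) ≤ (2 * P.s (n + 1) : ℕ)) ∧
    ∀ a b, a ≠ b → ((20 * P.r n : ℕ) : ℕ∞) < (cay σ (P.f (n + 1))).edist (w a) (w b) := by
  obtain ⟨L, hL1, hL2, hL3, hL4⟩ := R.s_spec n hn (P.f (n + 1)) (R.f_gt_thr n hn).le
    {d | d ∈ subgp σ (P.f (n + 1)) ∧ d * z ∈ P.Q Θ n} (fun d hd => hd.1) (by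
      intro x hx
      obtain ⟨y, hy, hxy⟩ := hΘ.net R hn (x * z)
      have hxy' : Near σ (P.f (n + 1)) (2 * P.r n) x (y * z⁻¹) := by
        rw [← near_mul_right z]
        simpa using (hxy.level_mono (R.f_lt n hn).le).mono (by omega)
      refine ⟨y * z⁻¹, ⟨?_, by simpa using hy⟩, hxy'⟩
      simpa using mul_mem hxy'.mem_subgp hx)
  have : Finite (ball (cay σ (P.f n)) (P.s n) (1 : Γ)) := ball_finite.to_subtype
  have hcard : Nat.card (P.BallType σ n) = Nat.card L := by
    rw [card_ballType, ← hL2, Nat.card_eq_fintype_card, Fintype.card_coe]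
  have hfin : Finite (P.BallType σ n) := inferInstance
  let ι : P.BallType σ n ≃ L :=
    (Finite.equivFin _).trans ((finCongr hcard).trans (Finite.equivFin L).symm)
  have hd : ∀ d : Γ, (cay σ (P.f (n + 1))).edist z (d * z) = (cay σ (P.f (n + 1))).edist 1 d := by
    intro d
    have := edist_mul_right (σ := σ) (n := P.f (n + 1)) (x := 1) (y := d) z
    rwa [one_mul] at this
  refine ⟨fun a => ι a * z, fun a => ⟨(hL1 (ι a).2).2, ?_⟩, fun a b hab => ?_⟩
  · rw [hd]; exact hL3 _ (ι a).2
  · rw [edist_mul_right]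
    exact hL4 _ (ι a).2 _ (ι b).2 fun h => hab (ι.injective (Subtype.ext h))

theorem Rules.supersize_bound (R : P.Rules σ) {n : ℕ} (hn : 1 ≤ n) :
    2 * P.s (n + 1) / 3 + 12 * P.r n + 10 * P.s n ≤ P.s (n + 1) ∧
      P.s (n + 1) ≤ P.r (n + 1) ∧ 18 * P.r n < P.s (n + 1) := by
  have h1 := R.s_lt_r (n + 1) (by omega)
  have h2 := R.r_le_s hn
  have h3 := R.s_le_r hn
  omega

/-- Now `Q_n` itself changes and `Q_{n+1}` is the first set to be kept. The changed zones lie within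
`r_{n+1}` of `z` but do not contain it, so sparseness keeps `Q_{n+1}` out of them while `z`
dominates all their points. -/
theorem exists_insertion [Countable Γ] (R : P.Rules σ) (hΘ : P.Clean σ Θ) {n : ℕ} (hn : 1 ≤ n)
    {z : Γ} (hz : z ∈ P.Q Θ (n + 1)) : ∃ Θb, P.IsInsertion σ n Θ z Θb := by
  obtain ⟨w, hw1, hw2⟩ := exists_insertion_points R hΘ hn z
  obtain ⟨hb1, hb2, hb3⟩ := R.supersize_bound hn
  have hf := (R.f_lt n hn).le
  choose x hx hax using fun a : Γ => hΘ.net R hn a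
  let τ := P.ballType σ n Θ
  -- `rep g` depends only on the type of `g`, so the range of `rep` contains one centre of each type
  -- that occurs.
  let rep : Γ → Γ := fun g => Function.invFun τ (τ g)
  have hrep : ∀ g, τ (rep g) = τ g := fun g => Function.invFun_eq ⟨g, rfl⟩
  have hA : ∀ a ∈ Set.range rep, rep a = a := by
    rintro _ ⟨g, rfl⟩
    change Function.invFun τ (τ (rep g)) = _
    rw [hrep]
  have hinj : ∀ a ∈ Set.range rep, ∀ b ∈ Set.range rep, a ≠ b → τ a ≠ τ b := by
    intro a ha b hb hab h
    apply hab
    rw [← hA a ha, ← hA b hb]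
    change Function.invFun τ (τ a) = Function.invFun τ (τ b)
    rw [h]
  have hnear : ∀ a, Near σ (P.f (n + 1)) (2 * P.s (n + 1) / 3) z (w a) := fun a =>
    le_div_three (hw1 a).2.2
  have hnot : ∀ a, ¬ Near σ (P.f (n + 1)) (6 * P.r n) z (w a) := by
    intro a h
    have h1 : (P.s (n + 1) : ℕ∞) ≤ 3 * (6 * P.r n : ℕ) :=
      (hw1 a).2.1.trans (mul_le_mul_right h 3)
    have h2 : P.s (n + 1) ≤ 3 * (6 * P.r n) := by exact_mod_cast h1
    omega
  obtain ⟨Θb, h⟩ := exists_patching R hΘ hΘ hn (n := n) le_rfl (by omega) (3 * P.r n)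
    (I := Set.range rep) (x := x) (y := fun a => w (τ a)) (by
      intro a ha b hb hab
      by_contra hne
      refine not_near.2 (hw2 _ _ (hinj a ha b hb hne)) ((hab.mono ?_).level_mono hf)
      omega) (by
      intro a _ ha
      refine hΘ.not_near_one (by omega) hz
        (((ha.level_mono hf).trans (hnear (τ a)).symm).mono (by omega))) (by
      intro a _ p hp hap
      exfalso
      have hzp : z = p := hΘ.sparse R (by omega) hz hp
        (((hnear (τ a)).trans (hap.level_mono hf)).mono (by omega))
      subst hzp
      exact hnot (τ a) ((hap.symm.level_mono hf).mono (by omega))) (by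
      intro a _ p hap
      exact ⟨z, hz, ((hnear (τ a)).trans (hap.level_mono hf)).symm.mono (by omega)⟩) (by omega)
  refine ⟨Θb, Set.range rep, fun a => w (τ a), x, ?_, fun a _ => hw1 _, ?_, ?_,
    h.mono_out (by have := R.s_le_r hn; omega)⟩
  · intro g
    refine ⟨rep g, ⟨⟨g, rfl⟩, ballType_eq_iff.1 (hrep g).symm⟩, ?_⟩
    rintro a ⟨ha, hga⟩
    rw [← hA a ha]
    change Function.invFun τ (τ a) = Function.invFun τ (τ g)
    rw [← show τ g = τ a from ballType_eq_iff.2 hga]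
  · intro a ha b hb hab
    exact hw2 _ _ (hinj a ha b hb hab)
  · intro a _
    refine ⟨hx a, a, ?_, ?_⟩
    · have h1 := (hax a).symm
      have h2 := R.s_le_r hn
      have h3 : P.r n + P.r n / 2 + P.s n < 2 * P.r n := by omega
      calc (cay σ (P.f n)).edist (x a) a + (P.s n : ℕ∞)
          ≤ ((P.r n + P.r n / 2 : ℕ) : ℕ∞) + (P.s n : ℕ∞) := by gcongr; exact h1
        _ < ((2 * P.r n : ℕ) : ℕ∞) := by exact_mod_cast h3
    · exact ballType_eq_iff.1 rfl

end Existence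

end Params
end FreeMinimal

/-! ### Bad points and a single repair -/

namespace FreeMinimal
namespace Params

variable {Γ : Type*} [Group Γ] {P : Params} {σ : ℕ → Γ}

/-- The total radius lost in repairs of levels `N, …, 2`. -/
def loss (P : Params) (N : ℕ) : ℕ := ∑ i ∈ Finset.Icc 2 N, (3 * P.s i + 5 * P.r (i - 1))

theorem loss_one (P : Params) : P.loss 1 = 0 := rfl

theorem loss_succ (P : Params) {N : ℕ} (hN : 1 ≤ N) :
    P.loss (N + 1) = P.loss N + (3 * P.s (N + 1) + 5 * P.r N) := by
  rw [loss, loss, Finset.sum_Icc_succ_top (by omega)]; simp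

theorem Rules.loss_le (R : P.Rules σ) {N : ℕ} (hN : 1 ≤ N) : 300 * P.loss N ≤ P.r N := by
  rcases hN.eq_or_lt with rfl | hN'
  · simp [loss_one]
  obtain ⟨m, rfl⟩ : ∃ m, N = m + 1 := ⟨N - 1, by omega⟩
  have h1 := R.r_sum m (by omega)
  have h2 : P.loss (m + 1) ≤ 3 * ∑ j ∈ Finset.Icc 1 (m + 1), (5 * P.r (j - 1) + P.s j) := by
    rw [loss, Finset.mul_sum]
    refine (Finset.sum_le_sum fun i _ => ?_).trans
      (Finset.sum_le_sum_of_subset (Finset.Icc_subset_Icc_left one_le_two))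
    omega
  omega

section Repairs

variable {Θ Θa Θd Θb Θ' Θi : Γ → P.Label} {B : ℕ → Γ → P.Label} {z : ℕ → Γ}

theorem IsPatching.eq_of_not_near (R : P.Rules σ) {n a b : ℕ} {I : Set Γ} {x y : Γ → Γ}
    (h : P.IsPatching σ n a (b + 1) Θa Θd I x y Θb) {g : Γ}
    (hg : ∀ i ∈ I, ¬ Near σ (P.f n) b (y i) g) : Θb g = Θa g :=
  R.label_ext (h.outside g fun i hi => succ_le_edist.2 (hg i hi)) (h.beyond g)

theorem IsPatching.Q_of_lt {n m a b : ℕ} {I : Set Γ} {x y : Γ → Γ}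
    (h : P.IsPatching σ n a b Θa Θd I x y Θb) (hm : n < m) : P.Q Θb m = P.Q Θa m := by
  ext g
  change (Θb g).2 m = _ ↔ (Θa g).2 m = _
  rw [(h.beyond g).2 m hm]

/-- A point of `Q_j` is not bad if its ball is not changed. -/
theorem not_mem_bad_of_agree {j : ℕ} (hj : 1 ≤ j) {p : Γ} (hp : p ∉ P.Bad σ B z j Θ')
    (h : ∀ u, Near σ (P.f j) (P.s j) p u → P.AgreeUpTo j (Θb u) (Θ' u)) :
    p ∉ P.Bad σ B z j Θb := by
  rintro ⟨hpQ, hpB⟩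
  have hiso : P.BallIso σ j (P.s j) Θb p Θ' p := fun u hu => by simpa using h u hu
  refine hp ⟨(hiso.mem_Q_iff hj).1 hpQ, fun hB => hpB (hiso.trans hB)⟩

theorem exists_ne_of_mem_bad {j : ℕ} (hj : 1 ≤ j) {p : Γ} (hp : p ∉ P.Bad σ B z j Θ')
    (hb : p ∈ P.Bad σ B z j Θb) : ∃ u, Near σ (P.f j) (P.s j) p u ∧ Θb u ≠ Θ' u := by
  by_contra! hcon
  exact not_mem_bad_of_agree hj hp (fun u hu => by rw [hcon u hu]; exact .refl ..) hb

/-- Inside of a patched ball a point of `Q_j` looks like a point of the labeling it comes from. -/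
theorem IsPatching.not_mem_bad (R : P.Rules σ) {n a b : ℕ} {I : Set Γ} {x y : Γ → Γ}
    (h : P.IsPatching σ n a b Θa Θd I x y Θb) {j D : ℕ} (hj : 1 ≤ j) (hjn : j ≤ n)
    (hbad : P.Bad σ B z j Θd = ∅) {i : Γ} (hi : i ∈ I) {p : Γ}
    (hp : Near σ (P.f n) D (y i) p) (hD : D + P.s j ≤ a) : p ∉ P.Bad σ B z j Θb := by
  rintro ⟨hpQ, hpB⟩
  have hiso : P.BallIso σ j (P.s j) Θb p Θd (p * (y i)⁻¹ * x i) := fun u hu => by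
    have := h.inside i hi u ((hp.trans (Near.level_mono hu (R.f_mono hj hjn))).mono hD)
    have heq : u * p⁻¹ * (p * (y i)⁻¹ * x i) = u * (y i)⁻¹ * x i := by group
    rw [heq]
    exact this.mono hjn
  have : p * (y i)⁻¹ * x i ∈ P.Bad σ B z j Θd :=
    ⟨(hiso.mem_Q_iff hj).1 hpQ, fun hB => hpB (hiso.trans hB)⟩
  rw [hbad] at this
  exact this

/-- A regular `n`-patching does not change `Q_n`. -/
theorem IsRegularPatching.Q_eq (R : P.Rules σ) {n : ℕ} (hn : 2 ≤ n) {Y : Set Γ} {x : Γ}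
    (h : P.IsRegularPatching σ n Θa Θd Y x Θb) (hΘa : P.Clean σ Θa) (hY : Y ⊆ P.Q Θa n)
    (hx : x ∈ P.Q Θd n) : P.Q Θb n = P.Q Θa n := by
  obtain ⟨N, rfl⟩ : ∃ N, n = N + 1 := ⟨n - 1, by omega⟩
  obtain ⟨hb1, -⟩ := R.regular_bound (n := N) (by omega)
  have hYb : Y ⊆ P.Q Θb (N + 1) := by
    intro y hy
    have := (h.inside y hy y (by simp)).2 (N + 1) (by omega) le_rfl
    change _ = _
    rw [this, mul_inv_cancel, one_mul]
    exact hx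
  ext p
  by_cases hfar : ∀ y ∈ Y, ¬ Near σ (P.f (N + 1)) (P.s (N + 1) + 4 * P.r N) y p
  · change (Θb p).2 (N + 1) = _ ↔ (Θa p).2 (N + 1) = _
    rw [IsPatching.eq_of_not_near R h hfar]
  · push Not at hfar
    obtain ⟨y, hy, hyp⟩ := hfar
    have hyp' := hyp.mono (t := P.r (N + 1)) (by omega)
    constructor
    · intro hp
      rw [← h.clean.sparse R (by omega) (hYb hy) hp hyp']
      exact hY hy
    · intro hp
      rw [← hΘa.sparse R (by omega) (hY hy) hp hyp']
      exact hYb hy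

theorem exists_repair [Countable Γ] (R : P.Rules σ) {i : ℕ} (hi : 2 ≤ i)
    (hΘi : P.Clean σ Θi) (hbad : P.Bad σ B z i Θi = ∅)
    (hΘ' : P.Clean σ Θ') : ∃ Θb, P.IsRepair σ B z i Θi Θ' Θb := by
  obtain ⟨x, hx⟩ := hΘi.Q_nonempty R (m := i) (by omega)
  obtain ⟨Θb, h⟩ := exists_regularPatching R hΘ' hΘi hi
    (Y := {y | y ∈ P.Q Θ' i ∧ ∃ j, 2 ≤ j ∧ j ≤ i ∧ ∃ g ∈ P.Bad σ B z j Θ',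
        g ∈ ball (cay σ (P.f i)) (P.s i + P.r (i - 1)) y}) (fun y hy => hy.1) hx
  refine ⟨Θb, x, ?_, h⟩
  by_contra hcon
  have : x ∈ P.Bad σ B z i Θi := ⟨hx, hcon⟩
  rw [hbad] at this
  exact this

theorem IsRepair.clean {i : ℕ} (h : P.IsRepair σ B z i Θi Θ' Θb) : P.Clean σ Θb :=
  let ⟨_, _, h⟩ := h
  IsPatching.clean h

theorem IsRepair.beyond {i : ℕ} (h : P.IsRepair σ B z i Θi Θ' Θb) (g : Γ) :
    P.AgreeBeyond i (Θb g) (Θ' g) :=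
  let ⟨_, _, h⟩ := h
  IsPatching.beyond h g

/-- Changes in a repair occur near bad points. -/
theorem IsRepair.exists_bad_near (R : P.Rules σ) {i : ℕ} (h : P.IsRepair σ B z i Θi Θ' Θb) {g : Γ}
    (hg : Θb g ≠ Θ' g) : ∃ j, 2 ≤ j ∧ j ≤ i ∧ ∃ p ∈ P.Bad σ B z j Θ',
      Near σ (P.f i) (2 * P.s i + 5 * P.r (i - 1)) p g := by
  obtain ⟨x, -, h⟩ := h
  by_contra! hcon
  refine hg (IsPatching.eq_of_not_near R h ?_)
  rintro y ⟨-, j, hj2, hji, p, hp, hyp⟩ hyg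
  exact hcon j hj2 hji p hp (((mem_ball.1 hyp).symm.trans hyg).mono (by omega))

/-- After an `i`-repair no point of `Q_i` is bad, and the bad points of lower level are far from
`Q_i`. -/
theorem IsRepair.spec (R : P.Rules σ) {i : ℕ} (hi : 2 ≤ i) (h : P.IsRepair σ B z i Θi Θ' Θb)
    (hz : z i ∈ P.Q (B i) i) (hΘ' : P.Clean σ Θ')
    (hbad : ∀ j, 2 ≤ j → j ≤ i → P.Bad σ B z j Θi = ∅) :
    P.Bad σ B z i Θb = ∅ ∧ ∀ j, 2 ≤ j → j < i → ∀ p ∈ P.Bad σ B z j Θb, ∀ y ∈ P.Q Θb i,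
      ∀ D, D + P.s j ≤ P.s i + P.r (i - 1) → ¬ Near σ (P.f i) D y p := by
  obtain ⟨N, rfl⟩ : ∃ N, i = N + 1 := ⟨i - 1, by omega⟩
  obtain ⟨hb1, -⟩ := R.regular_bound (n := N) (by omega)
  have hr := R.s_le_r (m := N + 1) (by omega)
  obtain ⟨x, hx, h⟩ := h
  set Y := {y | y ∈ P.Q Θ' (N + 1) ∧ ∃ j, 2 ≤ j ∧ j ≤ N + 1 ∧ ∃ g ∈ P.Bad σ B z j Θ',
        g ∈ ball (cay σ (P.f (N + 1))) (P.s (N + 1) + P.r (N + 1 - 1)) y} with hYdef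
  have hQ := h.Q_eq R hi hΘ' (fun y hy => hy.1) ((hx.mem_Q_iff (by omega)).2 hz)
  have key : ∀ y ∈ P.Q Θb (N + 1), ∀ j, 2 ≤ j → j ≤ N + 1 → ∀ D,
      D + P.s j ≤ P.s (N + 1) + P.r N → ∀ p, Near σ (P.f (N + 1)) D y p →
      p ∉ P.Bad σ B z j Θb := by
    intro y hy j hj2 hjN D hD p hyp
    rw [hQ] at hy
    by_cases hyY : y ∈ Y
    · exact IsPatching.not_mem_bad R h (by omega) hjN (hbad j hj2 hjN) hyY hyp hD
    · refine not_mem_bad_of_agree (by omega) (fun hp => hyY ⟨hy, j, hj2, hjN, p, hp,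
        hyp.mono (by simp only [Nat.add_sub_cancel]; omega)⟩) fun u hu => ?_
      rw [IsPatching.eq_of_not_near R h]
      · exact .refl ..
      -- A patch reaching the `s_j`-ball of `p` would have its centre within `r_i` of `y`, where `i
      -- = N + 1`, hence at `y`, which is not a patched point.
      · intro y' hy' hyu
        refine hyY ?_
        have h1 := (hyp.trans (hu.level_mono (R.f_mono (by omega) hjN))).trans hyu.symm
        simp only [Nat.add_sub_cancel] at h1
        rw [hΘ'.sparse R (by omega) hy hy'.1 (h1.mono (by omega))]
        exact hy'
  refine ⟨Set.eq_empty_of_forall_notMem fun y hy => ?_, ?_⟩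
  · exact key y hy.1 (N + 1) hi le_rfl 0 (by omega) y (Near.refl ..) hy
  · intro j hj2 hjN p hp y hy D hD hyp
    exact key y hy j hj2 hjN.le D hD p hyp hp

end Repairs

/-! ### Successive repairs of decreasing level -/

section Chains

variable {lab : ℕ → Γ → P.Label} {B : ℕ → Γ → P.Label} {z : ℕ → Γ} {Φ : ℕ → Γ → P.Label}

/-- The labelings `Φ (N + 1), …, Φ 2` are obtained by successive repairs of levels `N, …, 2`. -/
def IsChain (P : Params) (σ : ℕ → Γ) (B : ℕ → Γ → P.Label) (z : ℕ → Γ) (lab : ℕ → Γ → P.Label)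
    (N : ℕ) (Φ : ℕ → Γ → P.Label) : Prop :=
  ∀ i, 2 ≤ i → i ≤ N → P.IsRepair σ B z i (lab i) (Φ (i + 1)) (Φ i)

theorem IsChain.mono {N M : ℕ} (h : P.IsChain σ B z lab N Φ) (hM : M ≤ N) :
    P.IsChain σ B z lab M Φ := fun i h2 hi => h i h2 (hi.trans hM)

theorem IsChain.clean {N : ℕ} (h : P.IsChain σ B z lab N Φ) (hc : P.Clean σ (Φ (N + 1))) {i : ℕ}
    (hi : 2 ≤ i) (hiN : i ≤ N + 1) : P.Clean σ (Φ i) := by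
  rcases hiN.eq_or_lt with rfl | hlt
  · exact hc
  · exact (h i hi (by omega)).clean

theorem IsChain.beyond {N : ℕ} (hN : 1 ≤ N) (h : P.IsChain σ B z lab N Φ) (g : Γ) :
    P.AgreeBeyond N (Φ 2 g) (Φ (N + 1) g) := by
  induction N, hN using Nat.le_induction with
  | base => exact ⟨fun _ _ => rfl, fun _ _ => rfl⟩
  | succ N hN ih =>
    exact ((ih (h.mono (Nat.le_succ _))).mono (Nat.le_succ _)).trans
      ((h (N + 1) (by omega) le_rfl).beyond g)

theorem IsChain.Q_eq {N m : ℕ} (hN : 1 ≤ N) (h : P.IsChain σ B z lab N Φ) (hm : N < m) :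
    P.Q (Φ 2) m = P.Q (Φ (N + 1)) m := by
  ext g
  change (Φ 2 g).2 m = _ ↔ (Φ (N + 1) g).2 m = _
  rw [(h.beyond hN g).2 m hm]

/-- Repairs do not change labels far from bad points. -/
theorem IsChain.eq_of_near (R : P.Rules σ) {N k : ℕ} (hN : 1 ≤ N) (hNk : N ≤ k)
    (h : P.IsChain σ B z lab N Φ) {y : Γ} {D : ℕ}
    (hbad : ∀ j, 2 ≤ j → j ≤ N → ∀ p ∈ P.Bad σ B z j (Φ (N + 1)),
      ¬ Near σ (P.f k) (D + P.loss N) y p) {g : Γ} (hg : Near σ (P.f k) D y g) :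
    Φ 2 g = Φ (N + 1) g := by
  induction N, hN using Nat.le_induction with
  | base => rfl
  | succ N hN ih =>
    have hl := P.loss_succ hN
    have hrep := h (N + 1) (by omega) le_rfl
    have hf : P.f (N + 1) ≤ P.f k := R.f_mono (by omega) hNk
    -- This repair changes labels only within `2 s_{N+1} + 5 r_N` of a bad point, and a newly bad
    -- point is within `s_{N+1}` of a change. The sum of the two is the last summand of `loss (N +
    -- 1)`.
    have hch : ∀ D' u, D' ≤ D + P.loss N + P.s (N + 1) → Near σ (P.f k) D' y u →
        Φ (N + 1) u = Φ (N + 1 + 1) u := by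
      intro D' u hD' hu
      by_contra hne
      obtain ⟨j, hj2, hjN, p, hp, hpu⟩ := hrep.exists_bad_near R hne
      simp only [Nat.add_sub_cancel] at hpu
      exact hbad j hj2 hjN p hp ((hu.trans (hpu.symm.level_mono hf)).mono (by omega))
    rw [ih (by omega) (h.mono (Nat.le_succ _)) ?_, hch D g (by omega) hg]
    intro j hj2 hjN p hp hyp
    by_cases hp' : p ∈ P.Bad σ B z j (Φ (N + 1 + 1))
    · exact hbad j hj2 (by omega) p hp' (hyp.mono (by omega))
    · obtain ⟨u, hpu, hne⟩ := exists_ne_of_mem_bad (by omega) hp' hp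
      have hs := R.s_mono (show 1 ≤ j by omega) (show j ≤ N + 1 by omega)
      exact hne (hch _ u (by omega)
        (hyp.trans (hpu.level_mono (R.f_mono (by omega) (show j ≤ k by omega)))))

/-- The lower bad points stay outside of radius about `s_{N+1} + r_N` around `Q_{N+1}`. Damage
spreads by at most `loss N`, far less than `r_N`, so the `s_{N+1}`-balls around `Q_{N+1}` are never
reached. -/
theorem IsChain.bad_top (R : P.Rules σ) {N : ℕ} (hN : 1 ≤ N) (h : P.IsChain σ B z lab N Φ)
    (htop : P.Bad σ B z (N + 1) (Φ (N + 1)) = ∅)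
    (hfar : ∀ j, 2 ≤ j → j < N + 1 → ∀ p ∈ P.Bad σ B z j (Φ (N + 1)), ∀ y ∈ P.Q (Φ (N + 1)) (N + 1),
      ∀ D, D + P.s j ≤ P.s (N + 1) + P.r N → ¬ Near σ (P.f (N + 1)) D y p) :
    P.Bad σ B z (N + 1) (Φ 2) = ∅ := by
  refine Set.eq_empty_of_forall_notMem fun y hy => ?_
  have hyQ : y ∈ P.Q (Φ (N + 1)) (N + 1) := by
    rw [← h.Q_eq hN (Nat.lt_succ_self N)]; exact hy.1
  refine not_mem_bad_of_agree (by omega) (Θ' := Φ (N + 1)) (by rw [htop]; exact id)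
    (fun u hu => ?_) hy
  rw [h.eq_of_near R hN (Nat.le_succ N) ?_ hu]
  · exact .refl ..
  · intro j hj2 hjN p hp
    refine hfar j hj2 (by omega) p hp y hyQ _ ?_
    have h1 := R.loss_le hN
    have h2 := R.s_le_r hN
    have h3 := R.s_mono (show 1 ≤ j by omega) hjN
    omega

/-- The repair of level `m` produces exactly the hypotheses of `IsChain.bad_top` for the rest of the
chain. -/
theorem IsChain.bad_eq_empty (R : P.Rules σ) {N : ℕ} (h : P.IsChain σ B z lab N Φ)
    (hc : P.Clean σ (Φ (N + 1))) (hz : ∀ i, 2 ≤ i → i ≤ N → z i ∈ P.Q (B i) i)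
    (hlab : ∀ i, 2 ≤ i → i ≤ N → ∀ j, 2 ≤ j → j ≤ i → P.Bad σ B z j (lab i) = ∅)
    {m : ℕ} (hm : 2 ≤ m) (hmN : m ≤ N) : P.Bad σ B z m (Φ 2) = ∅ := by
  obtain ⟨M, rfl⟩ : ∃ M, m = M + 1 := ⟨m - 1, by omega⟩
  obtain ⟨h1, h2⟩ := (h (M + 1) hm hmN).spec R hm (hz _ hm hmN)
    (h.clean hc (by omega) (by omega)) (hlab _ hm hmN)
  exact IsChain.bad_top R (by omega) (h.mono (by omega)) h1 h2

theorem exists_chain [Countable Γ] (R : P.Rules σ) {N : ℕ} (hN : 1 ≤ N)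
    (hlab : ∀ i, 2 ≤ i → i ≤ N → P.Clean σ (lab i) ∧ P.Bad σ B z i (lab i) = ∅)
    {Θ : Γ → P.Label} (hc : P.Clean σ Θ) :
    ∃ Φ : ℕ → Γ → P.Label, Φ (N + 1) = Θ ∧ P.IsChain σ B z lab N Φ := by
  induction N, hN using Nat.le_induction generalizing Θ with
  | base => exact ⟨fun _ => Θ, rfl, fun i h1 h2 => by omega⟩
  | succ N hN ih =>
    obtain ⟨h1, h2⟩ := hlab (N + 1) (by omega) le_rfl
    obtain ⟨Θ', hΘ'⟩ := exists_repair R (by omega) h1 h2 hc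
    obtain ⟨Φ, hΦ, hch⟩ := ih (fun i hi hiN => hlab i hi (by omega)) hΘ'.clean
    refine ⟨Function.update Φ (N + 1 + 1) Θ, Function.update_self .., fun i hi hiN => ?_⟩
    rw [Function.update_of_ne (show i ≠ N + 1 + 1 by omega)]
    rcases hiN.eq_or_lt with rfl | hlt
    · rw [Function.update_self, hΦ]; exact hΘ'
    · rw [Function.update_of_ne (show i + 1 ≠ N + 1 + 1 by omega)]
      exact hch i hi (by omega)

end Chains

end Params
end FreeMinimal

/-! ### One stage of the construction -/

namespace FreeMinimal
namespace Params

section Data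

variable {Γ : Type*} {P : Params}

/-- The data of the construction. -/
structure Data (P : Params) (Γ : Type*) where
  lab : ℕ → Γ → P.Label
  z : ℕ → Γ
  hat : ℕ → ℕ → Γ → P.Label
  bar : ℕ → ℕ → Γ → P.Label

/-- The two data agree up to the index `n`. -/
structure Data.Agree (D D' : P.Data Γ) (n : ℕ) : Prop where
  lab : ∀ m ≤ n, D.lab m = D'.lab m
  z : ∀ m ≤ n, D.z m = D'.z m
  hat : ∀ m ≤ n, D.hat m = D'.hat m
  bar : ∀ m ≤ n, D.bar m = D'.bar m

theorem Data.Agree.mono {D D' : P.Data Γ} {m n : ℕ} (h : D.Agree D' n) (hmn : m ≤ n) :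
    D.Agree D' m :=
  ⟨fun k hk => h.lab k (hk.trans hmn), fun k hk => h.z k (hk.trans hmn),
    fun k hk => h.hat k (hk.trans hmn), fun k hk => h.bar k (hk.trans hmn)⟩

theorem Data.Agree.trans {D D' D'' : P.Data Γ} {n : ℕ} (h : D.Agree D' n) (h' : D'.Agree D'' n) :
    D.Agree D'' n :=
  ⟨fun k hk => (h.lab k hk).trans (h'.lab k hk), fun k hk => (h.z k hk).trans (h'.z k hk),
    fun k hk => (h.hat k hk).trans (h'.hat k hk), fun k hk => (h.bar k hk).trans (h'.bar k hk)⟩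

end Data

variable {Γ : Type*} [Group Γ] {P : Params} {σ : ℕ → Γ}

/-- The step from `lab n` to `lab (n + 1)` in the construction. -/
structure Stage (P : Params) (σ : ℕ → Γ) (lab : ℕ → Γ → P.Label) (z : ℕ → Γ)
    (hat bar : ℕ → ℕ → Γ → P.Label) (n : ℕ) : Prop where
  z_mem : z (n + 1) ∈ P.Q (lab n) (n + 1)
  hat_top : P.IsInsertion σ n (lab n) (z (n + 1)) (hat (n + 1) (n + 1))
  hat_chain : P.IsChain σ (fun m => hat m 2) z lab n (hat (n + 1))
  bar_top : P.IsRegularPatching σ (n + 1) (lab n) (hat (n + 1) 2) (P.Q (lab n) (n + 1)) (z (n + 1))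
      (bar (n + 1) (n + 1))
  bar_chain : P.IsChain σ (fun m => hat m 2) z lab n (bar (n + 1))
  lab_succ : lab (n + 1) = bar (n + 1) 2

/-- After stage `n` the labeling is clean and has no bad points of level at most `n`. -/
structure Good (P : Params) (σ : ℕ → Γ) (lab : ℕ → Γ → P.Label) (z : ℕ → Γ)
    (hat : ℕ → ℕ → Γ → P.Label) (n : ℕ) : Prop where
  clean : P.Clean σ (lab n)
  bad : ∀ j, 2 ≤ j → j ≤ n → P.Bad σ (fun m => hat m 2) z j (lab n) = ∅
  z_mem : 2 ≤ n → z n ∈ P.Q (hat n 2) n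

section Stage

variable {lab : ℕ → Γ → P.Label} {z : ℕ → Γ} {hat bar : ℕ → ℕ → Γ → P.Label} {n : ℕ}

theorem IsInsertion.clean {Θ Θb : Γ → P.Label} {y : Γ} (h : P.IsInsertion σ n Θ y Θb) :
    P.Clean σ Θb :=
  let ⟨_, _, _, _, _, _, _, h⟩ := h
  IsPatching.clean h

theorem IsInsertion.Q_of_lt {Θ Θb : Γ → P.Label} {y : Γ} (h : P.IsInsertion σ n Θ y Θb) {m : ℕ}
    (hm : n < m) : P.Q Θb m = P.Q Θ m :=
  let ⟨_, _, _, _, _, _, _, h⟩ := h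
  IsPatching.Q_of_lt h hm

theorem Stage.lab_clean (h : P.Stage σ lab z hat bar n) (hn : 1 ≤ n) :
    P.Clean σ (lab (n + 1)) := by
  rw [h.lab_succ]
  exact h.bar_chain.clean (IsPatching.clean h.bar_top) le_rfl (by omega)

theorem Stage.z_mem_hat (h : P.Stage σ lab z hat bar n) (hn : 1 ≤ n) :
    z (n + 1) ∈ P.Q (hat (n + 1) 2) (n + 1) := by
  rw [h.hat_chain.Q_eq hn (Nat.lt_succ_self n), h.hat_top.Q_of_lt (Nat.lt_succ_self n)]
  exact h.z_mem

theorem Stage.hat_bad (h : P.Stage σ lab z hat bar n) (R : P.Rules σ)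
    (hg : ∀ k, 1 ≤ k → k ≤ n → P.Good σ lab z hat k) {j : ℕ} (hj : 2 ≤ j) (hjn : j ≤ n) :
    P.Bad σ (fun m => hat m 2) z j (hat (n + 1) 2) = ∅ :=
  h.hat_chain.bad_eq_empty R h.hat_top.clean (fun i h2 hi => (hg i (by omega) hi).z_mem h2)
    (fun i h2 hi => (hg i (by omega) hi).bad) hj hjn

/-- At level `n + 1` the patching puts the codeball around every point of `Q_{n+1}`. What is patched
in has no bad points of lower level (`Stage.hat_bad`), so the repairs that follow spare these balls.
The lower levels are settled by the repairs themselves. -/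
theorem Stage.good (h : P.Stage σ lab z hat bar n) (R : P.Rules σ) (hn : 1 ≤ n)
    (hg : ∀ k, 1 ≤ k → k ≤ n → P.Good σ lab z hat k) : P.Good σ lab z hat (n + 1) := by
  refine ⟨h.lab_clean hn, ?_, fun _ => h.z_mem_hat hn⟩
  have hQ := IsRegularPatching.Q_eq R (by omega) h.bar_top (hg n hn le_rfl).clean subset_rfl
    (h.z_mem_hat hn)
  have hbt := h.bar_top
  unfold IsRegularPatching at hbt
  rw [h.lab_succ]
  intro j hj hjn
  rcases hjn.eq_or_lt with rfl | hlt
  · refine h.bar_chain.bad_top R hn ?_ ?_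
    · refine Set.eq_empty_of_forall_notMem fun y ⟨hyQ, hyB⟩ => hyB fun u hu => ?_
      rw [hQ] at hyQ
      exact hbt.inside y hyQ u (Near.mono hu (by omega))
    · intro j hj2 hjn p hp y hy D hD hyp
      rw [hQ] at hy
      exact hbt.not_mem_bad R (by omega) hjn.le (h.hat_bad R hg hj2 (by omega)) hy hyp hD hp
  · exact h.bar_chain.bad_eq_empty R (IsPatching.clean h.bar_top)
      (fun i h2 hi => (hg i (by omega) hi).z_mem h2)
      (fun i h2 hi => (hg i (by omega) hi).bad) hj (by omega)

/-- Stage `n` does not change labels near the identity. -/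
theorem Stage.lab_eq (h : P.Stage σ lab z hat bar n) (R : P.Rules σ) (hn : 1 ≤ n)
    (hg : P.Good σ lab z hat n) {g : Γ} (hgn : Near σ (P.f (n + 1)) (P.s (n + 1)) 1 g) :
    lab (n + 1) g = lab n g := by
  have h1 := R.r_le_s hn
  have h2 := R.loss_le hn
  have h3 := R.s_le_r hn
  -- `Q_{n+1}` stays `10 s_{n+1}` away from the identity, and the patches around it reach no further
  -- than `s_{n+1} + 4 r_n`.
  have hch : ∀ u, Near σ (P.f (n + 1)) (4 * P.s (n + 1)) 1 u →
      bar (n + 1) (n + 1) u = lab n u := by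
    intro u hu
    refine IsPatching.eq_of_not_near R h.bar_top fun y hy hyu => ?_
    simp only [Nat.add_sub_cancel] at hyu
    exact hg.clean.not_near_one (by omega) hy ((hu.trans hyu.symm).mono (by omega))
  rw [h.lab_succ, h.bar_chain.eq_of_near R hn (Nat.le_succ n) ?_ hgn, hch g (hgn.mono (by omega))]
  intro j hj2 hjn p hp hp1
  -- `lab n` has no bad points, so a bad point must have a changed label within `s_j` of it.
  obtain ⟨u, hpu, hne⟩ := exists_ne_of_mem_bad (by omega) (Θ' := lab n)
    (by rw [hg.bad j hj2 hjn]; exact id) hp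
  have h4 := R.s_mono (show 1 ≤ j by omega) hjn
  exact hne (hch u ((hp1.trans (hpu.level_mono (R.f_mono (by omega)
    (show j ≤ n + 1 by omega)))).mono (by omega)))

/-- The codeball of level `n + 1` contains copies of all balls of radius `s_n` in `lab n`. -/
theorem Stage.exists_copy (h : P.Stage σ lab z hat bar n) (R : P.Rules σ) (hn : 1 ≤ n)
    (hg : P.Good σ lab z hat n) (g : Γ) :
    ∃ v t, t + P.s n ≤ P.s (n + 1) ∧ Near σ (P.f (n + 1)) t (z (n + 1)) v ∧
      P.BallIso σ n (P.s n) (lab n) g (hat (n + 1) 2) v := by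
  obtain ⟨A, w, x, hA, hw, -, hx, hp⟩ := h.hat_top
  unfold IsSupersizePatching at hp
  obtain ⟨hb1, -, -⟩ := R.supersize_bound hn
  obtain ⟨a, ⟨haA, hga⟩, -⟩ := hA g
  obtain ⟨v, hv, hav⟩ := (hx a haA).2
  have hxv : ∀ b, Near σ (P.f n) (P.s n) 1 b → Near σ (P.f n) (2 * P.r n) (x a) (b * v) := by
    intro b hb
    have h1 : Near σ (P.f n) (P.s n) v (b * v) := by simpa using (near_mul_right v).2 hb
    calc (cay σ (P.f n)).edist (x a) (b * v) ≤ _ := SimpleGraph.edist_triangle (v := v)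
      _ ≤ _ := (add_le_add le_rfl h1).trans hv.le
      _ = _ := rfl
  have hback : ∀ u, u * (x a)⁻¹ * w a * (w a)⁻¹ * x a = u := fun u => by group
  have hwv : ∀ b, Near σ (P.f n) (P.s n) 1 b →
      Near σ (P.f n) (2 * P.r n) (w a) (b * (v * (x a)⁻¹ * w a)) := by
    intro b hb
    have := (near_translate_center (x a) (w a)).2 (hxv b hb)
    rwa [show b * v * (x a)⁻¹ * w a = b * (v * (x a)⁻¹ * w a) by group] at this
  -- The patched ball of radius `3 r_n` is copied from a labeling without bad points. Bad points can
  -- thus occur only near its boundary, and the repairs cannot reach the concentric ball of radius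
  -- `2 r_n`.
  have hkeep : ∀ u, Near σ (P.f n) (2 * P.r n) (w a) u → hat (n + 1) 2 u = hat (n + 1) (n + 1) u := by
    intro u hu
    refine h.hat_chain.eq_of_near R hn le_rfl ?_ hu
    intro j hj2 hjn p hpb hwp
    have h2 := R.loss_le hn
    have h3 := R.s_le_r hn
    have h4 := R.s_mono (show 1 ≤ j by omega) hjn
    exact hp.not_mem_bad R (by omega) hjn (hg.bad j hj2 hjn) haA hwp (by omega) hpb
  -- The copy lies within `2 r_n` of `w a`, which is within `2 s_{n+1} / 3` of the centre; so its
  -- whole `s_n`-ball fits into the codeball.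
  refine ⟨v * (x a)⁻¹ * w a, 2 * P.s (n + 1) / 3 + 2 * P.r n, by omega, ?_, ?_⟩
  · have h1 : Near σ (P.f (n + 1)) (2 * P.s (n + 1) / 3) (z (n + 1)) (w a) :=
      le_div_three (hw a haA).2.2
    have h2 := hwv 1 (Near.refl ..)
    rw [one_mul] at h2
    exact h1.trans (h2.level_mono (R.f_lt n hn).le)
  · refine (hga.trans hav).trans (ballIso_iff.2 fun b hb => ?_)
    have h1 := hwv b hb
    have h2 := hp.inside a haA _ (h1.mono (show 2 * P.r n ≤ 3 * P.r n by omega))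
    rw [hkeep _ h1]
    rw [show b * (v * (x a)⁻¹ * w a) * (w a)⁻¹ * x a = b * v by group] at h2
    exact h2.symm

/-- Given the first `n` labelings, the next stage can be carried out. -/
theorem exists_stage_data [Countable Γ] (R : P.Rules σ) (hn : 1 ≤ n)
    (hg : ∀ k, 1 ≤ k → k ≤ n → P.Good σ lab z hat k) :
    ∃ (y : Γ) (Φ Ψ : ℕ → Γ → P.Label), y ∈ P.Q (lab n) (n + 1) ∧
      P.IsInsertion σ n (lab n) y (Φ (n + 1)) ∧ P.IsChain σ (fun m => hat m 2) z lab n Φ ∧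
      P.IsRegularPatching σ (n + 1) (lab n) (Φ 2) (P.Q (lab n) (n + 1)) y (Ψ (n + 1)) ∧
      P.IsChain σ (fun m => hat m 2) z lab n Ψ := by
  have hc := (hg n hn le_rfl).clean
  have hlab : ∀ i, 2 ≤ i → i ≤ n → P.Clean σ (lab i) ∧
      P.Bad σ (fun m => hat m 2) z i (lab i) = ∅ := fun i h2 hi =>
    ⟨(hg i (by omega) hi).clean, (hg i (by omega) hi).bad i h2 le_rfl⟩
  obtain ⟨y, hy⟩ := hc.Q_nonempty R (m := n + 1) (by omega)
  obtain ⟨Θ₁, hΘ₁⟩ := exists_insertion R hc hn hy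
  obtain ⟨Φ, rfl, hΦ⟩ := exists_chain R hn hlab hΘ₁.clean
  have hyΦ : y ∈ P.Q (Φ 2) (n + 1) := by
    rw [hΦ.Q_eq hn (Nat.lt_succ_self n), hΘ₁.Q_of_lt (Nat.lt_succ_self n)]; exact hy
  obtain ⟨Θ₂, hΘ₂⟩ := exists_regularPatching R hc (hΦ.clean hΘ₁.clean le_rfl (by omega))
    (n := n + 1) (by omega) (Y := P.Q (lab n) (n + 1)) subset_rfl hyΦ
  obtain ⟨Ψ, rfl, hΨ⟩ := exists_chain R hn hlab (IsPatching.clean hΘ₂)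
  exact ⟨y, Φ, Ψ, hy, hΘ₁, hΦ, hΘ₂, hΨ⟩

end Stage

/-! ### Assembling the stages into an infinite construction -/

section Assembly

theorem Bad_congr {B B' : ℕ → Γ → P.Label} {z z' : ℕ → Γ} {i : ℕ} (hB : B i = B' i)
    (hz : z i = z' i) (Θ : Γ → P.Label) : P.Bad σ B z i Θ = P.Bad σ B' z' i Θ := by
  unfold Bad; rw [hB, hz]

/-- A repair of level `i` refers only to codeballs of level at most `i`, so completed stages remain
valid when the data are extended. -/
theorem IsRepair.congr {B B' : ℕ → Γ → P.Label} {z z' : ℕ → Γ} {i : ℕ} {Θi Θ' Θb : Γ → P.Label}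
    (h : P.IsRepair σ B z i Θi Θ' Θb) (hB : ∀ j ≤ i, B j = B' j) (hz : ∀ j ≤ i, z j = z' j) :
    P.IsRepair σ B' z' i Θi Θ' Θb := by
  obtain ⟨x, hx, h⟩ := h
  refine ⟨x, by rw [← hB i le_rfl, ← hz i le_rfl]; exact hx, ?_⟩
  convert h using 1
  ext y
  refine and_congr_right fun _ => exists_congr fun j => and_congr_right fun _ =>
    and_congr_right fun hj => ?_
  rw [Bad_congr (hB j hj) (hz j hj)]

theorem Stage.congr {D D' : P.Data Γ} {n : ℕ} (h : P.Stage σ D.lab D.z D.hat D.bar n)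
    (hD : D.Agree D' (n + 1)) : P.Stage σ D'.lab D'.z D'.hat D'.bar n := by
  have hch : ∀ Φ, P.IsChain σ (fun m => D.hat m 2) D.z D.lab n Φ →
      P.IsChain σ (fun m => D'.hat m 2) D'.z D'.lab n Φ := fun Φ hΦ i h2 hi => by
    rw [← hD.lab i (by omega)]
    exact (hΦ i h2 hi).congr (fun j hj => by rw [hD.hat j (by omega)])
      (fun j hj => hD.z j (by omega))
  have e1 := hD.lab n (by omega)
  have e2 := hD.lab (n + 1) le_rfl
  have e3 := hD.z (n + 1) le_rfl
  have e4 := hD.hat (n + 1) le_rfl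
  have e5 := hD.bar (n + 1) le_rfl
  obtain ⟨h1, h2, h3, h4, h5, h6⟩ := h
  rw [e1, e3] at h1
  rw [e1, e3, e4] at h2
  rw [e4] at h3
  rw [e1, e3, e4, e5] at h4
  rw [e5] at h5
  rw [e2, e5] at h6
  exact ⟨h1, h2, hch _ h3, h4, hch _ h5, h6⟩

theorem good_of_stages (R : P.Rules σ) {lab : ℕ → Γ → P.Label} {z : ℕ → Γ}
    {hat bar : ℕ → ℕ → Γ → P.Label} (hc : P.Clean σ (lab 1)) {n : ℕ}
    (h : ∀ k, 1 ≤ k → k < n → P.Stage σ lab z hat bar k) :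
    ∀ k, 1 ≤ k → k ≤ n → P.Good σ lab z hat k := by
  intro k
  induction k using Nat.strong_induction_on with
  | _ k ih =>
    intro h1 hk
    rcases h1.eq_or_lt with rfl | h1
    · exact ⟨hc, fun j h2 hj => by omega, fun h2 => by omega⟩
    obtain ⟨m, rfl⟩ : ∃ m, k = m + 1 := ⟨k - 1, by omega⟩
    exact (h m (by omega) (by omega)).good R (by omega) fun i hi him =>
      ih i (by omega) hi (by omega)

theorem exists_next [Countable Γ] (R : P.Rules σ) {D : P.Data Γ} (hc : P.Clean σ (D.lab 1)) {n : ℕ}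
    (hn : 1 ≤ n) (h : ∀ k, 1 ≤ k → k < n → P.Stage σ D.lab D.z D.hat D.bar k) :
    ∃ D' : P.Data Γ, D.Agree D' n ∧ ∀ k, 1 ≤ k → k < n + 1 →
      P.Stage σ D'.lab D'.z D'.hat D'.bar k := by
  obtain ⟨y, Φ, Ψ, h1, h2, h3, h4, h5⟩ := exists_stage_data R hn (good_of_stages R hc h)
  let D' : P.Data Γ := ⟨Function.update D.lab (n + 1) (Ψ 2), Function.update D.z (n + 1) y,
    Function.update D.hat (n + 1) Φ, Function.update D.bar (n + 1) Ψ⟩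
  have hag : D.Agree D' n :=
    ⟨fun m hm => (Function.update_of_ne (by omega) ..).symm,
      fun m hm => (Function.update_of_ne (by omega) ..).symm,
      fun m hm => (Function.update_of_ne (by omega) ..).symm,
      fun m hm => (Function.update_of_ne (by omega) ..).symm⟩
  refine ⟨D', hag, fun k hk hkn => ?_⟩
  rcases (Nat.lt_succ_iff.1 hkn).eq_or_lt with rfl | hlt
  · have hch : ∀ Φ, P.IsChain σ (fun m => D.hat m 2) D.z D.lab k Φ →
        P.IsChain σ (fun m => D'.hat m 2) D'.z D'.lab k Φ := fun Φ hΦ i h2 hi => by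
      rw [← hag.lab i hi]
      exact (hΦ i h2 hi).congr (fun j hj => by rw [hag.hat j (by omega)])
        (fun j hj => hag.z j (by omega))
    have e1 : D'.lab k = D.lab k := (hag.lab k le_rfl).symm
    have e2 : D'.lab (k + 1) = Ψ 2 := Function.update_self ..
    have e3 : D'.z (k + 1) = y := Function.update_self ..
    have e4 : D'.hat (k + 1) = Φ := Function.update_self ..
    have e5 : D'.bar (k + 1) = Ψ := Function.update_self ..
    refine ⟨?_, ?_, ?_, ?_, ?_, ?_⟩
    · rw [e1, e3]; exact h1
    · rw [e1, e3, e4]; exact h2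
    · rw [e4]; exact hch _ h3
    · rw [e1, e3, e4, e5]; exact h4
    · rw [e5]; exact hch _ h5
    · rw [e2, e5]
  · exact (h k hk hlt).congr (hag.mono hlt)

theorem nonempty_construction [Countable Γ] (R : P.Rules σ) {Θ : Γ → P.Label}
    (hΘ : P.Clean σ Θ) : Nonempty (P.Construction σ Θ) := by
  -- Data for which the stages `1, …, n` are carried out; these involve only indices up to `n + 1`,
  -- and entries beyond are arbitrary. Extension preserves the indices up to `n + 1`, so the
  -- diagonal sequence is well behaved.
  let X : ℕ → Type _ := fun n => {D : P.Data Γ // D.lab 1 = Θ ∧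
    ∀ k, 1 ≤ k → k < n + 1 → P.Stage σ D.lab D.z D.hat D.bar k}
  have hstep : ∀ n (D : X n), ∃ D' : X (n + 1), D.1.Agree D'.1 (n + 1) := by
    rintro n ⟨D, hD1, hD2⟩
    obtain ⟨D', h1, h2⟩ := exists_next R (D := D) (by rw [hD1]; exact hΘ) (n := n + 1)
      (by omega) hD2
    exact ⟨⟨D', by rw [← h1.lab 1 (by omega), hD1], h2⟩, h1⟩
  choose next hnext using hstep
  let D₀ : X 0 := ⟨⟨fun _ => Θ, fun _ => 1, fun _ _ => Θ, fun _ _ => Θ⟩, rfl,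
    fun k h1 h2 => by omega⟩
  let S : ∀ n, X n := fun n => Nat.rec D₀ (fun n D => next n D) n
  have hS : ∀ n, (S n).1.Agree (S (n + 1)).1 (n + 1) := fun n => hnext n (S n)
  have hS' : ∀ n k, n ≤ k → (S n).1.Agree (S k).1 (n + 1) := by
    intro n k hk
    induction k, hk using Nat.le_induction with
    | base => exact ⟨fun _ _ => rfl, fun _ _ => rfl, fun _ _ => rfl, fun _ _ => rfl⟩
    | succ k hk ih => exact ih.trans ((hS k).mono (by omega))
  let D : P.Data Γ := ⟨fun n => (S n).1.lab n, fun n => (S n).1.z n, fun n => (S n).1.hat n,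
    fun n => (S n).1.bar n⟩
  have hD : ∀ n, (S n).1.Agree D n := by
    refine fun n => ⟨fun m hm => ?_, fun m hm => ?_, fun m hm => ?_, fun m hm => ?_⟩
    · exact ((hS' m n hm).lab m (by omega)).symm
    · exact ((hS' m n hm).z m (by omega)).symm
    · exact ((hS' m n hm).hat m (by omega)).symm
    · exact ((hS' m n hm).bar m (by omega)).symm
  have hst : ∀ n, 1 ≤ n → P.Stage σ D.lab D.z D.hat D.bar n := fun n hn =>
    ((S (n + 1)).2.2 n hn (by omega)).congr (hD (n + 1))
  exact ⟨⟨D.lab, D.z, D.hat, D.bar, (S 1).2.1, fun n hn => (hst n hn).z_mem,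
    fun n hn => (hst n hn).hat_top, fun n hn => (hst n hn).hat_chain,
    fun n hn => (hst n hn).bar_top, fun n hn => (hst n hn).bar_chain,
    fun n hn => (hst n hn).lab_succ⟩⟩

theorem Construction.stage {Θ : Γ → P.Label} (C : P.Construction σ Θ) {n : ℕ} (hn : 1 ≤ n) :
    P.Stage σ C.lab C.z C.hat C.bar n :=
  ⟨C.z_mem n hn, C.hat_top n hn, C.hat_repair n hn, C.bar_top n hn, C.bar_repair n hn,
    C.lab_succ n hn⟩

theorem Construction.good {Θ : Γ → P.Label} (C : P.Construction σ Θ) (R : P.Rules σ)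
    (hΘ : P.Clean σ Θ) {n : ℕ} (hn : 1 ≤ n) : P.Good σ C.lab C.z C.hat n :=
  good_of_stages R (by rw [C.start]; exact hΘ) (fun _ hk _ => C.stage hk) n hn le_rfl

end Assembly

end Params
end FreeMinimal

/-! ### The limit labeling -/

namespace FreeMinimal
namespace Params

open Filter Topology

variable {Γ : Type*} [Group Γ] {P : Params} {σ : ℕ → Γ}

section Limit

theorem Rules.exists_forall_near (R : P.Rules σ) (hσ : IsGeneratingSystem σ) (g : Γ) :
    ∃ n, 1 ≤ n ∧ ∀ k ≥ n, Near σ (P.f k) (P.s k) 1 g := by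
  obtain ⟨n, t, h⟩ := exists_near hσ 1 g
  refine ⟨n + t + 1, by omega, fun k hk => ?_⟩
  have h1 := R.le_f (m := k) (by omega)
  have h2 := R.le_s (m := k) (by omega)
  exact (h (P.f k) (by omega)).mono (by omega)

theorem Rules.exists_forall_near_of_finite (R : P.Rules σ) (hσ : IsGeneratingSystem σ) {S : Set Γ}
    (hS : S.Finite) : ∃ n, 1 ≤ n ∧ ∀ k ≥ n, ∀ g ∈ S, Near σ (P.f k) (P.s k) 1 g := by
  induction S, hS using Set.Finite.induction_on with
  | empty => exact ⟨1, le_rfl, fun k _ g hg => absurd hg (Set.notMem_empty g)⟩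
  | @insert a S _ _ ih =>
    obtain ⟨n, hn, h⟩ := ih
    obtain ⟨m, -, h'⟩ := R.exists_forall_near hσ a
    refine ⟨max n m, le_max_of_le_left hn, fun k hk g hg => ?_⟩
    rcases hg with rfl | hg
    · exact h' k ((le_max_right ..).trans hk)
    · exact h k ((le_max_left ..).trans hk) g hg

/-- `Θ'` is the limit of the labelings `lab n`, reached at stage `n` on the ball of radius `s_n`. -/
def IsLimit (P : Params) (σ : ℕ → Γ) (lab : ℕ → Γ → P.Label) (Θ' : Γ → P.Label) : Prop :=
  ∀ n, 1 ≤ n → ∀ g, Near σ (P.f n) (P.s n) 1 g → lab n g = Θ' g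

theorem Construction.exists_isLimit {Θ : Γ → P.Label} (C : P.Construction σ Θ) (R : P.Rules σ)
    (hσ : IsGeneratingSystem σ) (hΘ : P.Clean σ Θ) : ∃ Θ', P.IsLimit σ C.lab Θ' := by
  have hstab : ∀ n, 1 ≤ n → ∀ g, Near σ (P.f n) (P.s n) 1 g → ∀ k ≥ n, C.lab k g = C.lab n g := by
    intro n hn g hg k hk
    induction k, hk using Nat.le_induction with
    | base => rfl
    | succ k hk ih =>
      rw [← ih]
      exact (C.stage (hn.trans hk)).lab_eq R (hn.trans hk) (C.good R hΘ (hn.trans hk))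
        ((hg.level_mono (R.f_mono hn (by omega))).mono (R.s_mono hn (by omega)))
  choose N hN1 hN using fun g => R.exists_forall_near hσ g
  refine ⟨fun g => C.lab (N g) g, fun n hn g hg => ?_⟩
  rcases le_total n (N g) with h | h
  · exact (hstab n hn g hg (N g) h).symm
  · exact hstab (N g) (hN1 g) g (hN g (N g) le_rfl) n h

variable {lab : ℕ → Γ → P.Label} {Θ' : Γ → P.Label}

theorem IsLimit.eventually (h : P.IsLimit σ lab Θ') (R : P.Rules σ) (hσ : IsGeneratingSystem σ)
    {S : Set Γ} (hS : S.Finite) : ∃ n, 1 ≤ n ∧ ∀ k ≥ n, ∀ g ∈ S, lab k g = Θ' g := by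
  obtain ⟨n, hn, hnS⟩ := R.exists_forall_near_of_finite hσ hS
  exact ⟨n, hn, fun k hk g hg => h k (hn.trans hk) g (hnS k hk g hg)⟩

/-- Each instance of a clause of cleanness involves finitely many points, domination included since
it looks only into a finite ball. It is therefore inherited from a late stage. -/
theorem IsLimit.clean (h : P.IsLimit σ lab Θ') (R : P.Rules σ) (hσ : IsGeneratingSystem σ)
    (hc : ∀ n, 1 ≤ n → P.Clean σ (lab n)) : P.Clean σ Θ' := by
  have hQ : ∀ {n g}, lab n g = Θ' g → ∀ m, g ∈ P.Q (lab n) m ↔ g ∈ P.Q Θ' m := by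
    intro n g hg m
    change (lab n g).2 m = _ ↔ (Θ' g).2 m = _
    rw [hg]
  have hmax : ∀ m, 1 ≤ m →
      IsMaximalSparse (cay σ (P.f m)) (P.Q Θ' (m - 1)) (P.r m) (P.Q Θ' m) := by
    intro m hm
    refine isMaximalSparse_iff.2 ⟨fun x hx => ?_, fun x hx y hy hxy => ?_, fun x hx => ?_⟩
    · obtain ⟨n, hn, hnS⟩ := h.eventually R hσ (Set.finite_singleton x)
      have he := hnS n le_rfl x rfl
      exact (hQ he _).1 ((hc n hn).anti R (Nat.sub_le m 1) ((hQ he _).2 hx))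
    · obtain ⟨n, hn, hnS⟩ := h.eventually R hσ ((Set.finite_singleton y).insert x)
      exact (hc n hn).sparse R hm ((hQ (hnS n le_rfl x (by simp)) _).2 hx)
        ((hQ (hnS n le_rfl y (by simp)) _).2 hy) hxy
    · obtain ⟨n, hn, hnS⟩ := h.eventually R hσ
        (ball_finite (σ := σ) (n := P.f m) (t := P.r m) (x := x))
      obtain ⟨y, hy, hxy⟩ := (hc n hn).dominates R hm
        ((hQ (hnS n le_rfl x (Near.refl ..)) _).2 hx)
      exact ⟨y, (hQ (hnS n le_rfl y hxy) _).1 hy, hxy⟩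
  refine ⟨?_, fun m hm => hmax m hm.le, fun m hm x y hne hxy => ?_, fun m hm x hx => ?_⟩
  · have := hmax 1 le_rfl
    rwa [Nat.sub_self, R.Q_zero] at this
  · obtain ⟨n, hn, hnS⟩ := h.eventually R hσ ((Set.finite_singleton y).insert x)
    rw [← hnS n le_rfl x (by simp), ← hnS n le_rfl y (by simp)]
    exact (hc n hn).proper m hm x y hne hxy
  · obtain ⟨n, hn, hnS⟩ := h.eventually R hσ (Set.finite_singleton x)
    exact (hc n hn).away m hm x ((hQ (hnS n le_rfl x rfl) _).2 hx)

end Limit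

/-! ### Orbit closures and finite windows -/

section Closure

variable {ρ τ : Γ → P.Label}

theorem isOpen_agreeUpTo (P : Params) (j : ℕ) (a : P.Label) :
    IsOpen {b : P.Label | P.AgreeUpTo j b a} := by
  have h : {b : P.Label | P.AgreeUpTo j b a} =
      (⋂ i ∈ Set.Iio j, {b : P.Label | b.1 i = a.1 i}) ∩
        ⋂ m ∈ Set.Icc 1 j, {b : P.Label | b.2 m = a.2 m} := by
    ext b
    simp [AgreeUpTo]
  rw [h]
  refine IsOpen.inter ((Set.finite_Iio j).isOpen_biInter fun i _ => ?_)
    ((Set.finite_Icc 1 j).isOpen_biInter fun m _ => ?_)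
  · exact (isOpen_discrete {a.1 i}).preimage
      (f := fun b : P.Label => b.1 i) ((continuous_apply i).comp continuous_fst)
  · exact (isOpen_discrete {a.2 m}).preimage
      (f := fun b : P.Label => b.2 m) ((continuous_apply m).comp continuous_snd)

theorem exists_agree_of_mem_orbitClosure (h : τ ∈ orbitClosure ρ) {S : Set Γ} (hS : S.Finite)
    (j : ℕ) : ∃ δ, ∀ g ∈ S, P.AgreeUpTo j (ρ (g * δ)) (τ g) := by
  have hopen : IsOpen (⋂ g ∈ S, {τ' : Γ → P.Label | P.AgreeUpTo j (τ' g) (τ g)}) :=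
    hS.isOpen_biInter fun g _ =>
      (isOpen_agreeUpTo P j (τ g)).preimage (f := fun τ' : Γ → P.Label => τ' g) (continuous_apply g)
  obtain ⟨τ', h1, δ, rfl⟩ := mem_closure_iff.1 h _ hopen
    (Set.mem_iInter₂.2 fun g _ => AgreeUpTo.refl ..)
  exact ⟨δ, fun g hg => Set.mem_iInter₂.1 h1 g hg⟩

/-- The windows exhaust `Γ` and the first `n` factors exhaust the label space, so the chosen shifts
of `ρ` converge to `τ`. -/
theorem mem_orbitClosure_of_agree (R : P.Rules σ) (hσ : IsGeneratingSystem σ)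
    (h : ∀ n, 1 ≤ n → ∃ δ, ∀ g, Near σ (P.f n) (P.s n) 1 g → P.AgreeUpTo n (ρ (g * δ)) (τ g)) :
    τ ∈ orbitClosure ρ := by
  choose! δ hδ using h
  have hev : ∀ g, ∀ j, ∀ᶠ n in atTop, P.AgreeUpTo j (ρ (g * δ n)) (τ g) := by
    intro g j
    obtain ⟨n, hn, hg⟩ := R.exists_forall_near hσ g
    filter_upwards [eventually_ge_atTop (max n j)] with k hk
    have hk1 := (le_max_left n j).trans hk
    exact (hδ k (hn.trans hk1) g (hg k hk1)).mono ((le_max_right ..).trans hk)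
  refine mem_closure_of_tendsto (f := fun n => shift (δ n) ρ) (b := atTop) ?_
    (Eventually.of_forall fun n => ⟨δ n, rfl⟩)
  refine tendsto_pi_nhds.2 fun g => ?_
  rw [Prod.tendsto_iff]
  constructor
  · refine tendsto_pi_nhds.2 fun i => tendsto_const_nhds.congr' ?_
    filter_upwards [hev g (i + 1)] with k hk
    exact (hk.1 i (Nat.lt_succ_self i)).symm
  · refine tendsto_pi_nhds.2 fun m => tendsto_const_nhds.congr' ?_
    rcases Nat.eq_zero_or_pos m with rfl | hm
    · have : Subsingleton (Fin (P.card 0)) := by rw [R.card_zero]; infer_instance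
      exact Eventually.of_forall fun k => Subsingleton.elim _ _
    · filter_upwards [hev g m] with k hk
      exact (hk.2 m hm le_rfl).symm

end Closure

end Params

section Shift

variable {Γ : Type*} [Group Γ] {K : Type*}

theorem shift_shift (δ ε : Γ) (ρ : Γ → K) : shift δ (shift ε ρ) = shift (δ * ε) ρ := by
  funext γ
  simp [shift, mul_assoc]

variable [TopologicalSpace K] {ρ τ : Γ → K}

theorem continuous_shift (δ : Γ) : Continuous (shift δ : (Γ → K) → Γ → K) :=
  continuous_pi fun γ => continuous_apply (γ * δ)

theorem mem_orbitClosure_self (ρ : Γ → K) : ρ ∈ orbitClosure ρ :=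
  subset_closure ⟨1, by funext γ; simp [shift]⟩

theorem shift_mem_orbitClosure (h : τ ∈ orbitClosure ρ) (δ : Γ) : shift δ τ ∈ orbitClosure ρ := by
  refine map_mem_closure (continuous_shift δ) h ?_
  rintro _ ⟨ε, rfl⟩
  exact ⟨δ * ε, (shift_shift δ ε ρ).symm⟩

theorem orbitClosure_subset (h : τ ∈ orbitClosure ρ) : orbitClosure τ ⊆ orbitClosure ρ := by
  refine closure_minimal ?_ isClosed_closure
  rintro _ ⟨δ, rfl⟩
  exact shift_mem_orbitClosure h δ

end Shift

/-! ### Freeness and minimality of the orbit closure -/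

namespace Params

variable {Γ : Type*} [Group Γ] {P : Params} {σ : ℕ → Γ}

/-- A period `δ ≠ 1` of `ρ` gives equal labels at `1` and `δ`. Approximating `ρ` on these two points
yields `ε` with equal labels of `Θ` at `ε` and `δε` in component `n + 1`, although these points are
within `r_n`. -/
theorem Clean.isFreeOn {Θ : Γ → P.Label} (h : P.Clean σ Θ) (R : P.Rules σ)
    (hσ : IsGeneratingSystem σ) : IsFreeOn (orbitClosure Θ) := by
  intro ρ hρ δ hδ
  by_contra hne
  obtain ⟨n, hn, hnear⟩ := R.exists_forall_near hσ δ
  have h1 : Near σ (P.f (n + 1)) (P.r n) 1 δ :=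
    ((hnear n le_rfl).level_mono (R.f_lt n hn).le).mono (R.s_lt_r n hn).le
  obtain ⟨ε, hε⟩ := exists_agree_of_mem_orbitClosure hρ ((Set.finite_singleton δ).insert 1) (n + 1)
  have h2 := (hε 1 (by simp)).2 (n + 1) (by omega) le_rfl
  have h3 := (hε δ (by simp)).2 (n + 1) (by omega) le_rfl
  have h4 : ρ δ = ρ 1 := by
    have := congrFun hδ 1
    simpa [shift] using this
  rw [h4, ← h2] at h3
  refine h.proper (n + 1) (by omega) (1 * ε) (δ * ε) ?_ ((near_mul_right ε).2 h1) h3.symm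
  simpa using fun h => hne h

/-- From `g` go to a point `y` of `Q_{n+1}`, then to the copy of the identity's `s_n`-ball inside
the codeball around `y`. The bound on `u` does not depend on `g`. -/
theorem Construction.exists_recurrence {Θ Θ' : Γ → P.Label} (C : P.Construction σ Θ)
    (R : P.Rules σ) (hσ : IsGeneratingSystem σ) (hΘ : P.Clean σ Θ) (h : P.IsLimit σ C.lab Θ')
    {n : ℕ} (hn : 1 ≤ n) (g : Γ) :
    ∃ u, Near σ (P.f (n + 1)) (2 * P.r (n + 1) + P.s (n + 1)) 1 u ∧
      P.BallIso σ n (P.s n) Θ' 1 Θ' (u * g) := by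
  have hc := h.clean R hσ fun n hn => (C.good R hΘ hn).clean
  have hf := (R.f_lt n hn).le
  obtain ⟨v, t, ht, hzv, hiso⟩ := (C.stage hn).exists_copy R hn (C.good R hΘ hn) 1
  obtain ⟨y, hy, hgy⟩ := hc.net R (m := n + 1) (by omega) g
  -- The stage `k` depends on `g`; this is harmless, as it serves only to identify the ball around
  -- `y` in the limit with a codeball.
  obtain ⟨k, hk1, hk⟩ := h.eventually R hσ
    (ball_finite (σ := σ) (n := P.f (n + 1)) (t := P.s (n + 1)) (x := y))
  have hek := hk (max k (n + 1)) (le_max_left ..)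
  have hgood := C.good R hΘ (hk1.trans (le_max_left k (n + 1)))
  have hy' : y ∈ P.Q (C.lab (max k (n + 1))) (n + 1) := by
    change (C.lab _ y).2 (n + 1) = _
    rw [hek y (Near.refl ..)]
    exact hy
  have hcode : P.BallIso σ (n + 1) (P.s (n + 1)) (C.lab (max k (n + 1))) y (C.hat (n + 1) 2)
      (C.z (n + 1)) := by
    by_contra hcon
    have hmem : y ∈ P.Bad σ (fun m => C.hat m 2) C.z (n + 1) (C.lab (max k (n + 1))) :=
      ⟨hy', hcon⟩
    rw [hgood.bad (n + 1) (by omega) (le_max_right ..)] at hmem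
    exact hmem
  have hv1 : Near σ (P.f (n + 1)) t 1 (v * (C.z (n + 1))⁻¹) := by
    rw [← near_mul_right (C.z (n + 1))]; simpa using hzv
  have hy1 : Near σ (P.f (n + 1)) (P.r (n + 1) + P.r (n + 1) / 2) 1 (y * g⁻¹) := by
    rw [← near_mul_right g]; simpa using hgy
  refine ⟨v * (C.z (n + 1))⁻¹ * (y * g⁻¹), ?_, ?_⟩
  · have := (near_mul_right (y * g⁻¹)).2 hv1
    rw [one_mul] at this
    exact (hy1.trans this).mono (by omega)
  · rw [ballIso_iff] at hiso hcode ⊢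
    intro b hb
    have hbv : Near σ (P.f (n + 1)) (P.s (n + 1)) 1 (b * (v * (C.z (n + 1))⁻¹)) := by
      have := (near_mul_right (v * (C.z (n + 1))⁻¹)).2 hb
      rw [one_mul] at this
      exact (hv1.trans (this.level_mono hf)).mono ht
    have h1 := hiso b hb
    have h2 := (hcode _ hbv).mono (Nat.le_succ n)
    rw [mul_one, h n hn b hb] at h1
    rw [hek _ (by simpa [mem_ball] using (near_mul_right y).2 hbv)] at h2
    rw [show b * (v * (C.z (n + 1))⁻¹) * C.z (n + 1) = b * v by group] at h2
    rw [mul_one, show b * (v * (C.z (n + 1))⁻¹ * (y * g⁻¹) * g) =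
      b * (v * (C.z (n + 1))⁻¹) * y by group]
    exact h1.trans h2.symm

/-- Any `ρ` in the orbit closure agrees with a translate of `Θ'` on a window large enough to contain
a recurrence of the ball at the identity. So the orbit of `ρ` approximates `Θ'`, which suffices by
transitivity. -/
theorem Construction.isMinimalSubshift {Θ Θ' : Γ → P.Label} (C : P.Construction σ Θ)
    (R : P.Rules σ) (hσ : IsGeneratingSystem σ) (hΘ : P.Clean σ Θ) (h : P.IsLimit σ C.lab Θ') :
    IsMinimalSubshift (orbitClosure Θ') := by
  refine ⟨⟨Θ', mem_orbitClosure_self Θ'⟩, isClosed_closure,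
    fun δ ρ hρ => shift_mem_orbitClosure hρ δ, fun ρ hρ => orbitClosure_subset ?_⟩
  refine mem_orbitClosure_of_agree R hσ fun n hn => ?_
  obtain ⟨δ, hδ⟩ := exists_agree_of_mem_orbitClosure hρ
    (ball_finite (σ := σ) (n := P.f (n + 1))
      (t := 2 * P.r (n + 1) + P.s (n + 1) + P.s n) (x := 1)) n
  obtain ⟨u, hu, hiso⟩ := C.exists_recurrence R hσ hΘ h hn δ
  refine ⟨u, fun g hg => ?_⟩
  have h1 := ballIso_iff.1 hiso g hg
  rw [mul_one, ← mul_assoc] at h1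
  have h2 : Near σ (P.f n) (P.s n) u (g * u) := by simpa using (near_mul_right u).2 hg
  have h3 := hδ (g * u) (hu.trans (h2.level_mono (R.f_lt n hn).le))
  exact (h1.trans h3).symm

end Params
end FreeMinimal

/-! ### Existence of generating systems -/

namespace FreeMinimal

open Filter
open scoped Pointwise

section Generating

variable {Γ : Type*} [Group Γ]

theorem subgp_succ (σ : ℕ → Γ) (n : ℕ) :
    subgp σ (n + 1) = subgp σ n ⊔ Subgroup.closure {σ (n + 1)} := by
  rw [subgp, subgp, ← Subgroup.closure_union]
  congr 1
  ext g
  constructor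
  · rintro ⟨i, h1, h2, rfl⟩
    rcases h2.eq_or_lt with rfl | h2
    · exact Or.inr rfl
    · exact Or.inl ⟨i, h1, by omega, rfl⟩
  · rintro (⟨i, h1, h2, rfl⟩ | rfl)
    · exact ⟨i, h1, by omega, rfl⟩
    · exact ⟨n + 1, by omega, le_rfl, rfl⟩

/-- Always adjoin the first element, in a fixed enumeration, that is missing from the subgroup
generated so far. -/
theorem exists_isGeneratingSystem [Countable Γ] : ∃ σ : ℕ → Γ, IsGeneratingSystem σ := by
  classical
  obtain ⟨e, he⟩ := exists_surjective_nat Γ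
  have hp : ∀ H : Subgroup Γ, ∃ g, (∀ k, e k ∉ H → (∀ i < k, e i ∈ H) → g = e k) ∧
      (H ≠ ⊤ → g ∉ H) := by
    intro H
    by_cases hex : ∃ k, e k ∉ H
    · refine ⟨e (Nat.find hex), fun k hk hmin => ?_, fun _ => Nat.find_spec hex⟩
      rw [(Nat.find_eq_iff hex).2 ⟨hk, fun i hi => not_not.2 (hmin i hi)⟩]
    · push Not at hex
      refine ⟨1, fun k hk => absurd (hex k) hk, fun h => absurd (eq_top_iff.2 fun g _ => ?_) h⟩
      obtain ⟨k, rfl⟩ := he g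
      exact hex k
  choose p hp1 hp2 using hp
  let H : ℕ → Subgroup Γ := fun n => Nat.rec ⊥ (fun _ K => K ⊔ Subgroup.closure {p K}) n
  let σ : ℕ → Γ := fun n => p (H (n - 1))
  have hH : ∀ n, subgp σ n = H n := by
    intro n
    induction n with
    | zero =>
      refine Subgroup.closure_eq_bot_iff.2 ?_
      rintro g ⟨i, h1, h2, -⟩
      omega
    | succ n ih => rw [subgp_succ, ih]; rfl
  have hσ : ∀ n, σ (n + 1) = p (subgp σ n) := fun n => by rw [hH]; rfl
  have hmem : ∀ n, ∀ k < n, e k ∈ subgp σ n := by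
    intro n
    induction n with
    | zero => intro k hk; omega
    | succ n ih =>
      intro k hk
      by_cases hkn : e k ∈ subgp σ n
      · exact subgp_mono (Nat.le_succ n) hkn
      · obtain rfl : k = n := by
          by_contra hne
          exact hkn (ih k (by omega))
        rw [← hp1 _ k hkn ih, ← hσ]
        exact Subgroup.subset_closure ⟨k + 1, by omega, le_rfl, rfl⟩
  refine ⟨σ, ⟨eq_top_iff.2 fun g _ => ?_, fun n _ hn => by rw [hσ]; exact hp2 _ hn⟩⟩
  obtain ⟨k, rfl⟩ := he g
  have hle : subgp σ (k + 1) ≤ Subgroup.closure {g | ∃ i, 1 ≤ i ∧ g = σ i} :=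
    Subgroup.closure_mono fun _ ⟨i, h1, _, h3⟩ => ⟨i, h1, h3⟩
  exact hle (hmem (k + 1) k (Nat.lt_succ_self k))

end Generating

/-! ### Growth of the subgroups `Γ_n` and separated points in nets -/

section Growth

variable {Γ : Type*} [Group Γ] {σ : ℕ → Γ}

theorem exists_pow_lt_two_pow (c t : ℕ) : ∃ N, ∀ n ≥ N, c * (2 * n + 1) ^ t < 2 ^ (n - 1) := by
  have h := tendsto_pow_const_div_const_pow_of_one_lt t (r := (2 : ℝ)) one_lt_two
  -- The factor `3 ^ t` comes from `2 * n + 1 ≤ 3 * n`, the factor 2 from the exponent `n - 1`.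
  have hpos : (0 : ℝ) < 1 / (2 * c * 3 ^ t + 1) := by positivity
  obtain ⟨N, hN⟩ := eventually_atTop.1 (h.eventually (gt_mem_nhds hpos))
  refine ⟨N + 1, fun n hn => ?_⟩
  have h1 := hN n (by omega)
  rw [div_lt_div_iff₀ (by positivity) (by positivity), one_mul] at h1
  have h2 : n ^ t * (2 * c * 3 ^ t + 1) < 2 ^ n := by exact_mod_cast h1
  have h3 : (2 * n + 1) ^ t ≤ 3 ^ t * n ^ t := by
    rw [← mul_pow]; exact Nat.pow_le_pow_left (by omega) t
  obtain ⟨m, rfl⟩ : ∃ m, n = m + 1 := ⟨n - 1, by omega⟩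
  rw [Nat.add_sub_cancel]
  rw [pow_succ] at h2
  have h4 : c * (2 * (m + 1) + 1) ^ t ≤ c * (3 ^ t * (m + 1) ^ t) := Nat.mul_le_mul_left c h3
  nlinarith [h2, h4, pow_pos (Nat.succ_pos m) t]

/-- A finite `Γ_n` is proper in `Γ`, so irredundancy and Lagrange's theorem at least double the
order at each step. -/
theorem two_pow_le_card_subgp [Infinite Γ] (hσ : IsGeneratingSystem σ)
    (hfin : ∀ n, Finite (subgp σ n)) {n : ℕ} (hn : 1 ≤ n) : 2 ^ (n - 1) ≤ Nat.card (subgp σ n) := by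
  induction n, hn using Nat.le_induction with
  | base => exact Nat.card_pos
  | succ n hn ih =>
    have hne : subgp σ n ≠ ⊤ := by
      intro h
      have := hfin n
      rw [h] at this
      exact not_finite_iff_infinite.2 ‹Infinite Γ› (Finite.of_equiv _ Subgroup.topEquiv.toEquiv)
    have hle := subgp_mono (σ := σ) (Nat.le_succ n)
    have hmem : σ (n + 1) ∈ subgp σ (n + 1) :=
      Subgroup.subset_closure ⟨n + 1, by omega, le_rfl, rfl⟩
    have hcard : Nat.card (subgp σ n) ≠ Nat.card (subgp σ (n + 1)) := by
      intro h
      have := hfin (n + 1)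
      have heq := Subgroup.eq_of_le_of_card_ge hle h.ge
      refine hσ.irredundant n hn hne ?_
      rw [heq]; exact hmem
    obtain ⟨k, hk⟩ := Subgroup.card_dvd_of_le hle
    have hpos : 0 < Nat.card (subgp σ (n + 1)) := Nat.card_pos
    obtain ⟨m, rfl⟩ : ∃ m, n = m + 1 := ⟨n - 1, by omega⟩
    simp only [Nat.add_sub_cancel] at ih ⊢
    have hk2 : 2 ≤ k := by
      by_contra! hlt
      interval_cases k
      · rw [mul_zero] at hk; exact absurd hk hpos.ne'
      · rw [mul_one] at hk; exact hcard hk.symm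
    rw [pow_succ]
    nlinarith

theorem growth [Infinite Γ] (hσ : IsGeneratingSystem σ) (c t : ℕ) :
    ∃ N, ∀ n ≥ N, (c : ℕ∞) * (ball (cay σ n) t (1 : Γ)).encard < (subgp σ n : Set Γ).encard := by
  have hball : ∀ n, (c : ℕ∞) * (ball (cay σ n) t (1 : Γ)).encard =
      ((c * (ball (cay σ n) t (1 : Γ)).ncard : ℕ) : ℕ∞) := fun n => by
    rw [← ball_finite.cast_ncard_eq]; push_cast; rfl
  by_cases hfin : ∀ n, Finite (subgp σ n)
  · obtain ⟨N, hN⟩ := exists_pow_lt_two_pow c t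
    refine ⟨N + 1, fun n hn => ?_⟩
    have hf : (subgp σ n : Set Γ).Finite := Set.toFinite _
    rw [hball, ← hf.cast_ncard_eq]
    have h1 := two_pow_le_card_subgp hσ hfin (n := n) (by omega)
    have h2 := hN n (by omega)
    have h3 : c * (ball (cay σ n) t (1 : Γ)).ncard ≤ c * (2 * n + 1) ^ t :=
      Nat.mul_le_mul_left c ball_ncard_le
    have h4 : (subgp σ n : Set Γ).ncard = Nat.card (subgp σ n) := rfl
    exact_mod_cast (by omega : c * (ball (cay σ n) t (1 : Γ)).ncard < (subgp σ n : Set Γ).ncard)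
  · push Not at hfin
    obtain ⟨N, hN⟩ := hfin
    refine ⟨N, fun n hn => ?_⟩
    have hinf : (subgp σ n : Set Γ).Infinite :=
      Set.Infinite.mono (subgp_mono hn) (Set.infinite_coe_iff.1 hN)
    rw [hball, hinf.encard_eq]
    exact WithTop.coe_lt_top _

theorem exists_not_near [Infinite Γ] (hσ : IsGeneratingSystem σ) (t : ℕ) :
    ∃ N, ∀ n ≥ N, ∃ g ∈ subgp σ n, ¬ Near σ n t 1 g := by
  obtain ⟨N, hN⟩ := growth hσ 1 t
  refine ⟨N, fun n hn => ?_⟩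
  by_contra! hall
  have h1 := hN n hn
  rw [Nat.cast_one, one_mul] at h1
  exact h1.not_ge (Set.encard_le_encard fun g hg => hall g hg)

/-- The element is a suffix of length `k + 1` of a shortest word for `g`; a shorter expression for
it would shorten `g`. -/
theorem exists_dist_eq {n k : ℕ} {g : Γ} (hg : g ∈ subgp σ n) (hk : ¬ Near σ n k 1 g) :
    ∃ h, Near σ n (k + 1) 1 h ∧ ¬ Near σ n k 1 h := by
  classical
  have hex := mem_subgp_iff.1 hg
  set t := Nat.find hex with ht
  have htk : k < t := by
    by_contra! hle
    exact hk ((Nat.find_spec hex).mono hle)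
  have hgt : g ∈ gens σ n ^ t := by
    have := near_iff.1 (Nat.find_spec hex)
    rwa [inv_one, mul_one] at this
  rw [show t = (t - k - 1) + (k + 1) by omega, pow_add] at hgt
  obtain ⟨a, ha, b, hb, rfl⟩ := Set.mem_mul.1 hgt
  refine ⟨b, near_iff.2 (by rwa [inv_one, mul_one]), fun hbk => ?_⟩
  have hab : Near σ n (t - k - 1) b (a * b) := near_iff.2 (by rwa [mul_inv_cancel_right])
  exact Nat.find_min hex (show k + (t - k - 1) < t by omega) (hbk.trans hab)

/-- Choose points at distance exactly `340 rκ + 25 ri` from the identity for `i < κ` and move each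
by at most `2r` into the net. The distances stay between one and two thirds of `1000 rκ`, and differ
pairwise by at least `25r - 4r > 20r`. -/
theorem exists_separated_of_net {n r κ : ℕ} (hr : 1 ≤ r) (hκ : 1 ≤ κ) {g : Γ}
    (hg : g ∈ subgp σ n) (hgs : ¬ Near σ n (1000 * r * κ - 1) 1 g) {T : Set Γ}
    (hT : ∀ x ∈ subgp σ n, ∃ y ∈ T, (cay σ n).edist x y ≤ (2 * r : ℕ)) :
    ∃ L : Finset Γ, (L : Set Γ) ⊆ T ∧ L.card = κ ∧
      (∀ d ∈ L, ((1000 * r * κ : ℕ) : ℕ∞) ≤ 3 * (cay σ n).edist 1 d ∧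
        3 * (cay σ n).edist 1 d ≤ (2 * (1000 * r * κ) : ℕ)) ∧
      (∀ x ∈ L, ∀ d ∈ L, x ≠ d → ((20 * r : ℕ) : ℕ∞) < (cay σ n).edist x d) := by
  classical
  have hi : ∀ i < κ, r * i + r ≤ r * κ := fun i hi => by
    rw [← Nat.mul_succ]; exact Nat.mul_le_mul_left r hi
  have hpos : r ≤ r * κ := Nat.le_mul_of_pos_right r hκ
  have hs : 1000 * r * κ = 1000 * (r * κ) := mul_assoc ..
  rw [hs] at hgs ⊢
  set a := r * κ with ha
  have hpt : ∀ i, i < κ → ∃ h t, t ∈ T ∧ Near σ n (340 * a + 25 * (r * i)) 1 h ∧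
      ¬ Near σ n (340 * a + 25 * (r * i) - 1) 1 h ∧ Near σ n (2 * r) h t := by
    intro i hiκ
    have := hi i hiκ
    obtain ⟨h, h1, h2⟩ := exists_dist_eq (k := 340 * a + 25 * (r * i) - 1) hg
      fun hn => hgs (hn.mono (by omega))
    rw [show 340 * a + 25 * (r * i) - 1 + 1 = 340 * a + 25 * (r * i) by omega] at h1
    obtain ⟨t, ht, hht⟩ := hT h (by simpa using h1.mem_subgp)
    exact ⟨h, t, ht, h1, h2, hht⟩
  choose! h t htT h1 h2 hht using hpt
  have hsep : ∀ i j, i < j → j < κ → ¬ Near σ n (20 * r) (t i) (t j) := by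
    intro i j hij hj hn
    have hrij : r * i + r ≤ r * j := by rw [← Nat.mul_succ]; exact Nat.mul_le_mul_left r hij
    have := ((((h1 i (hij.trans hj)).trans (hht i (hij.trans hj))).trans hn).trans (hht j hj).symm)
    exact h2 j hj (this.mono (by omega))
  have hsep' : ∀ i < κ, ∀ j < κ, i ≠ j → ¬ Near σ n (20 * r) (t i) (t j) := by
    intro i hi j hj hne
    rcases lt_or_gt_of_ne hne with h | h
    · exact hsep i j h hj
    · exact fun hn => hsep j i h hi hn.symm
  refine ⟨(Finset.range κ).image t, ?_, ?_, ?_, ?_⟩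
  · intro x hx
    obtain ⟨i, hi, rfl⟩ := Finset.mem_image.1 (Finset.mem_coe.1 hx)
    exact htT i (Finset.mem_range.1 hi)
  · rw [Finset.card_image_of_injOn, Finset.card_range]
    intro i hi j hj hij
    by_contra hne
    refine hsep' i (by simpa using hi) j (by simpa using hj) hne ?_
    rw [hij]; exact Near.refl ..
  · intro d hd
    obtain ⟨i, hiκ, rfl⟩ := Finset.mem_image.1 hd
    have hiκ := Finset.mem_range.1 hiκ
    have hb := hi i hiκ
    constructor
    · have hlow : ¬ Near σ n (338 * a - 1) 1 (t i) := fun hn =>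
        h2 i hiκ ((hn.trans (hht i hiκ).symm).mono (by omega))
      rw [not_near] at hlow
      calc ((1000 * a : ℕ) : ℕ∞) ≤ ((3 * (338 * a - 1) : ℕ) : ℕ∞) := by
            exact_mod_cast (by omega : 1000 * a ≤ 3 * (338 * a - 1))
        _ = 3 * ((338 * a - 1 : ℕ) : ℕ∞) := by norm_num
        _ ≤ _ := mul_le_mul_right hlow.le 3
    · have hup := (h1 i hiκ).trans (hht i hiκ)
      calc 3 * (cay σ n).edist 1 (t i) ≤ 3 * ((340 * a + 25 * (r * i) + 2 * r : ℕ) : ℕ∞) :=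
            mul_le_mul_right hup 3
        _ = ((3 * (340 * a + 25 * (r * i) + 2 * r) : ℕ) : ℕ∞) := by norm_num
        _ ≤ _ := by
          exact_mod_cast (by omega : 3 * (340 * a + 25 * (r * i) + 2 * r) ≤ 2 * (1000 * a))
  · intro x hx d hd hne
    obtain ⟨i, hi, rfl⟩ := Finset.mem_image.1 hx
    obtain ⟨j, hj, rfl⟩ := Finset.mem_image.1 hd
    exact not_near.1 (hsep' i (Finset.mem_range.1 hi) j (Finset.mem_range.1 hj)
      fun h => hne (by rw [h]))

end Growth

/-! ### Existence of clean labelings -/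

namespace Params

variable {Γ : Type*} [Group Γ] {P : Params} {σ : ℕ → Γ}

/-- One level of a clean labeling: a maximal sparse set that avoids a ball around the identity. -/
theorem exists_isMaximalSparse_away {n s r ρ : ℕ} {S : Set Γ} {g : Γ}
    (hg : g ∈ subgp σ n) (hgs : ¬ Near σ n (10 * s + ρ) 1 g) (hr : 20 * s + 2 * ρ + 1 ≤ r)
    (hS : ∀ x, ∃ y ∈ S, Near σ n ρ x y) :
    ∃ T, IsMaximalSparse (cay σ n) S r T ∧ ∀ x ∈ T, ¬ Near σ n (10 * s) 1 x := by
  obtain ⟨h, h1, h2⟩ := exists_dist_eq hg hgs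
  obtain ⟨p, hp, hhp⟩ := hS h
  have hp1 : ¬ Near σ n (10 * s) 1 p := fun hn => h2 (hn.trans hhp.symm)
  obtain ⟨T, hT0, hT⟩ := exists_isMaximalSparse (σ := σ) (n := n) (r := r)
    (S := {x | x ∈ S ∧ ¬ Near σ n (10 * s) 1 x}) (T₀ := {p})
    (Set.singleton_subset_iff.2 ⟨hp, hp1⟩) (by
      rintro x rfl y rfl _; rfl)
  obtain ⟨ht1, ht2, ht3⟩ := isMaximalSparse_iff.1 hT
  refine ⟨T, isMaximalSparse_iff.2 ⟨fun x hx => (ht1 hx).1, ht2, fun x hx => ?_⟩,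
    fun x hx => (ht1 hx).2⟩
  by_cases hx1 : Near σ n (10 * s) 1 x
  -- The single point `p` dominates all of the excluded ball: the distance is at most `10s + (10s +
  -- ρ + 1) + ρ`, the bound in `hr`.
  · exact ⟨p, hT0 rfl, ((hx1.symm.trans h1).trans hhp).mono (by omega)⟩
  · exact ht3 x ⟨hx, hx1⟩

theorem exists_clean [Countable Γ] (R : P.Rules σ)
    (hfar : ∀ m, 1 ≤ m → ∃ g ∈ subgp σ (P.f m), ¬ Near σ (P.f m) (20 * P.s m) 1 g) :
    ∃ Θ : Γ → P.Label, P.Clean σ Θ := by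
  -- The net property is carried through the recursion, as it supplies a point outside the forbidden
  -- ball at the next level.
  let X : ℕ → Type _ := fun m =>
    {S : Set Γ // ∀ k, (1 ≤ m → P.f m ≤ k) → ∀ x, ∃ y ∈ S, Near σ k (P.r m + P.r m / 2) x y}
  have hstep : ∀ m (S : X m), ∃ S' : X (m + 1),
      IsMaximalSparse (cay σ (P.f (m + 1))) S.1 (P.r (m + 1)) S'.1 ∧
      ∀ x ∈ S'.1, ¬ Near σ (P.f (m + 1)) (10 * P.s (m + 1)) 1 x := by
    rintro m ⟨S, hS⟩
    obtain ⟨g, hg, hgs⟩ := hfar (m + 1) (by omega)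
    have hrs : 100 * P.r m ≤ P.s (m + 1) := by
      rcases Nat.eq_zero_or_pos m with rfl | hm
      · simp [R.r_zero]
      · have := R.r_le_s hm; omega
    have hrr := R.s_le_r (m := m + 1) (by omega)
    have hS' := hS (P.f (m + 1)) (fun hm => (R.f_lt m hm).le)
    obtain ⟨T, hT1, hT2⟩ := exists_isMaximalSparse_away (s := P.s (m + 1)) (r := P.r (m + 1))
      (ρ := P.r m + P.r m / 2) hg (fun hn => hgs (hn.mono (by omega))) (by omega) hS'
    refine ⟨⟨T, fun k hk x => ?_⟩, hT1, hT2⟩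
    obtain ⟨y, hy, hxy⟩ := hS' x
    obtain ⟨w, hw, hyw⟩ := (isMaximalSparse_iff.1 hT1).2.2 y hy
    exact ⟨w, hw, ((hxy.trans hyw).level_mono (hk (by omega))).mono (by omega)⟩
  choose next hnext1 hnext2 using hstep
  let T : ∀ m, X m := fun m => Nat.rec
    ⟨Set.univ, fun _ _ x => ⟨x, trivial, Near.refl ..⟩⟩ (fun m S => next m S) m
  have hmax : ∀ m, IsMaximalSparse (cay σ (P.f (m + 1))) (T m).1 (P.r (m + 1)) (T (m + 1)).1 :=
    fun m => hnext1 m (T m)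
  have haway : ∀ m, ∀ x ∈ (T (m + 1)).1, ¬ Near σ (P.f (m + 1)) (10 * P.s (m + 1)) 1 x :=
    fun m => hnext2 m (T m)
  have hcol : ∀ m, ∃ col : Γ → Fin (P.card (m + 1)),
      (∀ x, col x = P.q (m + 1) ↔ x ∈ (T (m + 1)).1) ∧
      ∀ x y, x ≠ y → Near σ (P.f (m + 1)) (P.r m) x y → col x ≠ col y := by
    intro m
    obtain ⟨col, h1, h2, h3⟩ := exists_coloring (R.card_gt (m := m + 1) (by omega)) (P.q (m + 1))
      (T (m + 1)).1 (fun _ => P.q (m + 1)) (fun x hx y hy hne hxy =>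
        absurd ((isMaximalSparse_iff.1 (hmax m)).2.1 x hx y hy
          (hxy.mono (R.r_mono (by omega)))) hne)
    refine ⟨col, fun x => ⟨fun h => ?_, h1 x⟩, h3⟩
    by_contra hx
    exact h2 x hx h
  choose col hcol1 hcol2 using hcol
  let Θ : Γ → P.Label := fun x => (fun _ => false, fun m =>
    match m with
    | 0 => P.q 0
    | m + 1 => col m x)
  have hQ : ∀ m, P.Q Θ (m + 1) = (T (m + 1)).1 := fun m => by
    ext x; exact hcol1 m x
  have hmaxQ : ∀ m, IsMaximalSparse (cay σ (P.f (m + 1))) (P.Q Θ m) (P.r (m + 1))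
      (P.Q Θ (m + 1)) := by
    intro m
    rw [hQ]
    cases m with
    | zero => rw [R.Q_zero]; exact hmax 0
    | succ m => rw [hQ]; exact hmax (m + 1)
  refine ⟨Θ, ⟨?_, ?_, ?_, ?_⟩⟩
  · rw [← R.Q_zero Θ]; exact hmaxQ 0
  · intro m hm
    obtain ⟨k, rfl⟩ : ∃ k, m = k + 1 := ⟨m - 1, by omega⟩
    exact hmaxQ k
  · intro m hm x y hne hxy
    obtain ⟨k, rfl⟩ : ∃ k, m = k + 1 := ⟨m - 1, by omega⟩
    exact hcol2 k x y hne hxy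
  · intro m hm x hx
    obtain ⟨k, rfl⟩ : ∃ k, m = k + 1 := ⟨m - 1, by omega⟩
    rw [hQ] at hx
    exact not_near.1 (haway k x hx)

end Params
end FreeMinimal

/-! ### Existence of parameters -/

namespace FreeMinimal

section Levels

variable {Γ : Type*} [Group Γ] {σ : ℕ → Γ}

theorem exists_radius_encard_le {n k : ℕ} (h : (k : ℕ∞) ≤ (subgp σ n : Set Γ).encard) :
    ∃ t₀, ∀ t ≥ t₀, (k : ℕ∞) ≤ (ball (cay σ n) t (1 : Γ)).encard := by
  obtain ⟨S, hS, hcard⟩ := Set.exists_subset_encard_eq h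
  have hfin : S.Finite := Set.finite_of_encard_eq_coe hcard
  choose! d hd using fun g (hg : g ∈ subgp σ n) => mem_subgp_iff.1 hg
  obtain ⟨t₀, ht₀⟩ := (hfin.image d).bddAbove
  refine ⟨t₀, fun t ht => ?_⟩
  rw [← hcard]
  exact Set.encard_le_encard fun g hg =>
    (hd g (hS hg)).mono ((ht₀ (Set.mem_image_of_mem d hg)).trans ht)

/-- The order of choice matters: `f` makes `Γ_f` large compared with the ball of radius `5s`, then
`r` makes a ball in `Γ_f` that large, then `c` exceeds the ball of radius `r`. -/
theorem exists_level [Infinite Γ] (hσ : IsGeneratingSystem σ) (m s f₀ r₀ : ℕ) :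
    ∃ f r c : ℕ, f₀ < f ∧ r₀ ≤ r ∧
      10 ^ m * (ball (cay σ f) (5 * s) (1 : Γ)).encard < (subgp σ f : Set Γ).encard ∧
      10 ^ m * (ball (cay σ f) (5 * s) (1 : Γ)).encard ≤
        (ball (cay σ f) (r / 10) (1 : Γ)).encard ∧
      (ball (cay σ f) r (1 : Γ)).ncard < c ∧ ∃ g ∈ subgp σ f, ¬ Near σ f (20 * s) 1 g := by
  obtain ⟨N₁, h₁⟩ := growth hσ (10 ^ m) (5 * s)
  obtain ⟨N₂, h₂⟩ := exists_not_near hσ (20 * s)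
  set f := max (f₀ + 1) (max N₁ N₂) with hf
  have hlt := h₁ f (by omega)
  have hlt' := hlt
  rw [← ball_finite.cast_ncard_eq] at hlt'
  obtain ⟨t₀, ht₀⟩ := exists_radius_encard_le (k := 10 ^ m * (ball (cay σ f) (5 * s) (1 : Γ)).ncard)
    (by push_cast at hlt' ⊢; exact hlt'.le)
  have hball := ht₀ (max r₀ (10 * t₀) / 10) (by omega)
  rw [Nat.cast_mul, ball_finite.cast_ncard_eq] at hball
  exact ⟨f, max r₀ (10 * t₀), _, by omega, le_max_left .., by push_cast at hlt; exact hlt,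
    by push_cast at hball; exact hball, Nat.lt_succ_self _, h₂ f (by omega)⟩

/-- The parameters of one level, with the product of the numbers of labels and the sum of the radii
up to this level. -/
structure LevelData where
  s : ℕ
  r : ℕ
  f : ℕ
  card : ℕ
  prod : ℕ
  sum : ℕ

/-- The number of labeled balls on a level. -/
noncomputable def LevelData.types (σ : ℕ → Γ) (D : LevelData) (m : ℕ) : ℕ :=
  (2 ^ m * D.prod) ^ (ball (cay σ D.f) D.s (1 : Γ)).ncard

/-- `D m` describes level `m + 1`. Carrying the product and the sum along makes each level
computable from the preceding one alone. -/
theorem exists_levels [Infinite Γ] (hσ : IsGeneratingSystem σ) (thr : ℕ → ℕ) :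
    ∃ D : ℕ → LevelData, (D 0).s = 10 ∧ (D 0).prod = (D 0).card ∧ (D 0).sum = 10 ∧
      (∀ m, (D m).s < (D m).r ∧
        10 ^ (m + 1) * (ball (cay σ (D m).f) (5 * (D m).s) (1 : Γ)).encard <
          (subgp σ (D m).f : Set Γ).encard ∧
        10 ^ (m + 1) * (ball (cay σ (D m).f) (5 * (D m).s) (1 : Γ)).encard ≤
          (ball (cay σ (D m).f) ((D m).r / 10) (1 : Γ)).encard ∧
        (ball (cay σ (D m).f) (D m).r (1 : Γ)).ncard < (D m).card ∧
        ∃ g ∈ subgp σ (D m).f, ¬ Near σ (D m).f (20 * (D m).s) 1 g) ∧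
      ∀ m, (D (m + 1)).s = 1000 * (D m).r * (D m).types σ (m + 1) ∧
        (D m).f < (D (m + 1)).f ∧ thr ((D (m + 1)).s) < (D (m + 1)).f ∧
        1000 * (D (m + 1)).sum ≤ (D (m + 1)).r ∧
        (D (m + 1)).prod = (D m).prod * (D (m + 1)).card ∧
        (D (m + 1)).sum = (D m).sum + (5 * (D m).r + (D (m + 1)).s) := by
  choose F r c h using exists_level hσ
  let mk : ℕ → ℕ → ℕ → ℕ → ℕ → ℕ → LevelData := fun m s f₀ r₀ K S =>
    ⟨s, r m s f₀ (max (s + 1) r₀), F m s f₀ (max (s + 1) r₀), c m s f₀ (max (s + 1) r₀),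
      K * c m s f₀ (max (s + 1) r₀), S⟩
  let next : ℕ → LevelData → LevelData := fun m D =>
    let s' := 1000 * D.r * D.types σ (m + 1)
    let S' := D.sum + (5 * D.r + s')
    mk (m + 2) s' (max D.f (thr s')) (1000 * S') D.prod S'
  let D : ℕ → LevelData := fun m => Nat.rec (mk 1 10 0 0 1 10) next m
  have hmk : ∀ m, ∃ s f₀ r₀ K S, D m = mk (m + 1) s f₀ r₀ K S := by
    intro m
    cases m with
    | zero => exact ⟨_, _, _, _, _, rfl⟩
    | succ m => exact ⟨_, _, _, _, _, rfl⟩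
  refine ⟨D, rfl, one_mul _, rfl, fun m => ?_, fun m => ⟨rfl, ?_, ?_, ?_, rfl, rfl⟩⟩
  · obtain ⟨s, f₀, r₀, K, S, hD⟩ := hmk m
    rw [hD]
    obtain ⟨-, h2, h3⟩ := h (m + 1) s f₀ (max (s + 1) r₀)
    exact ⟨lt_of_lt_of_le (Nat.lt_succ_self s) ((le_max_left ..).trans h2), h3⟩
  · exact lt_of_le_of_lt (le_max_left ..) (h _ _ _ _).1
  · exact lt_of_le_of_lt (le_max_right ..) (h _ _ _ _).1
  · exact (le_max_right ..).trans (h _ _ _ _).2.1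

end Levels

namespace Params

variable {Γ : Type*} [Group Γ] {σ : ℕ → Γ}

/-- With `s_{m+1}` equal to `1000 r_m κ_m`, one threshold serves both the distance rule and the net
rule: beyond it `Γ_n` has a point far enough out for `exists_separated_of_net`. -/
theorem exists_rules [Infinite Γ] (hσ : IsGeneratingSystem σ) : ∃ P : Params, P.Rules σ ∧
    ∀ m, 1 ≤ m → ∃ g ∈ subgp σ (P.f m), ¬ Near σ (P.f m) (20 * P.s m) 1 g := by
  choose thr hthr using exists_not_near hσ
  obtain ⟨D, hs, hK, hS, hlev, hsucc⟩ := exists_levels hσ thr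
  let card : ℕ → ℕ := fun m =>
    match m with
    | 0 => 1
    | m + 1 => (D m).card
  have hcard : ∀ m, 0 < card m := fun m =>
    match m with
    | 0 => one_pos
    | m + 1 => (Nat.zero_le _).trans_lt (hlev m).2.2.2.1
  let P : Params := {
    s := fun m => (D (m - 1)).s
    r := fun m =>
      match m with
      | 0 => 0
      | m + 1 => (D m).r
    f := fun m => (D (m - 1)).f
    card := card
    thr := thr
    q := fun m => ⟨0, hcard m⟩ }
  have hprod : ∀ m, ∏ j ∈ Finset.Icc 1 (m + 1), P.card j = (D m).prod := by
    intro m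
    induction m with
    | zero => simpa using hK.symm
    | succ m ih =>
      rw [Finset.prod_Icc_succ_top (by omega), ih, (hsucc m).2.2.2.2.1]
  have hsum : ∀ m, ∑ j ∈ Finset.Icc 1 (m + 1), (5 * P.r (j - 1) + P.s j) = (D m).sum := by
    intro m
    induction m with
    | zero =>
      rw [zero_add, Finset.Icc_self, Finset.sum_singleton, hS]
      change 5 * 0 + (D 0).s = 10
      rw [hs]
    | succ m ih =>
      rw [Finset.sum_Icc_succ_top (by omega), ih, (hsucc m).2.2.2.2.2]; rfl
  have hkap : ∀ m, P.kap σ (m + 1) = (D m).types σ (m + 1) := by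
    intro m
    rw [kap, hprod]; rfl
  have htypes : ∀ m, 1 ≤ (D m).types σ (m + 1) := fun m => by
    rw [← hkap]
    exact Nat.pos_of_ne_zero (pow_ne_zero _ (Nat.mul_ne_zero (by simp)
      (Finset.prod_ne_zero_iff.2 fun j _ => (hcard j).ne')))
  have hsm : ∀ m, 1000 * P.r (m + 1) * P.kap σ (m + 1) = P.s (m + 1 + 1) := fun m => by
    rw [hkap]; exact (hsucc m).1.symm
  have hrpos : ∀ m, 1 ≤ P.r (m + 1) := fun m => (Nat.zero_le _).trans_lt (hlev m).1
  have hidx : ∀ {p : ℕ → Prop}, (∀ m, p (m + 1)) → ∀ m, 1 ≤ m → p m := fun {p} h m hm => by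
    obtain ⟨k, rfl⟩ : ∃ k, m = k + 1 := ⟨m - 1, by omega⟩
    exact h k
  refine ⟨P, ⟨rfl, rfl, hs, hidx fun m => (hlev m).1, hidx fun m => ?_, hidx fun m => (hsucc m).2.1,
    fun T _ n hn => ?_, hidx fun m => (hsm m).le, hidx fun m => ?_, hidx fun m => ?_,
    hidx fun m => (hlev m).2.1, hidx fun m => ?_, hidx fun m => (hlev m).2.2.1,
    hidx fun m => (hlev m).2.2.2.1⟩, hidx fun m => (hlev m).2.2.2.2⟩
  · rw [← hsm, hkap, mul_assoc]
    have := Nat.le_mul_of_pos_right (P.r (m + 1)) (htypes m)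
    have := hrpos m
    omega
  · obtain ⟨g, hg, hgT⟩ := hthr T n hn
    refine ⟨g, hg, ?_⟩
    rw [SimpleGraph.edist_comm]
    exact (not_near.1 hgT).le
  · intro n hn T _ hT
    obtain ⟨g, hg, hgT⟩ := hthr _ n hn
    have := exists_separated_of_net (hrpos m) (by rw [hkap]; exact htypes m) hg
      (fun h => hgT (h.mono (Nat.sub_le ..))) hT
    rwa [hsm] at this
  · rw [hsm]; exact (hsucc m).2.2.1
  · rw [hsum]; exact (hsucc m).2.2.2.1

end Params

end FreeMinimal

theorem mainTheorem7 {Γ : Type*} [Group Γ] [Countable Γ] [Infinite Γ] :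
    (∃ σ : ℕ → Γ, IsGeneratingSystem σ) ∧
    ∀ σ : ℕ → Γ, IsGeneratingSystem σ →
      (∃ P : Params, P.Rules σ ∧ ∃ Θ : Γ → P.Label, P.Clean σ Θ) ∧
      ∀ P : Params, P.Rules σ → ∀ Θ : Γ → P.Label, P.Clean σ Θ →
        Nonempty (P.Construction σ Θ) ∧
        ∀ C : P.Construction σ Θ, ∃ Θinf : Γ → P.Label,
          (∀ g : Γ, ∃ N, ∀ n, N ≤ n → C.lab n g = Θinf g) ∧
          P.Clean σ Θinf ∧
          IsFreeOn (orbitClosure Θinf) ∧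
          IsMinimalSubshift (orbitClosure Θinf) := by
  refine ⟨exists_isGeneratingSystem, fun σ hσ => ⟨?_, fun P R Θ hΘ =>
    ⟨Params.nonempty_construction R hΘ, fun C => ?_⟩⟩⟩
  · obtain ⟨P, R, hfar⟩ := Params.exists_rules hσ
    exact ⟨P, R, Params.exists_clean R hfar⟩
  · obtain ⟨Θ', h⟩ := C.exists_isLimit R hσ hΘ
    have hc := h.clean R hσ fun n hn => (C.good R hΘ hn).clean
    refine ⟨Θ', fun g => ?_, hc, hc.isFreeOn R hσ, C.isMinimalSubshift R hσ hΘ h⟩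
    obtain ⟨n, -, hn⟩ := h.eventually R hσ (Set.finite_singleton g)
    exact ⟨n, fun k hk => hn k hk g rfl⟩
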